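/- Let $n\ge 1$. Let $\mathbb S^{n+1}=\{x\in\mathbb R^{n+2}:\langle x,x\rangle_0=1\}$ and endow $\mathbb S^{n+1}\times\mathbb R$ with the Lorentzian metric $\langle\cdot,\cdot\rangle_1=\langle\cdot,\cdot\rangle_0-dt^2$. For an immersion of an $n$-manifold with non-degenerate induced metric, the second fundamental form is $h(X,Y)=(D_XY)^\perp$ ($D$ the Levi-Civita connection of the ambient space) and the mean curvature vector $\vec H$ is its trace with respect to the induced metric. An immersion into $\mathbb S^{n+1}\times\mathbb R$ is *spacelike* if the induced metric is positive definite; it has *null second fundamental form* if $\langle h(X,Y),h(X,Y)\rangle_1=0$ for all $X,Y$; it is *marginally trapped* if it is spacelike and $\langle\vec H,\vec H\rangle_1\equiv 0$. Let $\mathcal M$ be a smooth $n$-dimensional manifold. 1. If $n\ge 2$, every $C^2$ immersion $\mathcal M\to\mathbb S^{n+1}\times\mathbb R$ with non-degenerate induced metric and null second fundamental form is totally geodesic ($h\equiv 0$). 2. Let $\varphi:\mathcal M\to\mathbb S^{n+1}$ be a $C^4$ immersion with Gauss map $\nu$ (a $C^3$ unit normal field), let $\kappa_1,\dots,\kappa_p$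 be its distinct principal curvatures at a point $x$ (the eigenvalues of the shape operator $A=-d\nu$; $p$ may depend on $x$), with multiplicities $m_1,\dots,m_p$, and put $$P_x(s)=\sum_{i=1}^p m_i(\kappa_i s+1)\prod_{j\ne i}(s-\kappa_j).$$ Then $P_x$ has exactly $p-1$ distinct real roots if the mean curvature of $\varphi$ vanishes at $x$, and exactly $p$ otherwise. For every continuous function $s$ with $P_x(s(x))=0$ for all $x\in\mathcal M$, the map $$\bar\varphi_s=\Big(\frac{s\varphi+\nu}{\sqrt{1+s^2}},\ \cot^{-1}s\Big):\mathcal M\to\mathbb S^{n+1}\times\mathbb R,\qquad \cot^{-1}:\mathbb R\to(0,\pi),$$ is a marginally trapped immersion of class $C^2$. If the number $p$ of distinct principal curvatures is constant on $\mathcal M$, then the roots of $P_x$ are the values at $x$ of continuous functions $s_1,\dots,s_{p-1}$ on $\mathcal M$ if $\varphi$ is minimal, and $s_1,\dots,s_p$ if the mean curvature of $\varphi$ vanishes nowhere, these values being pairwise distinct at each point; so one gets $p-1$, respectively $p$, marginally trapped immersions $\bar\varphi_{s_i}$. 3. Conversely, let $\bar\varphi:\mathcal M\to\mathbb S^{n+1}\times\mathbb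 R$ be a marginally trapped immersion of class $C^5$. Let $x\in\mathcal M$ be a point near which $\langle\vec H,\xi\rangle_1=0$ for some continuous nowhere vanishing null normal field $\xi$ along $\bar\varphi$. Then near $x$ the immersion $\bar\varphi$ coincides, up to a vertical translation $(q,t)\mapsto(q,t+c)$, with some $\bar\varphi_s$ as in part 2, where $\varphi$ is a $C^4$ immersion into $\mathbb S^{n+1}$ with Gauss map $\nu$ and $s$ is a continuous root of its polynomial. The points near which $\bar\varphi$ is of this form contain an open dense subset of $\mathcal M$ which contains every point where $\vec H\ne 0$. 4. Let $n=2$, and let $\varphi$ be a $C^4$ immersion of a surface $\mathcal M$ into $\mathbb S^3$ with Gauss map $\nu$, without umbilic points and with nowhere vanishing mean curvature, with principal curvatures $\kappa_1\neq\kappa_2$. With $a=\dfrac{\kappa_1\kappa_2-1}{\kappa_1+\kappa_2}$, the two maps into $\mathbb S^3\times\mathbb R$ $$\bar\varphi_\pm=\Big(\frac{(a\pm\sqrt{a^2+1})\varphi+\nu}{\sqrt2\sqrt{a^2+1\pm a\sqrt{a^2+1}}},\ \cot^{-1}\big(a\pm\sqrt{a^2+1}\big)\Big)$$ are marginally trapped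 immersions. All of this holds as well with any open subset of $\mathcal M$ in place of $\mathcal M$. -/

import Mathlib

open scoped Manifold ContDiff
open Polynomial

noncomputable section

namespace MarginallyTrapped

/-! ### Extrinsic geometry of immersions into a submanifold of a flat pseudo-Euclidean space

`V` is a vector space with a symmetric bilinear form `B`; the ambient manifold `𝒩 ⊆ V` enters only
through its tangent spaces `W p ⊆ V`.  Its Levi-Civita connection is the tangential part of the flat
derivative of `V`. -/

section Extrinsic

variable {n : ℕ} {M : Type*} [TopologicalSpace M] [ChartedSpace (EuclideanSpace ℝ (Fin n)) M]
variable {V : Type*} [NormedAddCommGroup V] [NormedSpace ℝ V]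

/-- The differential of `f : M → V` at `x`; the tangent space at `x` is identified with `ℝⁿ` by the
preferred chart at `x`, as everywhere in Mathlib. -/
def diff (f : M → V) (x : M) : EuclideanSpace ℝ (Fin n) →L[ℝ] V :=
  mfderiv (𝓡 n) 𝓘(ℝ, V) f x

/-- The second derivative of `f : M → V` at `x` in the preferred chart at `x`, that is, the flat
derivative `D_X (df (Y))` for the coordinate vector fields `X`, `Y` with values `v`, `w` at `x`.
Another extension of `w` changes it by a vector tangent to `f` only. -/
def diff2 (f : M → V) (x : M) (v w : EuclideanSpace ℝ (Fin n)) : V :=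
  fderiv ℝ (fderiv ℝ (f ∘ (extChartAt (𝓡 n) x).symm)) (extChartAt (𝓡 n) x x) v w

/-- First fundamental form of `f` at `x`. -/
def firstForm (B : LinearMap.BilinForm ℝ V) (f : M → V) (x : M)
    (v w : EuclideanSpace ℝ (Fin n)) : ℝ :=
  B (diff f x v) (diff f x w)

/-- The normal space of `f` at `x`: the vectors tangent to the ambient manifold at `f x` which are
`B`-orthogonal to the image of the differential. -/
def normalSpace (n : ℕ) [ChartedSpace (EuclideanSpace ℝ (Fin n)) M]
    (B : LinearMap.BilinForm ℝ V) (W : V → Submodule ℝ V)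
    (f : M → V) (x : M) : Submodule ℝ V :=
  W (f x) ⊓ B.orthogonal (LinearMap.range (diff (n := n) f x).toLinearMap)

open Classical in
/-- `B`-orthogonal projection to `N`: the vector of `N` whose `B`-products with the elements of `N`
are those of `u` (it exists and is unique when `B` is nondegenerate on `N`). -/
def orthProj (B : LinearMap.BilinForm ℝ V) (N : Submodule ℝ V) (u : V) : V :=
  if h : ∃ ξ ∈ N, ∀ η ∈ N, B ξ η = B u η then h.choose else 0

/-- Second fundamental form `h(v, w) = (D_v w)^⊥`.  (The component of the flat derivative normal to
the ambient manifold is orthogonal to the normal space, so that projecting it out first makes no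
difference.) -/
def secondForm (B : LinearMap.BilinForm ℝ V) (W : V → Submodule ℝ V) (f : M → V) (x : M)
    (v w : EuclideanSpace ℝ (Fin n)) : V :=
  orthProj B (normalSpace n B W f x) (diff2 f x v w)

/-- Gram matrix of the first fundamental form in the standard basis. -/
def gram (B : LinearMap.BilinForm ℝ V) (f : M → V) (x : M) : Matrix (Fin n) (Fin n) ℝ :=
  Matrix.of fun i j => firstForm B f x (EuclideanSpace.single i 1) (EuclideanSpace.single j 1)

/-- Mean curvature vector: the trace of the second fundamental form with respect to the first. -/
def meanCurvature (n : ℕ) [ChartedSpace (EuclideanSpace ℝ (Fin n)) M]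
    (B : LinearMap.BilinForm ℝ V) (W : V → Submodule ℝ V) (f : M → V) (x : M) : V :=
  ∑ i : Fin n, ∑ j : Fin n, (gram B f x)⁻¹ i j •
    secondForm B W f x (EuclideanSpace.single i 1) (EuclideanSpace.single j 1)

end Extrinsic

/-! ### The sphere `𝕊ⁿ⁺¹ ⊆ ℝⁿ⁺²` and the Lorentzian product `𝕊ⁿ⁺¹ × ℝ ⊆ ℝⁿ⁺² × ℝ` -/

/-- `ℝⁿ⁺²` with the Euclidean inner product. -/
abbrev Euc (n : ℕ) : Type := EuclideanSpace ℝ (Fin (n + 2))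

/-- The inner product of `ℝⁿ⁺²` as a bilinear form. -/
def eucForm (n : ℕ) : LinearMap.BilinForm ℝ (Euc n) := innerₗ (Euc n)

/-- The tangent space of `𝕊ⁿ⁺¹` at `p`. -/
def sphereTangent (n : ℕ) (p : Euc n) : Submodule ℝ (Euc n) := (ℝ ∙ p)ᗮ

/-- The Lorentzian form `⟨u, v⟩ - a b` on `ℝⁿ⁺² × ℝ`. -/
def lorForm (n : ℕ) : LinearMap.BilinForm ℝ (Euc n × ℝ) :=
  (eucForm n).comp (LinearMap.fst ℝ _ _) (LinearMap.fst ℝ _ _) -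
    (LinearMap.mul ℝ ℝ).compl₁₂ (LinearMap.snd ℝ _ _) (LinearMap.snd ℝ _ _)

/-- The tangent space of `𝕊ⁿ⁺¹ × ℝ` at `q`. -/
def productTangent (n : ℕ) (q : Euc n × ℝ) : Submodule ℝ (Euc n × ℝ) :=
  (sphereTangent n q.1).prod ⊤

section Geometry

variable {n : ℕ} {M : Type*} [TopologicalSpace M] [ChartedSpace (EuclideanSpace ℝ (Fin n)) M]

/-- On `U`, `F` is an immersion of class `C^k` into `𝕊ⁿ⁺¹ × ℝ` with nondegenerate induced
metric (nondegeneracy makes the differential injective). -/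
structure IsNondegenerateOn (k : WithTop ℕ∞) (F : M → Euc n × ℝ) (U : Set M) : Prop where
  contMDiffOn : ContMDiffOn (𝓡 n) 𝓘(ℝ, Euc n × ℝ) k F U
  mem : ∀ x ∈ U, ‖(F x).1‖ = 1
  nondegenerate : ∀ x ∈ U, ∀ v : EuclideanSpace ℝ (Fin n),
    (∀ w, firstForm (lorForm n) F x v w = 0) → v = 0

/-- On `U`, `F` is a spacelike immersion of class `C^k` into `𝕊ⁿ⁺¹ × ℝ`. -/
structure IsSpacelikeOn (k : WithTop ℕ∞) (F : M → Euc n × ℝ) (U : Set M) : Prop where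
  contMDiffOn : ContMDiffOn (𝓡 n) 𝓘(ℝ, Euc n × ℝ) k F U
  mem : ∀ x ∈ U, ‖(F x).1‖ = 1
  spacelike : ∀ x ∈ U, ∀ v : EuclideanSpace ℝ (Fin n), v ≠ 0 → 0 < firstForm (lorForm n) F x v v

/-- The second fundamental form of `F` in `𝕊ⁿ⁺¹ × ℝ`. -/
abbrev secondFormL (F : M → Euc n × ℝ) (x : M) (v w : EuclideanSpace ℝ (Fin n)) : Euc n × ℝ :=
  secondForm (lorForm n) (productTangent n) F x v w

/-- The mean curvature vector of `F` in `𝕊ⁿ⁺¹ × ℝ`. -/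
abbrev meanCurvatureL (F : M → Euc n × ℝ) (x : M) : Euc n × ℝ :=
  meanCurvature n (lorForm n) (productTangent n) F x

/-- On `U`, the second fundamental form of `F` takes null values. -/
def HasNullSecondFormOn (F : M → Euc n × ℝ) (U : Set M) : Prop :=
  ∀ x ∈ U, ∀ v w, lorForm n (secondFormL F x v w) (secondFormL F x v w) = 0

/-- On `U`, `F` is totally geodesic. -/
def IsTotallyGeodesicOn (F : M → Euc n × ℝ) (U : Set M) : Prop :=
  ∀ x ∈ U, ∀ v w, secondFormL F x v w = 0

/-- On `U`, `F` is a spacelike marginally trapped immersion of class `C^k`: the mean curvature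
vector is null (possibly zero). -/
def IsMarginallyTrappedOn (k : WithTop ℕ∞) (F : M → Euc n × ℝ) (U : Set M) : Prop :=
  IsSpacelikeOn k F U ∧
    ∀ x ∈ U, lorForm n (meanCurvatureL F x) (meanCurvatureL F x) = 0

/-- On `U`, `ξ` is a continuous nowhere vanishing null normal field along `F`. -/
def IsNullNormalOn (F ξ : M → Euc n × ℝ) (U : Set M) : Prop :=
  ContinuousOn ξ U ∧ ∀ x ∈ U, ξ x ≠ 0 ∧ lorForm n (ξ x) (ξ x) = 0 ∧
    ξ x ∈ normalSpace n (lorForm n) (productTangent n) F x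

/-- On `U`, `φ` is an immersion of class `C⁴` into `𝕊ⁿ⁺¹` with Gauss map `ν` (a unit normal field of
class `C³`). -/
structure IsHypersurfaceOn (φ ν : M → Euc n) (U : Set M) : Prop where
  contMDiffOn : ContMDiffOn (𝓡 n) 𝓘(ℝ, Euc n) 4 φ U
  mem : ∀ x ∈ U, ‖φ x‖ = 1
  immersion : ∀ x ∈ U, Function.Injective (diff (n := n) φ x)
  gauss_contMDiffOn : ContMDiffOn (𝓡 n) 𝓘(ℝ, Euc n) 3 ν U
  gauss_unit : ∀ x ∈ U, ‖ν x‖ = 1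
  gauss_normal : ∀ x ∈ U, ν x ∈ normalSpace n (eucForm n) (sphereTangent n) φ x

/-- The mean curvature vector of `φ` in `𝕊ⁿ⁺¹`. -/
abbrev meanCurvatureS (φ : M → Euc n) (x : M) : Euc n :=
  meanCurvature n (eucForm n) (sphereTangent n) φ x

/-- The eigenspace `{v | A v = κ v}` of the shape operator `A`, which is given by
`dφ (A v) = - dν (v)`. -/
def principalSpace (φ ν : M → Euc n) (x : M) (κ : ℝ) : Submodule ℝ (EuclideanSpace ℝ (Fin n)) :=
  LinearMap.ker ((diff ν x).toLinearMap + κ • (diff φ x).toLinearMap)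

/-- The set of (distinct) principal curvatures at `x`. -/
def principalCurvatures (φ ν : M → Euc n) (x : M) : Set ℝ :=
  {κ | principalSpace φ ν x κ ≠ ⊥}

/-- The multiplicity of a principal curvature. -/
def principalMult (φ ν : M → Euc n) (x : M) (κ : ℝ) : ℕ :=
  Module.finrank ℝ (principalSpace φ ν x κ)

/-- The polynomial `P(s) = ∑ᵢ mᵢ (κᵢ s + 1) ∏_{j ≠ i} (s - κⱼ)` at the point `x`. -/
def trapPoly (φ ν : M → Euc n) (x : M) : ℝ[X] :=
  ∑ᶠ κ ∈ principalCurvatures φ ν x,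
    C (principalMult φ ν x κ : ℝ) * (C κ * X + 1) *
      ∏ᶠ μ ∈ principalCurvatures φ ν x \ {κ}, (X - C μ)

/-- The inverse cotangent with values in `(0, π)`. -/
def arccot (s : ℝ) : ℝ := Real.pi / 2 - Real.arctan s

/-- The map `((s φ + ν) / √(1 + s²), cot⁻¹ s)`. -/
def nullLift (φ ν : M → Euc n) (s : M → ℝ) (x : M) : Euc n × ℝ :=
  ((Real.sqrt (1 + s x ^ 2))⁻¹ • (s x • φ x + ν x), arccot (s x))

/-- On `U`, `s` is a continuous root of `P`. -/
def IsRootFunctionOn (φ ν : M → Euc n) (s : M → ℝ) (U : Set M) : Prop :=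
  ContinuousOn s U ∧ ∀ x ∈ U, (trapPoly φ ν x).IsRoot (s x)

/-- Near `x`, up to a vertical translation of `𝕊ⁿ⁺¹ × ℝ`, `F` is the map associated with a
hypersurface of `𝕊ⁿ⁺¹` and a root of its polynomial. -/
def IsLocallyNullLift (F : M → Euc n × ℝ) (x : M) : Prop :=
  ∃ N : Set M, IsOpen N ∧ x ∈ N ∧ ∃ (φ ν : M → Euc n) (s : M → ℝ) (c : ℝ),
    IsHypersurfaceOn φ ν N ∧ IsRootFunctionOn φ ν s N ∧
      ∀ y ∈ N, ((F y).1, (F y).2 + c) = nullLift φ ν s y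

/-- `a = (κ₁ κ₂ - 1) / (κ₁ + κ₂)`. -/
def surfaceParam (κ₁ κ₂ : M → ℝ) (x : M) : ℝ :=
  (κ₁ x * κ₂ x - 1) / (κ₁ x + κ₂ x)

/-- The explicit map of the surface case, where `ε = 1` or `ε = -1` is the sign. -/
def surfaceLift (ε : ℝ) (φ ν : M → Euc n) (a : M → ℝ) (x : M) : Euc n × ℝ :=
  ((Real.sqrt 2 * Real.sqrt (a x ^ 2 + 1 + ε * (a x * Real.sqrt (a x ^ 2 + 1))))⁻¹ •
      ((a x + ε * Real.sqrt (a x ^ 2 + 1)) • φ x + ν x),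
    arccot (a x + ε * Real.sqrt (a x ^ 2 + 1)))

end Geometry

end MarginallyTrapped

end

/-!
The normal space of an immersion `F` of codimension two into `𝕊ⁿ⁺¹ × ℝ`, at a point where the
induced metric is nondegenerate and a nonzero null normal exists, is spanned by two null vectors
`(N, 1)` and `(N', 1)`, with `N`, `N'` unit vectors. A normal vector is null exactly when it is
orthogonal to one of the two. The null normal direction solves smooth equations with invertible
linearization, so it extends to a field with one derivative fewer than `F`, and along it
`⟨h(v, w), (N, 1)⟩ = -⟪T v, R w⟫`, where `R = d(pr₁ F) - d(pr₂ F) N` and `T = dN + d(pr₂ F) pr₁ F`.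

If `h` is null everywhere and `h ≠ 0` near `x`, one of the two null directions satisfies `T = 0`
there, that is, `dN = -d(pr₂ F) pr₁ F`. The symmetry of the second derivative of `N` then makes
`d(pr₂ F) ∧ d(pr₁ F)` vanish, hence `d(pr₂ F) = 0` if `n ≥ 2`; so `h` is horizontal, and a
horizontal multiple of `(N, 1)` is zero.

Along the map of the pair `(φ, ν)` and the function `s = cot θ`, take
`N = cos θ • ν - sin θ • φ`. Then `R` and `T` are `sin θ` times `s dφ + dν` and `s dν - dφ`: the
differentials, up to scale, of the parallel hypersurface at distance `θ` and of its Gauss map. So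
`⟨H, (N, 1)⟩ = 0` says that the parallel hypersurface is minimal, i.e.
`∑ mᵢ (κᵢ s + 1) / (s - κᵢ) = 0`, whose left side is strictly decreasing between consecutive
`κᵢ`. This counts the roots of the polynomial and shows that they are simple, so that the implicit
function theorem makes a continuous root `C²`.

Conversely, when `⟨H, (N, 1)⟩ = 0`, the null geodesics issued from `F` in the direction `(N, 1)`
meet a suitable slice `𝕊ⁿ⁺¹ × {-c}` in a hypersurface from which `F` is recovered. Where `H ≠ 0`,
the direction of `H` is such an `(N, 1)`; where `H` vanishes identically, any null normal is.
-/

noncomputable section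

namespace MarginallyTrapped

open ContinuousLinearMap (adjoint)
open scoped RealInnerProductSpace Topology

/-! ### Real roots of `∑ m (κ X + 1) ∏ (X - μ)` -/

section Roots

/-- The polynomial `∑ m(κ) (κ X + 1) ∏_{μ ≠ κ} (X - μ)`, with `κ` and `μ` in `K`, of a finite set
`K` of principal curvatures with weights `m`. -/
def weightedPoly (K : Finset ℝ) (m : ℝ → ℝ) : ℝ[X] :=
  ∑ κ ∈ K, C (m κ) * (C κ * X + 1) * ∏ μ ∈ K.erase κ, (X - C μ)

/-- The weighted sum of the principal curvatures `(κ s + 1) / (s - κ)` of the parallel hypersurface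
at distance `cot⁻¹ s`; a term with `κ = s` has the junk value `0`. -/
def parallelMean (K : Finset ℝ) (m : ℝ → ℝ) (s : ℝ) : ℝ :=
  ∑ κ ∈ K, m κ * ((κ * s + 1) / (s - κ))

variable {K : Finset ℝ} {m : ℝ → ℝ}

theorem eval_weightedPoly (s : ℝ) :
    (weightedPoly K m).eval s = ∑ κ ∈ K, m κ * (κ * s + 1) * ∏ μ ∈ K.erase κ, (s - μ) := by
  simp [weightedPoly, eval_finsetSum, eval_prod]

theorem eval_weightedPoly_of_mem {κ : ℝ} (hκ : κ ∈ K) :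
    (weightedPoly K m).eval κ = m κ * (κ ^ 2 + 1) * ∏ μ ∈ K.erase κ, (κ - μ) := by
  rw [eval_weightedPoly, Finset.sum_eq_single_of_mem κ hκ, sq]
  intro μ _ hne
  rw [Finset.prod_eq_zero (Finset.mem_erase.2 ⟨hne.symm, hκ⟩) (sub_self κ), mul_zero]

theorem eval_weightedPoly_of_notMem {s : ℝ} (hs : s ∉ K) :
    (weightedPoly K m).eval s = (∏ μ ∈ K, (s - μ)) * parallelMean K m s := by
  rw [eval_weightedPoly, parallelMean, Finset.mul_sum]
  refine Finset.sum_congr rfl fun κ hκ => ?_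
  have : s - κ ≠ 0 := sub_ne_zero.2 fun h => hs (h ▸ hκ)
  rw [← Finset.mul_prod_erase K _ hκ]
  field_simp

theorem eval_weightedPoly_ne_zero {κ : ℝ} (hκ : κ ∈ K) (hm : m κ ≠ 0) :
    (weightedPoly K m).eval κ ≠ 0 := by
  rw [eval_weightedPoly_of_mem hκ]
  refine mul_ne_zero (mul_ne_zero hm (by positivity)) (Finset.prod_ne_zero_iff.2 fun μ hμ => ?_)
  exact sub_ne_zero.2 (Finset.ne_of_mem_erase hμ).symm

theorem weightedPoly_ne_zero {κ : ℝ} (hκ : κ ∈ K) (hm : m κ ≠ 0) : weightedPoly K m ≠ 0 :=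
  fun h => eval_weightedPoly_ne_zero hκ hm (by rw [h, eval_zero])

theorem isRoot_weightedPoly_iff (hm : ∀ κ ∈ K, m κ ≠ 0) {s : ℝ} :
    (weightedPoly K m).IsRoot s ↔ s ∉ K ∧ parallelMean K m s = 0 := by
  rw [IsRoot.def]
  by_cases hs : s ∈ K
  · simp only [hs, eval_weightedPoly_ne_zero hs (hm s hs), not_true_eq_false, false_and]
  · have hprod : ∏ μ ∈ K, (s - μ) ≠ 0 :=
      Finset.prod_ne_zero_iff.2 fun μ hμ => sub_ne_zero.2 fun h => hs (h ▸ hμ)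
    rw [eval_weightedPoly_of_notMem hs, mul_eq_zero, or_iff_right hprod]
    exact (and_iff_right hs).symm

theorem natDegree_weightedPoly_le : (weightedPoly K m).natDegree ≤ K.card := by
  refine natDegree_sum_le_of_forall_le _ _ fun κ hκ => ?_
  have hprod : (∏ μ ∈ K.erase κ, (X - C μ)).natDegree = (K.erase κ).card :=
    natDegree_finsetProd_X_sub_C_eq_card _ _
  have hlin : (C (m κ) * (C κ * X + 1)).natDegree ≤ 1 := by
    compute_degree
  have := Finset.card_erase_add_one hκ
  refine natDegree_mul_le.trans ?_
  omega

theorem coeff_card_weightedPoly : (weightedPoly K m).coeff K.card = ∑ κ ∈ K, m κ * κ := by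
  rw [weightedPoly, finsetSum_coeff]
  refine Finset.sum_congr rfl fun κ hκ => ?_
  have hmon : (∏ μ ∈ K.erase κ, (X - C μ)).Monic := monic_prod_X_sub_C _ _
  have hdeg : (∏ μ ∈ K.erase κ, (X - C μ)).natDegree = (K.erase κ).card :=
    natDegree_finsetProd_X_sub_C_eq_card _ _
  have htop : (∏ μ ∈ K.erase κ, (X - C μ)).coeff ((K.erase κ).card + 1) = 0 :=
    coeff_eq_zero_of_natDegree_lt (by omega)
  rw [← Finset.card_erase_add_one hκ, mul_assoc, coeff_C_mul, add_mul, coeff_add, one_mul,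
    mul_assoc, coeff_C_mul, coeff_X_mul, htop, ← hdeg, hmon.coeff_natDegree]
  ring

theorem eval_weightedPoly_mul_eval_neg {a b : ℝ} (ha : a ∈ K) (hb : b ∈ K) (hma : 0 < m a)
    (hmb : 0 < m b) (hab : a < b) (hK : ∀ κ ∈ K, κ ≤ a ∨ b ≤ κ) :
    (weightedPoly K m).eval a * (weightedPoly K m).eval b < 0 := by
  rw [eval_weightedPoly_of_mem ha, eval_weightedPoly_of_mem hb,
    ← Finset.mul_prod_erase _ _ (Finset.mem_erase.2 ⟨hab.ne', hb⟩),
    ← Finset.mul_prod_erase _ _ (Finset.mem_erase.2 ⟨hab.ne, ha⟩), Finset.erase_right_comm]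
  have hsign : 0 < (∏ μ ∈ (K.erase b).erase a, (a - μ)) * ∏ μ ∈ (K.erase b).erase a, (b - μ) := by
    rw [← Finset.prod_mul_distrib]
    refine Finset.prod_pos fun μ hμ => ?_
    rw [Finset.mem_erase, Finset.mem_erase] at hμ
    rcases hK μ hμ.2.2 with h | h
    · exact mul_pos (sub_pos.2 (lt_of_le_of_ne h hμ.1)) (sub_pos.2 (h.trans_lt hab))
    · exact mul_pos_of_neg_of_neg (sub_neg.2 (hab.trans_le h))
        (sub_neg.2 (lt_of_le_of_ne h hμ.2.1.symm))
  have hpos : 0 < (m a * (a ^ 2 + 1)) * (m b * (b ^ 2 + 1)) * ((b - a) * (b - a)) *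
      ((∏ μ ∈ (K.erase b).erase a, (a - μ)) * ∏ μ ∈ (K.erase b).erase a, (b - μ)) := by
    have : 0 < b - a := sub_pos.2 hab
    positivity
  linear_combination hpos

theorem exists_isRoot_weightedPoly_between {a b : ℝ} (ha : a ∈ K) (hb : b ∈ K) (hma : 0 < m a)
    (hmb : 0 < m b) (hab : a < b) (hK : ∀ κ ∈ K, κ ≤ a ∨ b ≤ κ) :
    ∃ s, a < s ∧ s < b ∧ (weightedPoly K m).IsRoot s := by
  have hc : ContinuousOn (fun s => (weightedPoly K m).eval s) (Set.Icc a b) :=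
    (weightedPoly K m).continuous.continuousOn
  have hneg := eval_weightedPoly_mul_eval_neg ha hb hma hmb hab hK
  rcases mul_neg_iff.1 hneg with ⟨hpos_a, hneg_b⟩ | ⟨hneg_a, hpos_b⟩
  · obtain ⟨s, hs, h0⟩ := intermediate_value_Ioo' hab.le hc ⟨hneg_b, hpos_a⟩
    exact ⟨s, hs.1, hs.2, h0⟩
  · obtain ⟨s, hs, h0⟩ := intermediate_value_Ioo hab.le hc ⟨hneg_a, hpos_b⟩
    exact ⟨s, hs.1, hs.2, h0⟩

theorem exists_isRoot_weightedPoly_gt (hK : K.Nonempty) (hm : ∀ κ ∈ K, 0 < m κ)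
    (hsum : ∑ κ ∈ K, m κ * κ < 0) :
    ∃ s, (∀ κ ∈ K, κ < s) ∧ (weightedPoly K m).IsRoot s := by
  set b := K.max' hK
  have hb : b ∈ K := K.max'_mem hK
  have hpos : 0 < (weightedPoly K m).eval b := by
    rw [eval_weightedPoly_of_mem hb]
    refine mul_pos (mul_pos (hm b hb) (by positivity)) (Finset.prod_pos fun μ hμ => sub_pos.2 ?_)
    rw [Finset.mem_erase] at hμ
    exact lt_of_le_of_ne (K.le_max' μ hμ.2) hμ.1
  have hdeg : (weightedPoly K m).natDegree = K.card :=
    le_antisymm natDegree_weightedPoly_le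
      (le_natDegree_of_ne_zero (by rw [coeff_card_weightedPoly]; exact hsum.ne))
  have hlead : (weightedPoly K m).leadingCoeff ≤ 0 := by
    rw [leadingCoeff, hdeg, coeff_card_weightedPoly]; exact hsum.le
  have htend := tendsto_atBot_of_leadingCoeff_nonpos (weightedPoly K m)
    (natDegree_pos_iff_degree_pos.1 (by rw [hdeg]; exact hK.card_pos)) hlead
  obtain ⟨t, ht, hbt⟩ := ((htend.eventually_lt_atBot 0).and (Filter.eventually_gt_atTop b)).exists
  obtain ⟨s, hs, h0⟩ := intermediate_value_Ioo' hbt.le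
    (weightedPoly K m).continuous.continuousOn ⟨ht, hpos⟩
  exact ⟨s, fun κ hκ => (K.le_max' κ hκ).trans_lt hs.1, h0⟩

theorem parallelMean_image_neg (s : ℝ) :
    parallelMean (K.image Neg.neg) (fun κ => m (-κ)) s = -parallelMean K m (-s) := by
  rw [parallelMean, parallelMean, Finset.sum_image neg_injective.injOn, ← Finset.sum_neg_distrib]
  refine Finset.sum_congr rfl fun κ _ => ?_
  rw [neg_neg, show s - -κ = -(-s - κ) by ring, div_neg]
  ring

theorem exists_isRoot_weightedPoly_lt (hK : K.Nonempty) (hm : ∀ κ ∈ K, 0 < m κ)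
    (hsum : 0 < ∑ κ ∈ K, m κ * κ) :
    ∃ s, (∀ κ ∈ K, s < κ) ∧ (weightedPoly K m).IsRoot s := by
  have hm' : ∀ κ ∈ K.image Neg.neg, 0 < m (-κ) := by
    intro κ hκ
    obtain ⟨μ, hμ, rfl⟩ := Finset.mem_image.1 hκ
    rw [neg_neg]
    exact hm μ hμ
  obtain ⟨s, hs, h0⟩ := exists_isRoot_weightedPoly_gt (hK.image _) hm' (by
    rw [Finset.sum_image neg_injective.injOn]
    simpa using hsum)
  rw [isRoot_weightedPoly_iff fun κ hκ => (hm' κ hκ).ne', parallelMean_image_neg, neg_eq_zero] at h0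
  refine ⟨-s, fun κ hκ => ?_, (isRoot_weightedPoly_iff fun κ hκ => (hm κ hκ).ne').2 ⟨?_, h0.2⟩⟩
  · exact neg_lt.1 (hs (-κ) (Finset.mem_image_of_mem _ hκ))
  · exact fun h => h0.1 (Finset.mem_image.2 ⟨-s, h, neg_neg s⟩)

theorem exists_card_sub_one_isRoot_weightedPoly (hm : ∀ κ ∈ K, 0 < m κ) :
    ∃ R : Finset ℝ, R.card = K.card - 1 ∧ ∀ s ∈ R, (weightedPoly K m).IsRoot s ∧
      (∃ κ ∈ K, κ < s) ∧ ∃ κ ∈ K, s < κ := by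
  let e := K.orderEmbOfFin rfl
  have he : ∀ i, e i ∈ K := K.orderEmbOfFin_mem rfl
  have hlt : ∀ i : Fin (K.card - 1), i.1 < K.card ∧ i.1 + 1 < K.card := fun i => by omega
  have hex : ∀ i : Fin (K.card - 1), ∃ s, e ⟨i, (hlt i).1⟩ < s ∧ s < e ⟨i + 1, (hlt i).2⟩ ∧
      (weightedPoly K m).IsRoot s := by
    intro i
    refine exists_isRoot_weightedPoly_between (he _) (he _) (hm _ (he _)) (hm _ (he _))
      (e.strictMono (Fin.mk_lt_mk.2 i.1.lt_succ_self)) fun κ hκ => ?_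
    obtain ⟨j, rfl⟩ : κ ∈ Set.range e := by rw [Finset.range_orderEmbOfFin]; exact hκ
    rw [e.le_iff_le, e.le_iff_le, Fin.le_def, Fin.le_def]
    exact le_or_gt j.1 i.1
  choose r hgt hr_lt hroot using hex
  have hmono : StrictMono r := by
    intro i j hij
    refine (hr_lt i).trans_le (le_trans ?_ (hgt j).le)
    rw [e.le_iff_le, Fin.le_def]
    exact hij
  refine ⟨Finset.univ.map ⟨r, hmono.injective⟩, by simp, fun s hs => ?_⟩
  obtain ⟨i, -, rfl⟩ := Finset.mem_map.1 hs
  exact ⟨hroot i, ⟨_, he _, hgt i⟩, ⟨_, he _, hr_lt i⟩⟩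

theorem encard_setOf_isRoot_of_natDegree_le_card {p : ℝ[X]} (hp : p ≠ 0) {R : Finset ℝ}
    (hdeg : p.natDegree ≤ R.card) (hroot : ∀ s ∈ R, p.IsRoot s) :
    {s | p.IsRoot s}.encard = (R.card : ℕ∞) := by
  have hset : {s | p.IsRoot s} = (p.roots.toFinset : Set ℝ) := by
    ext s; simp [hp]
  rw [hset, Set.encard_coe_eq_coe_finsetCard, Nat.cast_inj]
  refine le_antisymm (((Multiset.toFinset_card_le _).trans (card_roots' _)).trans hdeg) ?_
  exact Finset.card_le_card fun s hs => by simpa [hp] using hroot s hs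

theorem encard_roots_weightedPoly_of_sum_eq_zero (hK : K.Nonempty) (hm : ∀ κ ∈ K, 0 < m κ)
    (hsum : ∑ κ ∈ K, m κ * κ = 0) :
    {s | (weightedPoly K m).IsRoot s}.encard = ((K.card - 1 : ℕ) : ℕ∞) := by
  obtain ⟨R, hR, hroot⟩ := exists_card_sub_one_isRoot_weightedPoly hm
  have hne : weightedPoly K m ≠ 0 := weightedPoly_ne_zero hK.choose_spec (hm _ hK.choose_spec).ne'
  have hlt : (weightedPoly K m).natDegree ≠ K.card := by
    intro h
    have := coeff_card_weightedPoly (K := K) (m := m)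
    rw [hsum, ← h, coeff_natDegree, leadingCoeff_eq_zero] at this
    exact hne this
  have hle := natDegree_weightedPoly_le (K := K) (m := m)
  rw [← hR]
  exact encard_setOf_isRoot_of_natDegree_le_card hne (by omega) fun s hs => (hroot s hs).1

theorem encard_roots_weightedPoly_of_sum_ne_zero (hK : K.Nonempty) (hm : ∀ κ ∈ K, 0 < m κ)
    (hsum : ∑ κ ∈ K, m κ * κ ≠ 0) :
    {s | (weightedPoly K m).IsRoot s}.encard = (K.card : ℕ∞) := by
  obtain ⟨R, hR, hroot⟩ := exists_card_sub_one_isRoot_weightedPoly hm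
  have hne : weightedPoly K m ≠ 0 := weightedPoly_ne_zero hK.choose_spec (hm _ hK.choose_spec).ne'
  obtain ⟨s, hs, h0⟩ : ∃ s ∉ R, (weightedPoly K m).IsRoot s := by
    rcases hsum.lt_or_gt with h | h
    · obtain ⟨s, hs, h0⟩ := exists_isRoot_weightedPoly_gt hK hm h
      refine ⟨s, fun hR => ?_, h0⟩
      obtain ⟨-, -, κ, hκ, hlt⟩ := hroot s hR
      exact lt_asymm hlt (hs κ hκ)
    · obtain ⟨s, hs, h0⟩ := exists_isRoot_weightedPoly_lt hK hm h
      refine ⟨s, fun hR => ?_, h0⟩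
      obtain ⟨-, ⟨κ, hκ, hlt⟩, -⟩ := hroot s hR
      exact lt_asymm hlt (hs κ hκ)
  have hcard : (insert s R).card = K.card := by
    rw [Finset.card_insert_of_notMem hs, hR]
    exact Nat.sub_add_cancel hK.card_pos
  rw [← hcard]
  refine encard_setOf_isRoot_of_natDegree_le_card hne
    (natDegree_weightedPoly_le.trans hcard.ge) fun t ht => ?_
  rcases Finset.mem_insert.1 ht with rfl | ht
  · exact h0
  · exact (hroot t ht).1

theorem hasDerivAt_parallelMean {s : ℝ} (hs : s ∉ K) :
    HasDerivAt (parallelMean K m) (-∑ κ ∈ K, m κ * ((κ ^ 2 + 1) / (s - κ) ^ 2)) s := by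
  rw [← Finset.sum_neg_distrib]
  refine HasDerivAt.fun_sum fun κ hκ => ?_
  have : s - κ ≠ 0 := sub_ne_zero.2 fun h => hs (h ▸ hκ)
  convert! ((((hasDerivAt_id s).const_mul κ).add_const 1).div
    ((hasDerivAt_id s).sub_const κ) this).const_mul (m κ) using 1
  simp only [id]
  ring

theorem exists_hasDerivAt_parallelMean_neg (hK : K.Nonempty) (hm : ∀ κ ∈ K, 0 < m κ) {s : ℝ}
    (hs : s ∉ K) : ∃ c < 0, HasDerivAt (parallelMean K m) c s := by
  refine ⟨_, neg_neg_iff_pos.2 (Finset.sum_pos (fun κ hκ => ?_) hK), hasDerivAt_parallelMean hs⟩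
  have : s - κ ≠ 0 := sub_ne_zero.2 fun h => hs (h ▸ hκ)
  have := hm κ hκ
  positivity

end Roots

/-! ### Traces of pairs of linear maps -/

section Factor

variable {E V : Type*} [NormedAddCommGroup E] [NormedSpace ℝ E] [FiniteDimensional ℝ E]
  [NormedAddCommGroup V] [NormedSpace ℝ V]

theorem isUnit_of_injective {A : E →L[ℝ] E} (hA : Function.Injective A) : IsUnit A :=
  ContinuousLinearMap.isUnit_iff_bijective.2
    ⟨hA, LinearMap.surjective_of_injective (f := A.toLinearMap) hA⟩

theorem exists_eq_comp {P Q : E →L[ℝ] V} (hP : Function.Injective P)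
    (h : ∀ v, ∃ u, Q v = P u) : ∃ R : E →L[ℝ] E, Q = P ∘L R := by
  choose R hR using h
  refine ⟨LinearMap.toContinuousLinearMap
    { toFun := R
      map_add' := fun v w => hP (by rw [map_add, ← hR, ← hR, ← hR, map_add])
      map_smul' := fun c v => hP (by rw [RingHom.id_apply, map_smul, ← hR, ← hR, map_smul]) }, ?_⟩
  ext v : 1
  exact hR v

end Factor

section RelTrace

variable {E V : Type*} [NormedAddCommGroup E] [InnerProductSpace ℝ E] [CompleteSpace E]
  [NormedAddCommGroup V] [InnerProductSpace ℝ V] [CompleteSpace V]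

/-- The trace of the endomorphism `R` with `Q = P ∘ R`, for injective `P`. The formula
`R = (P† P)⁻¹ P† Q` makes the smooth dependence on `P` and `Q` visible. -/
def relTrace (P Q : E →L[ℝ] V) : ℝ :=
  LinearMap.trace ℝ E
    (Ring.inverse (adjoint P ∘L P) * (adjoint P ∘L Q) : E →L[ℝ] E).toLinearMap

variable [FiniteDimensional ℝ E]

theorem isUnit_adjoint_comp_self {P : E →L[ℝ] V} (hP : Function.Injective P) :
    IsUnit (adjoint P ∘L P) := by
  refine isUnit_of_injective ((injective_iff_map_eq_zero _).2 fun v hv => hP ?_)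
  rw [map_zero, ← inner_self_eq_zero (𝕜 := ℝ), ← ContinuousLinearMap.adjoint_inner_left]
  change inner ℝ ((adjoint P ∘L P) v) v = 0
  rw [hv, inner_zero_left]

theorem relTrace_comp {P : E →L[ℝ] V} (hP : Function.Injective P) (R : E →L[ℝ] E) :
    relTrace P (P ∘L R) = LinearMap.trace ℝ E R.toLinearMap := by
  rw [relTrace, ← ContinuousLinearMap.comp_assoc]
  change LinearMap.trace ℝ E
    (Ring.inverse (adjoint P ∘L P) * ((adjoint P ∘L P) * R) : E →L[ℝ] E).toLinearMap = _
  rw [← mul_assoc, Ring.inverse_mul_cancel _ (isUnit_adjoint_comp_self hP), one_mul]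

theorem relTrace_comp_comp {P Q : E →L[ℝ] V} (hP : Function.Injective P)
    (h : ∀ v, ∃ u, Q v = P u) {T : E →L[ℝ] E} (hT : Function.Bijective T) :
    relTrace (P ∘L T) (Q ∘L T) = relTrace P Q := by
  obtain ⟨R, rfl⟩ := exists_eq_comp hP h
  obtain ⟨e, rfl⟩ : ∃ e : E ≃L[ℝ] E, (e : E →L[ℝ] E) = T :=
    ⟨(LinearEquiv.ofBijective T.toLinearMap hT).toContinuousLinearEquiv, by ext v; rfl⟩
  have hconj : (P ∘L R) ∘L (e : E →L[ℝ] E) = (P ∘L (e : E →L[ℝ] E)) ∘L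
      ((e.symm : E →L[ℝ] E) ∘L R ∘L (e : E →L[ℝ] E)) := by
    ext v; simp
  have hPe : Function.Injective (P ∘L (e : E →L[ℝ] E)) := hP.comp e.injective
  rw [hconj, relTrace_comp hPe, relTrace_comp hP]
  exact LinearMap.trace_conj' (R := ℝ) R.toLinearMap e.symm.toLinearEquiv

theorem relTrace_smul_smul {P Q : E →L[ℝ] V} (hP : Function.Injective P)
    (h : ∀ v, ∃ u, Q v = P u) {c : ℝ} (hc : c ≠ 0) :
    relTrace (c • P) (c • Q) = relTrace P Q := by
  obtain ⟨R, rfl⟩ := exists_eq_comp hP h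
  rw [← ContinuousLinearMap.smul_comp, relTrace_comp hP,
    relTrace_comp ((smul_right_injective V hc).comp hP)]

theorem contDiffAt_relTrace {X : Type*} [NormedAddCommGroup X] [NormedSpace ℝ X]
    {k : WithTop ℕ∞} {P Q : X → E →L[ℝ] V} {z : X} (hP : ContDiffAt ℝ k P z)
    (hQ : ContDiffAt ℝ k Q z) (hinj : Function.Injective (P z)) :
    ContDiffAt ℝ k (fun y => relTrace (P y) (Q y)) z := by
  have hadj : ContDiffAt ℝ k (fun y => adjoint (P y)) z :=
    (adjoint (𝕜 := ℝ) (E := E) (F := V)).toContinuousLinearEquiv.contDiff.contDiffAt.comp z hP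
  obtain ⟨u, hu⟩ := isUnit_adjoint_comp_self hinj
  have hinv : ContDiffAt ℝ k (fun y => Ring.inverse (adjoint (P y) ∘L P y)) z := by
    refine ContDiffAt.comp z (g := Ring.inverse) ?_ (hadj.clm_comp hP)
    rw [← hu]
    exact contDiffAt_ringInverse ℝ u
  let tr : (E →L[ℝ] E) →ₗ[ℝ] ℝ :=
    LinearMap.trace ℝ E ∘ₗ ContinuousLinearMap.coeLM ℝ
  exact (LinearMap.toContinuousLinearMap tr).contDiff.contDiffAt.comp z
    (hinv.clm_comp (hadj.clm_comp hQ))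

theorem exists_inner_map_eq {P : E →L[ℝ] V} (hP : Function.Injective P) (t : E →L[ℝ] ℝ) :
    ∃ z, ∀ v, ⟪P z, P v⟫ = t v := by
  obtain ⟨z, hz⟩ := (ContinuousLinearMap.isUnit_iff_bijective.1 (isUnit_adjoint_comp_self hP)).2
    ((InnerProductSpace.toDual ℝ E).symm t)
  refine ⟨z, fun v => ?_⟩
  rw [← ContinuousLinearMap.adjoint_inner_left]
  change inner ℝ ((adjoint P ∘L P) z) v = t v
  rw [hz, InnerProductSpace.toDual_symm_apply]

theorem eventually_injective {X : Type*} [TopologicalSpace X] {P : X → E →L[ℝ] V} {z : X}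
    (hP : ContinuousAt P z) (hinj : Function.Injective (P z)) :
    ∀ᶠ y in 𝓝 z, Function.Injective (P y) := by
  have hadj : ContinuousAt (fun y => adjoint (P y) ∘L P y) z :=
    ((adjoint (𝕜 := ℝ) (E := E) (F := V)).continuous.continuousAt.comp hP).clm_comp hP
  filter_upwards [hadj.eventually (Units.isOpen.mem_nhds (isUnit_adjoint_comp_self hinj))]
    with y hy
  exact Function.Injective.of_comp (f := adjoint (P y))
    (ContinuousLinearMap.isUnit_iff_bijective.1 hy).1

end RelTrace

/-! ### Shape operators -/

section Shape

variable {E V : Type*} [NormedAddCommGroup E] [InnerProductSpace ℝ E]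
  [NormedAddCommGroup V] [InnerProductSpace ℝ V]

/-- A pair such as the differentials of a hypersurface and its Gauss map: `a` is injective and
`b = - a ∘ A`, where the shape operator `A` is symmetric for the metric induced by `a`. -/
structure IsShapePair (a b : E →L[ℝ] V) : Prop where
  injective : Function.Injective a
  symm : ∀ v w, ⟪a v, b w⟫ = ⟪b v, a w⟫
  range : ∀ v, ∃ u, b v = a u

/-- The eigenspace of the shape operator `A` given by `b = - a ∘ A`. -/
def shapeSpace (a b : E →L[ℝ] V) (κ : ℝ) : Submodule ℝ E :=
  LinearMap.ker (b.toLinearMap + κ • a.toLinearMap)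

/-- The set of eigenvalues of the shape operator. -/
def shapeSet (a b : E →L[ℝ] V) : Set ℝ := {κ | shapeSpace a b κ ≠ ⊥}

/-- The multiplicity of an eigenvalue of the shape operator. -/
def shapeMult (a b : E →L[ℝ] V) (κ : ℝ) : ℕ := Module.finrank ℝ (shapeSpace a b κ)

variable {a b : E →L[ℝ] V}

theorem mem_shapeSpace {κ : ℝ} {v : E} : v ∈ shapeSpace a b κ ↔ b v = -(κ • a v) := by
  rw [shapeSpace, LinearMap.mem_ker, LinearMap.add_apply, LinearMap.smul_apply,
    add_eq_zero_iff_eq_neg]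
  rfl

theorem notMem_shapeSet_iff {s : ℝ} :
    s ∉ shapeSet a b ↔ Function.Injective (s • a + b) := by
  rw [shapeSet, Set.mem_ofPred_eq, not_not, shapeSpace, LinearMap.ker_eq_bot, add_comm]
  rfl

theorem smul_sub_apply_of_mem_shapeSpace {s κ : ℝ} (hκ : s - κ ≠ 0) {v : E}
    (hv : v ∈ shapeSpace a b κ) :
    (s • b - a) v = (s • a + b) (-((κ * s + 1) / (s - κ)) • v) := by
  rw [mem_shapeSpace] at hv
  rw [map_smul]
  simp only [_root_.sub_apply, _root_.smul_apply, _root_.add_apply, hv]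
  match_scalars
  field_simp
  ring

variable [FiniteDimensional ℝ E]

theorem shapeMult_pos {κ : ℝ} (hκ : κ ∈ shapeSet a b) : 0 < shapeMult a b κ :=
  Module.finrank_pos_iff.2 (Submodule.nontrivial_iff_ne_bot.2 hκ)

theorem iSup_eigenspace_eq_top_of_isSymmetric_conj {F : Type*} [NormedAddCommGroup F]
    [InnerProductSpace ℝ F] {A : Module.End ℝ E} (e : E ≃ₗ[ℝ] F)
    (hA : (e.conj A).IsSymmetric) : ⨆ κ, A.eigenspace κ = ⊤ := by
  have : FiniteDimensional ℝ F := e.finiteDimensional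
  have hmap : ∀ κ, A.eigenspace κ = ((e.conj A).eigenspace κ).map e.symm.toLinearMap := by
    intro κ
    ext v
    rw [Submodule.mem_map_equiv, Module.End.mem_eigenspace_iff, Module.End.mem_eigenspace_iff,
      LinearEquiv.symm_symm, LinearEquiv.conj_apply_apply, e.symm_apply_apply, ← map_smul,
      e.injective.eq_iff]
  have htop : ⨆ κ, (e.conj A).eigenspace κ = ⊤ := by
    rw [← Submodule.orthogonal_eq_bot_iff]
    exact hA.orthogonalComplement_iSup_eigenspaces_eq_bot
  rw [iSup_congr hmap, ← Submodule.map_iSup, htop, Submodule.map_top]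
  exact e.symm.range

namespace IsShapePair

theorem exists_shapeOperator (h : IsShapePair a b) :
    ∃ A : Module.End ℝ E, (∀ v, b v = -a (A v)) ∧ ∀ κ, A.eigenspace κ = shapeSpace a b κ := by
  obtain ⟨R, hR⟩ := exists_eq_comp h.injective h.range
  have hb : ∀ v, b v = -a ((-R.toLinearMap) v) := fun v => by
    rw [hR, LinearMap.neg_apply, map_neg, neg_neg]; rfl
  refine ⟨-R.toLinearMap, hb, fun κ => ?_⟩
  ext v
  rw [Module.End.mem_eigenspace_iff, mem_shapeSpace, hb, neg_inj, ← map_smul, h.injective.eq_iff]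

theorem isInternal (h : IsShapePair a b) : DirectSum.IsInternal (shapeSpace a b) := by
  classical
  obtain ⟨A, hA, hE⟩ := h.exists_shapeOperator
  let e : E ≃ₗ[ℝ] LinearMap.range a.toLinearMap := LinearEquiv.ofInjective a.toLinearMap h.injective
  have he : ∀ v, ((e v : LinearMap.range a.toLinearMap) : V) = a v := fun v => rfl
  have hconj : ∀ v, ((e.conj A (e v) : LinearMap.range a.toLinearMap) : V) = -b v := fun v => by
    rw [LinearEquiv.conj_apply_apply, e.symm_apply_apply, he, hA, neg_neg]
  have hsymm : (e.conj A).IsSymmetric := by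
    intro x y
    obtain ⟨v, rfl⟩ := e.surjective x
    obtain ⟨w, rfl⟩ := e.surjective y
    rw [Submodule.coe_inner, Submodule.coe_inner, hconj, hconj, inner_neg_left, inner_neg_right,
      he, he, h.symm]
  rw [show shapeSpace a b = A.eigenspace from funext fun κ => (hE κ).symm]
  exact DirectSum.isInternal_submodule_of_iSupIndep_of_iSup_eq_top A.eigenspaces_iSupIndep
    (iSup_eigenspace_eq_top_of_isSymmetric_conj e hsymm)

theorem finite (h : IsShapePair a b) : (shapeSet a b).Finite := by
  obtain ⟨A, -, hE⟩ := h.exists_shapeOperator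
  refine (Module.End.finite_hasEigenvalue A).subset fun κ hκ => ?_
  change A.eigenspace κ ≠ ⊥
  rw [hE]
  exact hκ

theorem trace_eq (h : IsShapePair a b) {S : E →ₗ[ℝ] E} {c : ℝ → ℝ}
    (hS : ∀ κ, ∀ v ∈ shapeSpace a b κ, S v = c κ • v) :
    LinearMap.trace ℝ E S = ∑ κ ∈ h.finite.toFinset, shapeMult a b κ * c κ := by
  have hmaps : ∀ κ, Set.MapsTo S (shapeSpace a b κ) (shapeSpace a b κ) := fun κ v hv => by
    rw [hS κ v hv]
    exact Submodule.smul_mem _ _ hv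
  classical
  rw [LinearMap.trace_eq_sum_trace_restrict' h.isInternal h.finite hmaps]
  refine Finset.sum_congr rfl fun κ _ => ?_
  have hrestrict : S.restrict (hmaps κ) = c κ • LinearMap.id :=
    LinearMap.ext fun v => Subtype.ext (hS κ v v.2)
  rw [hrestrict, map_smul, LinearMap.trace_id, smul_eq_mul, mul_comm]
  rfl

theorem sum_mult (h : IsShapePair a b) :
    ∑ κ ∈ h.finite.toFinset, shapeMult a b κ = Module.finrank ℝ E := by
  have htrace := h.trace_eq (S := LinearMap.id) (c := fun _ => 1) fun κ v _ => by
    rw [LinearMap.id_apply, one_smul]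
  rw [LinearMap.trace_id] at htrace
  simp only [mul_one] at htrace
  exact_mod_cast htrace.symm

theorem shapeMult_eq_one (h : IsShapePair a b)
    (hcard : (shapeSet a b).ncard = Module.finrank ℝ E) {κ : ℝ} (hκ : κ ∈ shapeSet a b) :
    shapeMult a b κ = 1 := by
  have hle : ∀ κ ∈ h.finite.toFinset, 1 ≤ shapeMult a b κ := fun κ hκ =>
    shapeMult_pos (h.finite.mem_toFinset.1 hκ)
  refine ((Finset.sum_eq_sum_iff_of_le hle).1 ?_ κ (h.finite.mem_toFinset.2 hκ)).symm
  rw [h.sum_mult, ← hcard, Set.ncard_eq_toFinset_card _ h.finite, Finset.card_eq_sum_ones]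

theorem nonempty [Nontrivial E] (h : IsShapePair a b) : (shapeSet a b).Nonempty := by
  rw [← h.finite.toFinset_nonempty]
  refine Finset.nonempty_of_sum_ne_zero (f := shapeMult a b) ?_
  rw [h.sum_mult]
  exact Module.finrank_pos.ne'

theorem exists_smul_sub_eq (h : IsShapePair a b) {s : ℝ} (hs : s ∉ shapeSet a b) (v : E) :
    ∃ u, (s • b - a) v = (s • a + b) u := by
  obtain ⟨A, hA, -⟩ := h.exists_shapeOperator
  have hinj : Function.Injective (s • (LinearMap.id : E →ₗ[ℝ] E) - A) := by
    refine fun v w hvw => notMem_shapeSet_iff.1 hs ?_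
    simpa [hA, map_sub, sub_eq_add_neg] using congrArg a hvw
  obtain ⟨u, hu⟩ := LinearMap.surjective_of_injective hinj (-(s • A v + v))
  have hau := congrArg a hu
  simp only [LinearMap.sub_apply, LinearMap.smul_apply, LinearMap.id_apply, map_sub, map_smul,
    map_neg, map_add] at hau
  refine ⟨u, ?_⟩
  simp only [_root_.sub_apply, _root_.smul_apply, _root_.add_apply, hA]
  rw [← sub_eq_add_neg, hau, smul_neg]
  abel

variable [CompleteSpace E] [CompleteSpace V]

theorem relTrace_eq (h : IsShapePair a b) :
    relTrace a b = -∑ κ ∈ h.finite.toFinset, shapeMult a b κ * κ := by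
  obtain ⟨R, hR⟩ := exists_eq_comp h.injective h.range
  have htrace := h.trace_eq (S := R.toLinearMap) (c := fun κ => -κ) fun κ v hv => h.injective <| by
    rw [mem_shapeSpace] at hv
    change (a ∘L R) v = _
    rw [← hR, hv, map_smul, neg_smul]
  nth_rewrite 1 [hR]
  rw [relTrace_comp h.injective, htrace, ← Finset.sum_neg_distrib]
  exact Finset.sum_congr rfl fun κ _ => mul_neg _ _

theorem relTrace_smul_add_smul_sub (h : IsShapePair a b) {s : ℝ} (hs : s ∉ shapeSet a b) :
    relTrace (s • a + b) (s • b - a) =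
      -parallelMean h.finite.toFinset (fun κ => shapeMult a b κ) s := by
  have hinj := notMem_shapeSet_iff.1 hs
  obtain ⟨R, hR⟩ := exists_eq_comp hinj (h.exists_smul_sub_eq hs)
  have htrace := h.trace_eq (S := R.toLinearMap) (c := fun κ => -((κ * s + 1) / (s - κ)))
    fun κ v hv => by
      rcases eq_or_ne v 0 with rfl | hv0
      · rw [map_zero, smul_zero]
      have hκ : s - κ ≠ 0 := by
        refine sub_ne_zero.2 fun hsκ => hs (hsκ ▸ fun hbot => hv0 ?_)
        rwa [hbot, Submodule.mem_bot] at hv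
      refine hinj ?_
      change ((s • a + b) ∘L R) v = _
      rw [← hR, smul_sub_apply_of_mem_shapeSpace hκ hv]
  rw [hR, relTrace_comp hinj, htrace, parallelMean, ← Finset.sum_neg_distrib]
  exact Finset.sum_congr rfl fun κ _ => mul_neg _ _

theorem isRoot_iff (h : IsShapePair a b) {s : ℝ} :
    (weightedPoly h.finite.toFinset (fun κ => shapeMult a b κ)).IsRoot s ↔
      Function.Injective (s • a + b) ∧ relTrace (s • a + b) (s • b - a) = 0 := by
  rw [isRoot_weightedPoly_iff fun κ hκ =>
      Nat.cast_ne_zero.2 (shapeMult_pos (h.finite.mem_toFinset.1 hκ)).ne',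
    ← notMem_shapeSet_iff, h.finite.mem_toFinset]
  refine and_congr_right fun hs => ?_
  rw [h.relTrace_smul_add_smul_sub hs, neg_eq_zero]

theorem exists_hasDerivAt_relTrace [Nontrivial E] (h : IsShapePair a b) {s : ℝ}
    (hs : s ∉ shapeSet a b) :
    ∃ c ≠ 0, HasDerivAt (fun s : ℝ => relTrace (s • a + b) (s • b - a)) c s := by
  obtain ⟨c, hc, hderiv⟩ := exists_hasDerivAt_parallelMean_neg
    (m := fun κ => (shapeMult a b κ : ℝ)) (h.finite.toFinset_nonempty.2 h.nonempty)
    (fun κ hκ => Nat.cast_pos.2 (shapeMult_pos (h.finite.mem_toFinset.1 hκ)))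
    (fun hmem => hs (h.finite.mem_toFinset.1 hmem))
  refine ⟨-c, neg_ne_zero.2 hc.ne, hderiv.neg.congr_of_eventuallyEq ?_⟩
  filter_upwards [h.finite.isClosed.isOpen_compl.mem_nhds hs] with r hr
  exact h.relTrace_smul_add_smul_sub hr

end IsShapePair

end Shape

section GramTrace

variable {E V : Type*} [NormedAddCommGroup E] [InnerProductSpace ℝ E] [FiniteDimensional ℝ E]
  [CompleteSpace E] [NormedAddCommGroup V] [InnerProductSpace ℝ V] [CompleteSpace V]

theorem sum_inv_gram_mul_inner_eq_relTrace {ι : Type*} [Fintype ι] [DecidableEq ι]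
    (e : Module.Basis ι ℝ E) {P : E →L[ℝ] V} (hP : Function.Injective P) (Q : E →L[ℝ] V) :
    ∑ i, ∑ j, (Matrix.gram ℝ (P ∘ e))⁻¹ i j * ⟪Q (e i), P (e j)⟫ = relTrace P Q := by
  let R : E →L[ℝ] E := Ring.inverse (adjoint P ∘L P) * (adjoint P ∘L Q)
  let G := Matrix.gram ℝ (P ∘ e)
  let S := LinearMap.toMatrix e e R.toLinearMap
  have hPR : ∀ i, adjoint P (P (R (e i))) = adjoint P (Q (e i)) := fun i => by
    change ((adjoint P ∘L P) * (Ring.inverse (adjoint P ∘L P) * (adjoint P ∘L Q))) (e i) = _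
    rw [← mul_assoc, Ring.mul_inverse_cancel _ (isUnit_adjoint_comp_self hP), one_mul]
    rfl
  have hR : ∀ i, R (e i) = ∑ k, S k i • e k := fun i => by
    rw [← e.sum_repr (R (e i))]
    exact Finset.sum_congr rfl fun k _ =>
      congrArg (· • e k) (LinearMap.toMatrix_apply e e R.toLinearMap k i).symm
  have hSG : Matrix.of (fun i j => ⟪Q (e i), P (e j)⟫) = S.transpose * G := by
    ext i j
    rw [Matrix.of_apply, ← ContinuousLinearMap.adjoint_inner_left, ← hPR,
      ContinuousLinearMap.adjoint_inner_left, hR, map_sum, sum_inner, Matrix.mul_apply]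
    refine Finset.sum_congr rfl fun k _ => ?_
    rw [map_smul, real_inner_smul_left]
    rfl
  have hGsymm : G.transpose = G := Matrix.ext fun i j => real_inner_comm _ _
  have hdet : IsUnit G.det := isUnit_iff_ne_zero.2 <|
    Matrix.det_gram_ne_zero_iff_linearIndependent.2
      (e.linearIndependent.map' P.toLinearMap (LinearMap.ker_eq_bot.2 hP))
  calc ∑ i, ∑ j, G⁻¹ i j * ⟪Q (e i), P (e j)⟫
      = (G⁻¹.transpose * Matrix.of fun i j => ⟪Q (e i), P (e j)⟫).trace := by
        rw [Matrix.trace, Finset.sum_comm]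
        rfl
    _ = (G⁻¹ * S.transpose * G).trace := by
        rw [Matrix.transpose_nonsing_inv, hGsymm, hSG, Matrix.mul_assoc]
    _ = S.trace := by
        rw [Matrix.trace_mul_comm, ← Matrix.mul_assoc, Matrix.mul_nonsing_inv _ hdet,
          Matrix.one_mul, Matrix.trace_transpose]
    _ = relTrace P Q := (LinearMap.trace_eq_matrix_trace ℝ e _).symm

end GramTrace

/-! ### Orthogonal complements -/

section Orthogonal

variable {V : Type*} [NormedAddCommGroup V] [InnerProductSpace ℝ V] [FiniteDimensional ℝ V]

theorem exists_eq_apply_of_orthonormal {E ι : Type*} [NormedAddCommGroup E] [NormedSpace ℝ E]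
    [Fintype ι] {b : ι → V} (hb : Orthonormal ℝ b) {P : E →L[ℝ] V} (hP : Function.Injective P)
    (hdim : Module.finrank ℝ V = Module.finrank ℝ E + Fintype.card ι)
    (hPb : ∀ i v, ⟪b i, P v⟫ = 0) {u : V} (hu : ∀ i, ⟪b i, u⟫ = 0) : ∃ v, u = P v := by
  let L := Submodule.span ℝ (Set.range b)
  have hmem : ∀ w : V, (∀ i, ⟪b i, w⟫ = 0) → w ∈ Lᗮ := fun w hw => by
    have hL : L ≤ (ℝ ∙ w)ᗮ := Submodule.span_le.2 <| by
      rintro _ ⟨i, rfl⟩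
      exact Submodule.mem_orthogonal_singleton_iff_inner_left.2 (hw i)
    exact (Submodule.mem_orthogonal L w).2 fun x hx =>
      Submodule.mem_orthogonal_singleton_iff_inner_left.1 (hL hx)
  have hle : LinearMap.range P.toLinearMap ≤ Lᗮ := by
    rintro _ ⟨v, rfl⟩
    exact hmem _ fun i => hPb i v
  have hrank : Module.finrank ℝ (LinearMap.range P.toLinearMap) = Module.finrank ℝ Lᗮ := by
    have hL := L.finrank_add_finrank_orthogonal
    rw [finrank_span_eq_card hb.linearIndependent] at hL
    rw [LinearMap.finrank_range_of_inj hP]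
    lia
  obtain ⟨v, hv⟩ : u ∈ LinearMap.range P.toLinearMap :=
    Submodule.eq_of_le_of_finrank_eq hle hrank ▸ hmem u hu
  exact ⟨v, hv.symm⟩

theorem exists_mem_orthogonal_inner_self_eq_one {L : Submodule ℝ V}
    (hL : Module.finrank ℝ L < Module.finrank ℝ V) : ∃ m ∈ Lᗮ, ⟪m, m⟫ = 1 := by
  have : Nontrivial Lᗮ := Submodule.nontrivial_iff_ne_bot.2 fun hbot => hL.ne <| by
    rw [Submodule.orthogonal_eq_bot_iff.1 hbot, finrank_top]
  obtain ⟨m, hm⟩ := exists_norm_eq Lᗮ zero_le_one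
  exact ⟨m, m.2, by rw [real_inner_self_eq_norm_sq, ← Submodule.coe_norm, hm, one_pow]⟩

end Orthogonal

/-! ### Null directions normal to a linear map -/

section NullDir

variable {n : ℕ}

theorem lorForm_apply (u v : Euc n × ℝ) : lorForm n u v = ⟪u.1, v.1⟫ - u.2 * v.2 := rfl

theorem eucForm_apply (u v : Euc n) : eucForm n u v = ⟪u, v⟫ := rfl

theorem lorForm_isSymm : (lorForm n).IsSymm := ⟨fun u v => by
  rw [lorForm_apply, lorForm_apply, real_inner_comm, mul_comm]⟩

theorem exists_eq_apply_of_perp {P : EuclideanSpace ℝ (Fin n) →L[ℝ] Euc n}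
    (hP : Function.Injective P) {p q : Euc n} (hp : ⟪p, p⟫ = 1) (hq : ⟪q, q⟫ = 1)
    (hqp : ⟪q, p⟫ = 0) (hPp : ∀ v, ⟪p, P v⟫ = 0) (hPq : ∀ v, ⟪q, P v⟫ = 0) {u : Euc n}
    (hup : ⟪p, u⟫ = 0) (huq : ⟪q, u⟫ = 0) : ∃ v, u = P v := by
  have hpq : Orthonormal ℝ ![p, q] := by
    rw [orthonormal_iff_ite]
    intro i j
    fin_cases i <;> fin_cases j
    exacts [hp, (real_inner_comm q p).trans hqp, hqp, hq]
  refine exists_eq_apply_of_orthonormal hpq hP ?_ (fun i v => ?_) fun i => ?_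
  · rw [finrank_euclideanSpace_fin, finrank_euclideanSpace_fin, Fintype.card_fin]
  · fin_cases i
    exacts [hPp v, hPq v]
  · fin_cases i
    exacts [hup, huq]

/-- The vector `(N, 1)` is null, tangent to the product at a point over `p`, and normal to the
range of `D`. Every nonzero null vector normal to a spacelike `D` is a multiple of such a vector. -/
structure NullDir (p N : Euc n) (D : EuclideanSpace ℝ (Fin n) →L[ℝ] Euc n × ℝ) : Prop where
  unit : ⟪N, N⟫ = 1
  perp : ⟪N, p⟫ = 0
  normal : ∀ v, ⟪N, (D v).1⟫ = (D v).2

/-- The representative of `D` modulo the null direction `(N, 1)` which takes values in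
`Euc n × {0}`. Where `(N, 1)` is normal to `D` it induces the same metric as `D`. -/
def reduced (D : EuclideanSpace ℝ (Fin n) →L[ℝ] Euc n × ℝ) (N : Euc n) :
    EuclideanSpace ℝ (Fin n) →L[ℝ] Euc n :=
  ContinuousLinearMap.fst ℝ _ _ ∘L D - (ContinuousLinearMap.snd ℝ _ _ ∘L D).smulRight N

variable {D : EuclideanSpace ℝ (Fin n) →L[ℝ] Euc n × ℝ} {p N N' : Euc n}

theorem reduced_apply (v : EuclideanSpace ℝ (Fin n)) :
    reduced D N v = (D v).1 - (D v).2 • N := rfl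

theorem reduced_comp (D : EuclideanSpace ℝ (Fin n) →L[ℝ] Euc n × ℝ) (N : Euc n)
    (T : EuclideanSpace ℝ (Fin n) →L[ℝ] EuclideanSpace ℝ (Fin n)) :
    reduced (D ∘L T) N = reduced D N ∘L T := rfl

theorem contDiffAt_reduced {X : Type*} [NormedAddCommGroup X] [NormedSpace ℝ X]
    {k : WithTop ℕ∞} {D : X → EuclideanSpace ℝ (Fin n) →L[ℝ] Euc n × ℝ} {N : X → Euc n} {z : X}
    (hD : ContDiffAt ℝ k D z) (hN : ContDiffAt ℝ k N z) :
    ContDiffAt ℝ k (fun y => reduced (D y) (N y)) z :=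
  (contDiffAt_const.clm_comp hD).sub ((contDiffAt_const.clm_comp hD).smulRight hN)

namespace NullDir

theorem norm_eq_one (h : NullDir p N D) : ‖N‖ = 1 := by
  rw [norm_eq_sqrt_real_inner, h.unit, Real.sqrt_one]

theorem lorForm_self (h : NullDir p N D) : lorForm n (N, 1) (N, 1) = 0 := by
  rw [lorForm_apply, h.unit, mul_one, sub_self]

theorem lorForm_apply_eq_zero (h : NullDir p N D) (v : EuclideanSpace ℝ (Fin n)) :
    lorForm n (N, 1) (D v) = 0 := by
  rw [lorForm_apply, h.normal, one_mul, sub_self]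

theorem lorForm_ne_zero (h : NullDir p N D) (h' : NullDir p N' D) (hne : N ≠ N') :
    lorForm n (N, 1) (N', 1) ≠ 0 := by
  rw [lorForm_apply, mul_one, sub_ne_zero, Ne,
    inner_eq_one_iff_of_norm_eq_one h.norm_eq_one h'.norm_eq_one]
  exact hne

theorem comp_iff {T : EuclideanSpace ℝ (Fin n) →L[ℝ] EuclideanSpace ℝ (Fin n)}
    (hT : Function.Surjective T) : NullDir p N (D ∘L T) ↔ NullDir p N D :=
  ⟨fun h => ⟨h.unit, h.perp, hT.forall.2 h.normal⟩,
    fun h => ⟨h.unit, h.perp, fun v => h.normal (T v)⟩⟩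

theorem inner_reduced (h : NullDir p N D) (v w : EuclideanSpace ℝ (Fin n)) :
    ⟪reduced D N v, reduced D N w⟫ = lorForm n (D v) (D w) := by
  have hv := (real_inner_comm _ _).trans (h.normal v)
  simp only [reduced_apply, inner_sub_left, inner_sub_right, real_inner_smul_left,
    real_inner_smul_right, hv, h.normal, h.unit, lorForm_apply]
  ring

theorem injective_reduced (h : NullDir p N D)
    (hD : ∀ v, (∀ w, lorForm n (D v) (D w) = 0) → v = 0) :
    Function.Injective (reduced D N) := by
  refine (injective_iff_map_eq_zero _).2 fun v hv => hD v fun w => ?_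
  rw [← h.inner_reduced, hv, inner_zero_left]

theorem inner_reduced_left (h : NullDir p N D) (v : EuclideanSpace ℝ (Fin n)) :
    ⟪N, reduced D N v⟫ = 0 := by
  rw [reduced_apply, inner_sub_right, real_inner_smul_right, h.unit, h.normal, mul_one, sub_self]

theorem inner_base_reduced (h : NullDir p N D) (hD : ∀ v, ⟪p, (D v).1⟫ = 0)
    (v : EuclideanSpace ℝ (Fin n)) : ⟪p, reduced D N v⟫ = 0 := by
  rw [reduced_apply, inner_sub_right, real_inner_smul_right, hD, real_inner_comm, h.perp, mul_zero,
    sub_zero]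

theorem eq_zero_of_perp (h : NullDir p N D) (hp : ⟪p, p⟫ = 1) (hD : ∀ v, ⟪p, (D v).1⟫ = 0)
    (hinj : Function.Injective (reduced D N)) {u : Euc n} (hup : ⟪p, u⟫ = 0) (huN : ⟪N, u⟫ = 0)
    (huD : ∀ v, ⟪(D v).1, u⟫ = 0) : u = 0 := by
  obtain ⟨v, hv⟩ := exists_eq_apply_of_perp hinj hp h.unit h.perp (h.inner_base_reduced hD)
    h.inner_reduced_left hup huN
  rw [← inner_self_eq_zero (𝕜 := ℝ)]
  nth_rewrite 1 [hv]
  rw [reduced_apply, inner_sub_left, real_inner_smul_left, huN, huD, mul_zero, sub_zero]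

theorem exists_eq_smul_add_smul (h : NullDir p N D) (h' : NullDir p N' D) (hne : N ≠ N')
    (hp : ⟪p, p⟫ = 1) (hD : ∀ v, ⟪p, (D v).1⟫ = 0) (hinj : Function.Injective (reduced D N))
    {ζ : Euc n × ℝ} (hζp : ⟪p, ζ.1⟫ = 0) (hζ : ∀ v, lorForm n ζ (D v) = 0) :
    ∃ α β : ℝ, ζ = α • (N, 1) + β • (N', 1) := by
  have hNN' : ⟪N, N'⟫ - 1 ≠ 0 := by
    simpa only [lorForm_apply, mul_one] using h.lorForm_ne_zero h' hne
  let β := (⟪N, ζ.1⟫ - ζ.2) / (⟪N, N'⟫ - 1)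
  have hβ : β * (⟪N, N'⟫ - 1) = ⟪N, ζ.1⟫ - ζ.2 := div_mul_cancel₀ _ hNN'
  have hfst : ζ.1 - ((ζ.2 - β) • N + β • N') = 0 := by
    refine h.eq_zero_of_perp hp hD hinj ?_ ?_ fun v => ?_
    · simp only [inner_sub_right, inner_add_right, real_inner_smul_right, real_inner_comm N p,
        real_inner_comm N' p, h.perp, h'.perp, hζp]
      ring
    · simp only [inner_sub_right, inner_add_right, real_inner_smul_right, h.unit]
      linear_combination -hβ
    · have hv := hζ v
      rw [lorForm_apply] at hv
      rw [real_inner_comm]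
      simp only [inner_sub_left, inner_add_left, real_inner_smul_left, h.normal, h'.normal]
      linear_combination hv
  refine ⟨ζ.2 - β, β, Prod.ext (sub_eq_zero.1 hfst) ?_⟩
  simp only [Prod.snd_add, Prod.smul_snd, smul_eq_mul, mul_one, sub_add_cancel]

-- The second null direction is the other intersection of the unit sphere with the line through
-- `N` and `q`, where `q ⟂ N` is the vector of the range of `reduced D N` with `⟪q, D v⟫ = (D v).2`.
theorem exists_ne (h : NullDir p N D) (hD : ∀ v, ⟪p, (D v).1⟫ = 0)
    (hinj : Function.Injective (reduced D N)) : ∃ N', NullDir p N' D ∧ N ≠ N' := by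
  obtain ⟨z, hz⟩ := exists_inner_map_eq hinj (ContinuousLinearMap.snd ℝ _ _ ∘L D)
  have hNq := h.inner_reduced_left z
  have hqp := (real_inner_comm _ _).trans (h.inner_base_reduced hD z)
  have hqD : ∀ v, ⟪reduced D N z, (D v).1⟫ = (D v).2 := fun v => by
    rw [← sub_add_cancel (D v).1 ((D v).2 • N), ← reduced_apply, inner_add_right, hz,
      real_inner_smul_right, real_inner_comm, hNq, mul_zero, add_zero]
    rfl
  set q := reduced D N z
  have hpos : 0 < 1 + ⟪q, q⟫ := add_pos_of_pos_of_nonneg one_pos real_inner_self_nonneg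
  have hN' : NullDir p (N + (2 / (1 + ⟪q, q⟫)) • (q - N)) D := by
    refine ⟨?_, ?_, fun v => ?_⟩
    · simp only [inner_add_left, inner_add_right, real_inner_smul_left, real_inner_smul_right,
        inner_sub_left, inner_sub_right, h.unit, hNq, real_inner_comm N q]
      field_simp
      ring
    · simp only [inner_add_left, real_inner_smul_left, inner_sub_left, h.perp, hqp]
      ring
    · simp only [inner_add_left, real_inner_smul_left, inner_sub_left, h.normal, hqD]
      ring
  refine ⟨_, hN', fun heq => ?_⟩
  have hinner := congrArg (inner ℝ N) heq
  rw [inner_add_right, real_inner_smul_right, inner_sub_right, hNq, h.unit] at hinner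
  field_simp at hinner
  linarith

end NullDir

theorem exists_unit_perp (D₁ : EuclideanSpace ℝ (Fin n) →L[ℝ] Euc n) (p : Euc n) :
    ∃ m : Euc n, ⟪m, m⟫ = 1 ∧ ⟪m, p⟫ = 0 ∧ ∀ v, ⟪m, D₁ v⟫ = 0 := by
  let L := LinearMap.range D₁.toLinearMap ⊔ (ℝ ∙ p)
  have hL : Module.finrank ℝ L < Module.finrank ℝ (Euc n) :=
    calc Module.finrank ℝ L
        ≤ Module.finrank ℝ (LinearMap.range D₁.toLinearMap) + Module.finrank ℝ (ℝ ∙ p) :=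
          Submodule.finrank_add_le_finrank_add_finrank _ _
      _ ≤ n + 1 := add_le_add
          ((LinearMap.finrank_range_le _).trans_eq finrank_euclideanSpace_fin)
          ((finrank_span_le_card {p}).trans_eq (by rw [Set.toFinset_singleton]; rfl))
      _ < Module.finrank ℝ (Euc n) := by rw [finrank_euclideanSpace_fin]; lia
  obtain ⟨m, hmL, hm⟩ := exists_mem_orthogonal_inner_self_eq_one hL
  rw [Submodule.mem_orthogonal'] at hmL
  exact ⟨m, hm, hmL p (Submodule.mem_sup_right (Submodule.mem_span_singleton_self p)),
    fun v => hmL _ (Submodule.mem_sup_left ⟨v, rfl⟩)⟩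

theorem exists_nullDir (hD : ∀ v, ⟪p, (D v).1⟫ = 0)
    (hpos : ∀ v, v ≠ 0 → 0 < lorForm n (D v) (D v)) : ∃ N, NullDir p N D := by
  let D₁ := ContinuousLinearMap.fst ℝ _ _ ∘L D
  have hlt : ∀ v, v ≠ 0 → (D v).2 ^ 2 < ⟪D₁ v, D₁ v⟫ := fun v hv => by
    have hv' := hpos v hv
    rwa [lorForm_apply, sub_pos, ← sq] at hv'
  have hinj : Function.Injective D₁ := (injective_iff_map_eq_zero _).2 fun v hv =>
    by_contra fun hv0 => by
      have hv' := hlt v hv0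
      rw [hv, inner_zero_left] at hv'
      exact hv'.not_ge (sq_nonneg _)
  obtain ⟨z, hz⟩ := exists_inner_map_eq hinj (ContinuousLinearMap.snd ℝ _ _ ∘L D)
  replace hz : ∀ v, ⟪D₁ z, D₁ v⟫ = (D v).2 := hz
  have hle : ⟪D₁ z, D₁ z⟫ ≤ 1 := by
    rcases eq_or_ne z 0 with rfl | hz0
    · rw [map_zero, inner_zero_left]
      exact zero_le_one
    · have hz' := hlt z hz0
      rw [← hz z] at hz'
      nlinarith only [hz', real_inner_self_nonneg (F := Euc n) (x := D₁ z)]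
  obtain ⟨m, hm, hmp, hmD⟩ := exists_unit_perp D₁ p
  have hmz : ⟪D₁ z, m⟫ = 0 := (real_inner_comm _ _).trans (hmD z)
  have hsq := Real.mul_self_sqrt (sub_nonneg.2 hle)
  refine ⟨D₁ z + √(1 - ⟪D₁ z, D₁ z⟫) • m, ?_, ?_, fun v => ?_⟩
  · simp only [inner_add_left, inner_add_right, real_inner_smul_left, real_inner_smul_right, hm,
      hmD, hmz]
    linear_combination hsq
  · rw [inner_add_left, real_inner_smul_left, hmp, mul_zero, add_zero, real_inner_comm]
    exact hD z
  · rw [inner_add_left, real_inner_smul_left]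
    change ⟪D₁ z, D₁ v⟫ + _ * ⟪m, D₁ v⟫ = _
    rw [hmD, hz, mul_zero, add_zero]

theorem nullDir_of_null {ζ : Euc n × ℝ} (hζ0 : ζ ≠ 0) (hnull : lorForm n ζ ζ = 0)
    (hp : ⟪p, ζ.1⟫ = 0) (hD : ∀ v, lorForm n ζ (D v) = 0) :
    ζ.2 ≠ 0 ∧ NullDir p (ζ.2⁻¹ • ζ.1) D := by
  have hζ2 : ζ.2 ≠ 0 := by
    intro hζ2
    rw [lorForm_apply, hζ2, mul_zero, sub_zero, inner_self_eq_zero] at hnull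
    exact hζ0 (Prod.ext hnull hζ2)
  rw [lorForm_apply, sub_eq_zero] at hnull
  refine ⟨hζ2, ?_, ?_, fun v => ?_⟩
  · rw [real_inner_smul_left, real_inner_smul_right, hnull]
    field_simp
  · rw [real_inner_smul_left, real_inner_comm, hp, mul_zero]
  · have hv := hD v
    rw [lorForm_apply, sub_eq_zero] at hv
    rw [real_inner_smul_left, hv, inv_mul_cancel_left₀ hζ2]

end NullDir

/-! ### Charts -/

section Charts

variable {n : ℕ} {M : Type*} [TopologicalSpace M] [ChartedSpace (EuclideanSpace ℝ (Fin n)) M]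
  {X V : Type*} [NormedAddCommGroup V] [NormedSpace ℝ V] {f : M → V} {x y : M}

/-- The map `f` in the preferred chart at `x`. -/
def inChart (x : M) (f : M → X) : EuclideanSpace ℝ (Fin n) → X :=
  f ∘ (extChartAt (𝓡 n) x).symm

/-- The change of coordinates from the preferred chart at `y` to the one at `x`, as a map between
the tangent spaces that `diff` uses. -/
def chartChange (x y : M) : EuclideanSpace ℝ (Fin n) →L[ℝ] EuclideanSpace ℝ (Fin n) :=
  mfderiv (𝓡 n) 𝓘(ℝ, EuclideanSpace ℝ (Fin n)) (extChartAt (𝓡 n) x) y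

theorem inChart_apply (hy : y ∈ (extChartAt (𝓡 n) x).source) (f : M → X) :
    inChart x f (extChartAt (𝓡 n) x y) = f y := by
  rw [inChart, Function.comp_apply, PartialEquiv.left_inv _ hy]

theorem inChart_apply_self (x : M) (f : M → X) : inChart x f (extChartAt (𝓡 n) x x) = f x :=
  inChart_apply (n := n) (mem_extChartAt_source x) f

theorem eventually_inChart {p : M → Prop} (h : ∀ᶠ y in 𝓝 x, p y) :
    ∀ᶠ z in 𝓝 (extChartAt (𝓡 n) x x), p ((extChartAt (𝓡 n) x).symm z) := by
  have hcont := continuousAt_extChartAt_symm (I := 𝓡 n) x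
  rw [ContinuousAt, extChartAt_to_inv] at hcont
  exact hcont.eventually h

theorem eventually_of_inChart {p : EuclideanSpace ℝ (Fin n) → Prop}
    (h : ∀ᶠ z in 𝓝 (extChartAt (𝓡 n) x x), p z) :
    ∀ᶠ y in 𝓝 x, y ∈ (extChartAt (𝓡 n) x).source ∧ p (extChartAt (𝓡 n) x y) :=
  Filter.Eventually.and (extChartAt_source_mem_nhds (I := 𝓡 n) x)
    ((continuousAt_extChartAt (I := 𝓡 n) x).eventually h)

theorem natCast_le_infty (k : ℕ) : (k : WithTop ℕ∞) ≤ ∞ := by exact_mod_cast le_top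

theorem diff_eq_fderiv (hf : MDifferentiableAt (𝓡 n) 𝓘(ℝ, V) f x) :
    diff f x = fderiv ℝ (inChart x f) (extChartAt (𝓡 n) x x) := by
  refine hf.mfderiv.trans ?_
  simp only [writtenInExtChartAt, extChartAt_model_space_eq_id, PartialEquiv.refl_coe,
    Function.id_comp, modelWithCornersSelf_coe, Set.range_id, fderivWithin_univ]
  rfl

variable [IsManifold (𝓡 n) ∞ M]

theorem bijective_chartChange (hy : y ∈ (extChartAt (𝓡 n) x).source) :
    Function.Bijective (chartChange (n := n) x y) := by
  obtain ⟨T, hT⟩ := isInvertible_mfderiv_extChartAt (I := 𝓡 n) hy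
  refine (congrArg Function.Bijective (funext fun v => ?_)).mp T.bijective
  exact congrArg (fun L => L v) hT

theorem contDiffAt_inChart {k : WithTop ℕ∞} (hk : k ≤ ∞)
    (hy : y ∈ (extChartAt (𝓡 n) x).source) (hf : ContMDiffAt (𝓡 n) 𝓘(ℝ, V) k f y) :
    ContDiffAt ℝ k (inChart x f) (extChartAt (𝓡 n) x y) := by
  have : IsManifold (𝓡 n) k M := IsManifold.of_le hk
  have hsymm : ContMDiffAt 𝓘(ℝ, EuclideanSpace ℝ (Fin n)) (𝓡 n) k (extChartAt (𝓡 n) x).symm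
      (extChartAt (𝓡 n) x y) :=
    (contMDiffOn_extChartAt_symm x).contMDiffAt
      ((isOpen_extChartAt_target x).mem_nhds ((extChartAt (𝓡 n) x).map_source hy))
  refine contMDiffAt_iff_contDiffAt.1 (ContMDiffAt.comp (g := f) _ ?_ hsymm)
  rwa [PartialEquiv.left_inv _ hy]

theorem contDiffAt_fderiv_inChart {k : ℕ} (hy : y ∈ (extChartAt (𝓡 n) x).source)
    (hf : ContMDiffAt (𝓡 n) 𝓘(ℝ, V) (k + 1 : ℕ) f y) :
    ContDiffAt ℝ k (fderiv ℝ (inChart x f)) (extChartAt (𝓡 n) x y) :=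
  (contDiffAt_inChart (natCast_le_infty _) hy hf).fderiv_right (by norm_cast)

theorem contMDiffAt_comp_extChartAt {k : WithTop ℕ∞} (hk : k ≤ ∞)
    {g : EuclideanSpace ℝ (Fin n) → V} (hy : y ∈ (extChartAt (𝓡 n) x).source)
    (hg : ContDiffAt ℝ k g (extChartAt (𝓡 n) x y)) :
    ContMDiffAt (𝓡 n) 𝓘(ℝ, V) k (fun w => g (extChartAt (𝓡 n) x w)) y := by
  have : IsManifold (𝓡 n) k M := IsManifold.of_le hk
  have hchart : ContMDiffAt (𝓡 n) 𝓘(ℝ, EuclideanSpace ℝ (Fin n)) k (extChartAt (𝓡 n) x) y :=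
    contMDiffAt_extChartAt' (by rwa [extChartAt_source] at hy)
  exact (contMDiffAt_iff_contDiffAt.2 hg).comp y hchart

theorem eventually_contMDiffAt {k : ℕ} (hf : ContMDiffAt (𝓡 n) 𝓘(ℝ, V) k f x) :
    ∀ᶠ y in 𝓝 x, ContMDiffAt (𝓡 n) 𝓘(ℝ, V) k f y := by
  have : IsManifold (𝓡 n) (k : WithTop ℕ∞) M := IsManifold.of_le (n := ∞) (natCast_le_infty k)
  exact (contMDiffAt_iff_contMDiffAt_nhds (by simp)).1 hf

theorem hasFDerivAt_inChart (hf : ContMDiffAt (𝓡 n) 𝓘(ℝ, V) 1 f x) :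
    HasFDerivAt (inChart x f) (diff f x) (extChartAt (𝓡 n) x x) := by
  rw [diff_eq_fderiv (hf.mdifferentiableAt one_ne_zero)]
  exact ((contDiffAt_inChart (natCast_le_infty 1) (mem_extChartAt_source x)
    hf).differentiableAt one_ne_zero).hasFDerivAt

theorem diff_eq_of_hasFDerivAt (hf : ContMDiffAt (𝓡 n) 𝓘(ℝ, V) 1 f x)
    {L : EuclideanSpace ℝ (Fin n) →L[ℝ] V}
    (h : HasFDerivAt (inChart x f) L (extChartAt (𝓡 n) x x)) : diff f x = L :=
  (hasFDerivAt_inChart hf).unique h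

theorem diff_eq_fderiv_comp_chartChange (hy : y ∈ (extChartAt (𝓡 n) x).source)
    (hf : ContMDiffAt (𝓡 n) 𝓘(ℝ, V) 1 f y) :
    diff f y = fderiv ℝ (inChart x f) (extChartAt (𝓡 n) x y) ∘L chartChange x y := by
  have hchart : MDifferentiableAt (𝓡 n) 𝓘(ℝ, EuclideanSpace ℝ (Fin n)) (extChartAt (𝓡 n) x) y :=
    mdifferentiableAt_extChartAt (by rwa [extChartAt_source] at hy)
  have hin : DifferentiableAt ℝ (inChart x f) (extChartAt (𝓡 n) x y) :=
    (contDiffAt_inChart (natCast_le_infty 1) hy hf).differentiableAt one_ne_zero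
  have heq : f =ᶠ[𝓝 y] inChart x f ∘ extChartAt (𝓡 n) x := by
    filter_upwards [(isOpen_extChartAt_source (I := 𝓡 n) x).mem_nhds hy] with w hw
    exact (inChart_apply hw f).symm
  rw [diff, heq.mfderiv_eq, mfderiv_comp y hin.mdifferentiableAt hchart, mfderiv_eq_fderiv]
  rfl

theorem hasFDerivAt_fderiv_inChart (hf : ContMDiffAt (𝓡 n) 𝓘(ℝ, V) 2 f x) :
    ∃ D₂ : EuclideanSpace ℝ (Fin n) →L[ℝ] EuclideanSpace ℝ (Fin n) →L[ℝ] V,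
      HasFDerivAt (fderiv ℝ (inChart x f)) D₂ (extChartAt (𝓡 n) x x) ∧
        ∀ v w, D₂ v w = diff2 f x v w :=
  ⟨_, ((contDiffAt_fderiv_inChart (mem_extChartAt_source x) hf).differentiableAt
    (by simp)).hasFDerivAt, fun _ _ => rfl⟩

theorem diff2_comm (hf : ContMDiffAt (𝓡 n) 𝓘(ℝ, V) 2 f x) (v w : EuclideanSpace ℝ (Fin n)) :
    diff2 f x v w = diff2 f x w v :=
  ((contDiffAt_inChart (natCast_le_infty 2) (mem_extChartAt_source x) hf).isSymmSndFDerivAt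
    (by simp)).eq v w

end Charts

/-! ### Extrinsic geometry -/

section Extrinsic

variable {n : ℕ} {M : Type*} [TopologicalSpace M] [ChartedSpace (EuclideanSpace ℝ (Fin n)) M]
variable {V : Type*} [NormedAddCommGroup V] [NormedSpace ℝ V] {B : LinearMap.BilinForm ℝ V}

section OrthProj

variable {S : Submodule ℝ V}

theorem orthProj_mem (u : V) : orthProj B S u ∈ S := by
  rw [orthProj]
  split_ifs with h
  · exact h.choose_spec.1
  · exact S.zero_mem

theorem orthProj_spec {u : V} (h : ∃ ξ ∈ S, ∀ η ∈ S, B ξ η = B u η) {η : V} (hη : η ∈ S) :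
    B (orthProj B S u) η = B u η := by
  rw [orthProj, dif_pos h]
  exact h.choose_spec.2 η hη

theorem exists_orthProj_of_null {ξ η : V} (hξ : ξ ∈ S) (hη : η ∈ S) (hξξ : B ξ ξ = 0)
    (hηη : B η η = 0) (hξη : B ξ η ≠ 0) (hB : B.IsSymm)
    (hspan : ∀ ζ ∈ S, ∃ α β : ℝ, ζ = α • ξ + β • η) (u : V) :
    ∃ ξ ∈ S, ∀ η ∈ S, B ξ η = B u η := by
  have hηξ : B η ξ = B ξ η := hB.eq η ξ
  refine ⟨(B u η / B ξ η) • ξ + (B u ξ / B ξ η) • η,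
    S.add_mem (S.smul_mem _ hξ) (S.smul_mem _ hη), fun ζ hζ => ?_⟩
  obtain ⟨α, β, rfl⟩ := hspan ζ hζ
  simp only [map_add, map_smul, LinearMap.add_apply, LinearMap.smul_apply, smul_eq_mul, hξξ, hηη,
    hηξ]
  field_simp
  ring

end OrthProj

variable {W : V → Submodule ℝ V} {f : M → V} {x : M}

theorem mem_normalSpace_iff (hB : B.IsSymm) {ζ : V} :
    ζ ∈ normalSpace n B W f x ↔
      ζ ∈ W (f x) ∧ ∀ v : EuclideanSpace ℝ (Fin n), B ζ (diff f x v) = 0 := by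
  refine Submodule.mem_inf.trans (and_congr_right fun _ => ⟨fun h v => ?_, ?_⟩)
  · exact (hB.eq _ _).symm.trans (h (diff f x v) ⟨v, rfl⟩)
  · rintro h _ ⟨v, rfl⟩
    exact (hB.eq _ _).symm.trans (h v)

theorem secondForm_mem_normalSpace (f : M → V) (x : M) (v w : EuclideanSpace ℝ (Fin n)) :
    secondForm B W f x v w ∈ normalSpace n B W f x :=
  orthProj_mem _

theorem meanCurvature_mem_normalSpace (x : M) :
    meanCurvature n B W f x ∈ normalSpace n B W f x :=
  Submodule.sum_mem _ fun _ _ => Submodule.sum_mem _ fun _ _ =>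
    Submodule.smul_mem _ _ (secondForm_mem_normalSpace ..)

theorem form_meanCurvature_eq_neg_relTrace {Y : Type*} [NormedAddCommGroup Y]
    [InnerProductSpace ℝ Y] [CompleteSpace Y] {P Q : EuclideanSpace ℝ (Fin n) →L[ℝ] Y}
    (hP : Function.Injective P) (hfirst : ∀ v w, firstForm B f x v w = ⟪P v, P w⟫) {ζ : V}
    (hsecond : ∀ v w, B (secondForm B W f x v w) ζ = -⟪Q v, P w⟫) :
    B (meanCurvature n B W f x) ζ = -relTrace P Q := by
  let e := (EuclideanSpace.basisFun (Fin n) ℝ).toBasis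
  have he : ∀ i, e i = EuclideanSpace.single i 1 := fun i => by
    rw [OrthonormalBasis.coe_toBasis, EuclideanSpace.basisFun_apply]
  have hgram : gram B f x = Matrix.gram ℝ (P ∘ e) := Matrix.ext fun i j => by
    rw [gram, Matrix.of_apply, hfirst, ← he, ← he]
    rfl
  simp only [← sum_inv_gram_mul_inner_eq_relTrace e hP Q, ← hgram, meanCurvature, map_sum,
    map_smul, LinearMap.sum_apply, LinearMap.smul_apply, smul_eq_mul, hsecond, he, mul_neg,
    Finset.sum_neg_distrib]

/-- Differentiate `B ξ (df w) = 0` along `v`. -/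
theorem form_diff2_eq_neg_of_normal [FiniteDimensional ℝ V] [IsManifold (𝓡 n) ∞ M] {ξ : M → V}
    (hf : ContMDiffAt (𝓡 n) 𝓘(ℝ, V) 2 f x) (hξ : ContMDiffAt (𝓡 n) 𝓘(ℝ, V) 1 ξ x)
    (hnormal : ∀ᶠ y in 𝓝 x, ∀ w : EuclideanSpace ℝ (Fin n), B (ξ y) (diff f y w) = 0)
    (v w : EuclideanSpace ℝ (Fin n)) :
    B (ξ x) (diff2 f x v w) = -B (diff ξ x v) (diff f x w) := by
  have hf₁ := hf.of_le one_le_two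
  obtain ⟨D₂, hD₂, hD₂_apply⟩ := hasFDerivAt_fderiv_inChart hf
  have hzero : (fun z => B (inChart x ξ z) (fderiv ℝ (inChart x f) z w))
      =ᶠ[𝓝 (extChartAt (𝓡 n) x x)] fun _ => 0 := by
    filter_upwards [eventually_inChart (hnormal.and (eventually_contMDiffAt (k := 1) hf₁)),
      extChartAt_target_mem_nhds (I := 𝓡 n) x] with z ⟨hz, hfz⟩ hzt
    have hzs := (extChartAt (𝓡 n) x).map_target hzt
    obtain ⟨u, rfl⟩ := (bijective_chartChange hzs).2 w
    rw [← hz u, diff_eq_fderiv_comp_chartChange hzs hfz, PartialEquiv.right_inv _ hzt]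
    rfl
  have hderiv := (B.toContinuousBilinearMap.hasFDerivAt_of_bilinear (hasFDerivAt_inChart hξ)
    ((ContinuousLinearMap.apply ℝ V w).hasFDerivAt.comp _ hD₂)).unique
    ((hasFDerivAt_const (0 : ℝ) _).congr_of_eventuallyEq hzero)
  have happly : B (inChart x ξ (extChartAt (𝓡 n) x x)) (D₂ v w) +
      B (diff ξ x v) (fderiv ℝ (inChart x f) (extChartAt (𝓡 n) x x) w) = 0 :=
    DFunLike.congr_fun hderiv v
  rw [inChart_apply_self, ← diff_eq_fderiv (hf₁.mdifferentiableAt one_ne_zero), hD₂_apply] at happly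
  exact eq_neg_of_add_eq_zero_left happly

end Extrinsic

section Charts

variable {n : ℕ} {M : Type*} [TopologicalSpace M] [ChartedSpace (EuclideanSpace ℝ (Fin n)) M]
  {x : M}
variable {V W : Type*} [NormedAddCommGroup V] [NormedSpace ℝ V] [NormedAddCommGroup W]
  [NormedSpace ℝ W]

theorem contMDiffAt_fst_apply {k : WithTop ℕ∞} {F : M → V × W}
    (hF : ContMDiffAt (𝓡 n) 𝓘(ℝ, V × W) k F x) :
    ContMDiffAt (𝓡 n) 𝓘(ℝ, V) k (fun y => (F y).1) x :=
  (ContinuousLinearMap.fst ℝ V W).contMDiff.contMDiffAt.comp x hF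

theorem contMDiffAt_snd_apply {k : WithTop ℕ∞} {F : M → V × W}
    (hF : ContMDiffAt (𝓡 n) 𝓘(ℝ, V × W) k F x) :
    ContMDiffAt (𝓡 n) 𝓘(ℝ, W) k (fun y => (F y).2) x :=
  (ContinuousLinearMap.snd ℝ V W).contMDiff.contMDiffAt.comp x hF

variable [IsManifold (𝓡 n) ∞ M]

theorem diff_clm_comp (L : V →L[ℝ] W) {f : M → V} (hf : ContMDiffAt (𝓡 n) 𝓘(ℝ, V) 1 f x) :
    diff (n := n) (fun y => L (f y)) x = L ∘L diff f x :=
  diff_eq_of_hasFDerivAt (L.contMDiff.contMDiffAt.comp x hf)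
    (L.hasFDerivAt.comp _ (hasFDerivAt_inChart hf))

theorem diff_prodMk {f : M → V} {g : M → W} (hf : ContMDiffAt (𝓡 n) 𝓘(ℝ, V) 1 f x)
    (hg : ContMDiffAt (𝓡 n) 𝓘(ℝ, W) 1 g x) :
    diff (n := n) (fun y => (f y, g y)) x = (diff f x).prod (diff g x) :=
  diff_eq_of_hasFDerivAt (hf.prodMk_space hg)
    ((hasFDerivAt_inChart hf).prodMk (hasFDerivAt_inChart hg))

theorem inner_diff_add_inner_diff {V : Type*} [NormedAddCommGroup V] [InnerProductSpace ℝ V]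
    {f g : M → V} (hf : ContMDiffAt (𝓡 n) 𝓘(ℝ, V) 1 f x) (hg : ContMDiffAt (𝓡 n) 𝓘(ℝ, V) 1 g x)
    {c : ℝ} (h : ∀ᶠ y in 𝓝 x, ⟪f y, g y⟫ = c) (v : EuclideanSpace ℝ (Fin n)) :
    ⟪f x, diff g x v⟫ + ⟪diff f x v, g x⟫ = 0 := by
  have hconst : (fun z => ⟪inChart x f z, inChart x g z⟫)
      =ᶠ[𝓝 (extChartAt (𝓡 n) x x)] fun _ => c := eventually_inChart h
  have hderiv := ((hasFDerivAt_inChart hf).inner ℝ (hasFDerivAt_inChart hg)).unique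
    ((hasFDerivAt_const c _).congr_of_eventuallyEq hconst)
  rw [inChart_apply_self, inChart_apply_self] at hderiv
  exact DFunLike.congr_fun hderiv v

theorem inner_diff_self_eq_zero {V : Type*} [NormedAddCommGroup V] [InnerProductSpace ℝ V]
    {f : M → V} (hf : ContMDiffAt (𝓡 n) 𝓘(ℝ, V) 1 f x) {c : ℝ} (h : ∀ᶠ y in 𝓝 x, ‖f y‖ = c)
    (v : EuclideanSpace ℝ (Fin n)) : ⟪f x, diff f x v⟫ = 0 := by
  have hsum := inner_diff_add_inner_diff hf hf (c := c ^ 2)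
    (h.mono fun y hy => by rw [real_inner_self_eq_norm_sq, hy]) v
  rwa [real_inner_comm (f x), add_self_eq_zero] at hsum

theorem diff_fst_apply {F : M → V × W} (hF : ContMDiffAt (𝓡 n) 𝓘(ℝ, V × W) 1 F x)
    (v : EuclideanSpace ℝ (Fin n)) : diff (fun y => (F y).1) x v = (diff F x v).1 :=
  DFunLike.congr_fun (diff_clm_comp (.fst ℝ V W) hF) v

theorem inner_fst_diff_eq_zero {V : Type*} [NormedAddCommGroup V] [InnerProductSpace ℝ V]
    {F : M → V × W} (hF : ContMDiffAt (𝓡 n) 𝓘(ℝ, V × W) 1 F x)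
    {c : ℝ} (h : ∀ᶠ y in 𝓝 x, ‖(F y).1‖ = c) (v : EuclideanSpace ℝ (Fin n)) :
    ⟪(F x).1, (diff F x v).1⟫ = 0 := by
  rw [← diff_fst_apply hF, inner_diff_self_eq_zero (contMDiffAt_fst_apply hF) h]

end Charts

/-! ### Null normal fields -/

section NullField

variable {n : ℕ} {M : Type*} [TopologicalSpace M] [ChartedSpace (EuclideanSpace ℝ (Fin n)) M]
  {F : M → Euc n × ℝ} {N : M → Euc n} {x : M}

theorem mem_normalSpace_lorForm_iff {ζ : Euc n × ℝ} :
    ζ ∈ normalSpace n (lorForm n) (productTangent n) F x ↔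
      ⟪(F x).1, ζ.1⟫ = 0 ∧ ∀ v : EuclideanSpace ℝ (Fin n), lorForm n ζ (diff F x v) = 0 := by
  rw [mem_normalSpace_iff lorForm_isSymm, productTangent, Submodule.mem_prod, sphereTangent,
    Submodule.mem_orthogonal_singleton_iff_inner_right, and_iff_left Submodule.mem_top]

theorem NullDir.mem_normalSpace {q : Euc n} (h : NullDir (F x).1 q (diff F x)) :
    (q, (1 : ℝ)) ∈ normalSpace n (lorForm n) (productTangent n) F x :=
  mem_normalSpace_lorForm_iff.2 ⟨(real_inner_comm _ _).trans h.perp, h.lorForm_apply_eq_zero⟩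

theorem NullDir.lorForm_self_eq_zero_iff {p q q' : Euc n}
    {D : EuclideanSpace ℝ (Fin n) →L[ℝ] Euc n × ℝ} (h : NullDir p q D) (h' : NullDir p q' D)
    (hne : q ≠ q') (hp : ⟪p, p⟫ = 1) (hD : ∀ v, ⟪p, (D v).1⟫ = 0)
    (hinj : Function.Injective (reduced D q)) {ζ : Euc n × ℝ} (hζp : ⟪p, ζ.1⟫ = 0)
    (hζ : ∀ v, lorForm n ζ (D v) = 0) :
    lorForm n ζ ζ = 0 ↔ lorForm n ζ (q, 1) = 0 ∨ lorForm n ζ (q', 1) = 0 := by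
  have hqq' := h.lorForm_ne_zero h' hne
  obtain ⟨α, β, rfl⟩ := h.exists_eq_smul_add_smul h' hne hp hD hinj hζp hζ
  have hsymm : lorForm n (q', (1 : ℝ)) (q, 1) = lorForm n (q, 1) (q', 1) := lorForm_isSymm.eq _ _
  simp only [map_add, map_smul, LinearMap.add_apply, LinearMap.smul_apply, smul_eq_mul,
    h.lorForm_self, h'.lorForm_self, hsymm, mul_zero, zero_add, add_zero, mul_eq_zero, hqq',
    or_false]
  rw [mul_left_comm, add_self_eq_zero, mul_eq_zero, mul_eq_zero, or_iff_left hqq']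

/-- The derivative of the null normal field `(N, 1)` along `F`, tangent to the sphere. -/
def twist (F : M → Euc n × ℝ) (N : M → Euc n) (x : M) : EuclideanSpace ℝ (Fin n) →L[ℝ] Euc n :=
  diff N x + (ContinuousLinearMap.snd ℝ _ _ ∘L diff F x).smulRight (F x).1

theorem twist_apply (v : EuclideanSpace ℝ (Fin n)) :
    twist F N x v = diff N x v + (diff F x v).2 • (F x).1 := rfl

/-- `(N, 1)` is a null normal field of class `C¹` along the `C²` immersion `F` near `x`. -/
structure IsNullField (F : M → Euc n × ℝ) (N : M → Euc n) (x : M) : Prop where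
  contMDiffAt : ContMDiffAt (𝓡 n) 𝓘(ℝ, Euc n × ℝ) 2 F x
  base_unit : ∀ᶠ y in 𝓝 x, ‖(F y).1‖ = 1
  field_contMDiffAt : ContMDiffAt (𝓡 n) 𝓘(ℝ, Euc n) 1 N x
  nullDir : ∀ᶠ y in 𝓝 x, NullDir (F y).1 (N y) (diff F y)
  injective : ∀ᶠ y in 𝓝 x, Function.Injective (reduced (diff F y) (N y))

namespace IsNullField

theorem inner_base (h : IsNullField F N x) : ⟪(F x).1, (F x).1⟫ = 1 := by
  rw [real_inner_self_eq_norm_sq, h.base_unit.self_of_nhds, one_pow]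

theorem contMDiffAt_one (h : IsNullField F N x) : ContMDiffAt (𝓡 n) 𝓘(ℝ, Euc n × ℝ) 1 F x :=
  h.contMDiffAt.of_le one_le_two

variable [IsManifold (𝓡 n) ∞ M]

theorem eventually (h : IsNullField F N x) : ∀ᶠ y in 𝓝 x, IsNullField F N y := by
  filter_upwards [eventually_contMDiffAt (k := 2) h.contMDiffAt, h.base_unit.eventually_nhds,
    eventually_contMDiffAt (k := 1) h.field_contMDiffAt, h.nullDir.eventually_nhds,
    h.injective.eventually_nhds] with y hF hunit hN hdir hinj
  exact ⟨hF, hunit, hN, hdir, hinj⟩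

theorem inner_base_diff (h : IsNullField F N x) (v : EuclideanSpace ℝ (Fin n)) :
    ⟪(F x).1, (diff F x v).1⟫ = 0 :=
  inner_fst_diff_eq_zero h.contMDiffAt_one h.base_unit v

theorem inner_field_diff (h : IsNullField F N x) (v : EuclideanSpace ℝ (Fin n)) :
    ⟪N x, diff N x v⟫ = 0 :=
  inner_diff_self_eq_zero h.field_contMDiffAt (h.nullDir.mono fun _ hy => hy.norm_eq_one) v

theorem inner_base_diff_field (h : IsNullField F N x) (v : EuclideanSpace ℝ (Fin n)) :
    ⟪(F x).1, diff N x v⟫ = -(diff F x v).2 := by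
  have hsum := inner_diff_add_inner_diff h.field_contMDiffAt
    (contMDiffAt_fst_apply h.contMDiffAt_one) (c := 0) (h.nullDir.mono fun y hy => hy.perp) v
  rw [diff_fst_apply h.contMDiffAt_one, h.nullDir.self_of_nhds.normal, real_inner_comm] at hsum
  exact eq_neg_of_add_eq_zero_right hsum

theorem inner_field_twist (h : IsNullField F N x) (v : EuclideanSpace ℝ (Fin n)) :
    ⟪N x, twist F N x v⟫ = 0 := by
  rw [twist_apply, inner_add_right, real_inner_smul_right, h.inner_field_diff,
    h.nullDir.self_of_nhds.perp, mul_zero, add_zero]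

theorem inner_base_twist (h : IsNullField F N x) (v : EuclideanSpace ℝ (Fin n)) :
    ⟪(F x).1, twist F N x v⟫ = 0 := by
  rw [twist_apply, inner_add_right, real_inner_smul_right, h.inner_base_diff_field, h.inner_base,
    mul_one, neg_add_cancel]

theorem exists_twist_eq (h : IsNullField F N x) (v : EuclideanSpace ℝ (Fin n)) :
    ∃ u, twist F N x v = reduced (diff F x) (N x) u :=
  exists_eq_apply_of_perp h.injective.self_of_nhds h.inner_base h.nullDir.self_of_nhds.unit
    h.nullDir.self_of_nhds.perp
    (h.nullDir.self_of_nhds.inner_base_reduced h.inner_base_diff)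
    h.nullDir.self_of_nhds.inner_reduced_left (h.inner_base_twist v) (h.inner_field_twist v)

theorem inner_twist_reduced (h : IsNullField F N x) (v w : EuclideanSpace ℝ (Fin n)) :
    ⟪twist F N x v, reduced (diff F x) (N x) w⟫ = ⟪diff N x v, (diff F x w).1⟫ := by
  rw [twist_apply, inner_add_left, real_inner_smul_left,
    h.nullDir.self_of_nhds.inner_base_reduced h.inner_base_diff, mul_zero, add_zero, reduced_apply,
    inner_sub_right, real_inner_smul_right, real_inner_comm (N x), h.inner_field_diff, mul_zero,
    sub_zero]

theorem lorForm_diff2 (h : IsNullField F N x) (v w : EuclideanSpace ℝ (Fin n)) :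
    lorForm n (N x, 1) (diff2 F x v w) = -⟪twist F N x v, reduced (diff F x) (N x) w⟫ := by
  have hconst : ContMDiffAt (𝓡 n) 𝓘(ℝ, ℝ) 1 (fun _ => (1 : ℝ)) x := contMDiffAt_const
  have hdiff_const : diff (n := n) (fun _ => (1 : ℝ)) x = 0 := mfderiv_const
  rw [form_diff2_eq_neg_of_normal (ξ := fun y => (N y, (1 : ℝ))) h.contMDiffAt
    (h.field_contMDiffAt.prodMk_space hconst)
    (h.nullDir.mono fun _ hy => hy.lorForm_apply_eq_zero), diff_prodMk h.field_contMDiffAt hconst,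
    hdiff_const, h.inner_twist_reduced, lorForm_apply, ContinuousLinearMap.prod_apply,
    zero_apply, zero_mul, sub_zero]

theorem exists_orthProj (h : IsNullField F N x) (u : Euc n × ℝ) :
    ∃ ξ ∈ normalSpace n (lorForm n) (productTangent n) F x,
      ∀ η ∈ normalSpace n (lorForm n) (productTangent n) F x,
        lorForm n ξ η = lorForm n u η := by
  have hN := h.nullDir.self_of_nhds
  have hinj := h.injective.self_of_nhds
  obtain ⟨N', hN', hne⟩ := hN.exists_ne h.inner_base_diff hinj
  refine exists_orthProj_of_null hN.mem_normalSpace hN'.mem_normalSpace hN.lorForm_self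
    hN'.lorForm_self (hN.lorForm_ne_zero hN' hne) lorForm_isSymm (fun ζ hζ => ?_) u
  rw [mem_normalSpace_lorForm_iff] at hζ
  exact hN.exists_eq_smul_add_smul hN' hne h.inner_base h.inner_base_diff hinj hζ.1 hζ.2

theorem lorForm_secondForm (h : IsNullField F N x) (v w : EuclideanSpace ℝ (Fin n))
    {ζ : Euc n × ℝ} (hζ : ζ ∈ normalSpace n (lorForm n) (productTangent n) F x) :
    lorForm n (secondFormL F x v w) ζ = lorForm n (diff2 F x v w) ζ :=
  orthProj_spec (h.exists_orthProj _) hζ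

theorem lorForm_secondForm_field (h : IsNullField F N x) (v w : EuclideanSpace ℝ (Fin n)) :
    lorForm n (secondFormL F x v w) (N x, 1) =
      -⟪twist F N x v, reduced (diff F x) (N x) w⟫ := by
  rw [h.lorForm_secondForm v w h.nullDir.self_of_nhds.mem_normalSpace, ← h.lorForm_diff2]
  exact lorForm_isSymm.eq _ _

theorem lorForm_meanCurvature (h : IsNullField F N x) :
    lorForm n (meanCurvatureL F x) (N x, 1) =
      -relTrace (reduced (diff F x) (N x)) (twist F N x) :=
  form_meanCurvature_eq_neg_relTrace h.injective.self_of_nhds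
    (fun v w => (h.nullDir.self_of_nhds.inner_reduced v w).symm) h.lorForm_secondForm_field

end IsNullField

end NullField

/-! ### Existence of null normal fields -/

section ImplicitFunction

variable {X Y Z : Type*} [NormedAddCommGroup X] [NormedSpace ℝ X] [FiniteDimensional ℝ X]
  [NormedAddCommGroup Y] [NormedSpace ℝ Y] [FiniteDimensional ℝ Y]

theorem isInvertible_of_injective {L : X →L[ℝ] Y} (hL : Function.Injective L)
    (hdim : Module.finrank ℝ X = Module.finrank ℝ Y) : L.IsInvertible :=
  ⟨(LinearEquiv.ofInjectiveOfFinrankEq L.toLinearMap hL hdim).toContinuousLinearEquiv, by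
    ext v; rfl⟩

theorem exists_implicit [NormedAddCommGroup Z] [NormedSpace ℝ Z] [CompleteSpace Z]
    (hdim : Module.finrank ℝ X = Module.finrank ℝ Y) {k : WithTop ℕ∞} (hk : k ≠ 0)
    {G : Z × X → Y} {z : Z} {u : X} (hG : ContDiffAt ℝ k G (z, u)) (hzero : G (z, u) = 0)
    {L : X →L[ℝ] Y} (hL : HasFDerivAt (fun u => G (z, u)) L u) (hinj : Function.Injective L) :
    ∃ ψ : Z → X, ContDiffAt ℝ k ψ z ∧ ψ z = u ∧ (∀ᶠ y in 𝓝 z, G (y, ψ y) = 0) ∧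
      ∀ᶠ w in 𝓝 (z, u), G w = 0 → w.2 = ψ w.1 := by
  have : CompleteSpace X := FiniteDimensional.complete ℝ X
  have : CompleteSpace Y := FiniteDimensional.complete ℝ Y
  have hpartial : HasFDerivAt (fun u => G (z, u)) (fderiv ℝ G (z, u) ∘L .inr ℝ Z X) u :=
    HasFDerivAt.comp (g := G) u (hG.differentiableAt hk).hasFDerivAt (hasFDerivAt_prodMk_right z u)
  have hinv : (fderiv ℝ G (z, u) ∘L .inr ℝ Z X).IsInvertible := by
    rw [hpartial.unique hL]
    exact isInvertible_of_injective hinj hdim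
  refine ⟨hG.implicitFunction hk hinv, hG.contDiffAt_implicitFunction hk hinv,
    hG.implicitFunction_apply_self hk hinv, ?_, ?_⟩
  · have hlevel := hG.eventually_apply_implicitFunction hk hinv
    rwa [hzero] at hlevel
  · filter_upwards [hG.eventually_apply_eq_iff_implicitFunction hk hinv] with w hw hw_zero
    exact (hw.1 (hw_zero.trans hzero.symm)).symm

end ImplicitFunction

section NullSystem

variable {n : ℕ} {p q : Euc n} {D : EuclideanSpace ℝ (Fin n) →L[ℝ] Euc n × ℝ}

/-- The left-hand sides of the equations that define `NullDir p u D`, as a map of `u` between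
spaces of the same dimension. -/
def nullSystem (p : Euc n) (D : EuclideanSpace ℝ (Fin n) →L[ℝ] Euc n × ℝ) (u : Euc n) :
    ℝ × ℝ × (EuclideanSpace ℝ (Fin n) →L[ℝ] ℝ) :=
  (⟪u, u⟫ - 1, ⟪p, u⟫, innerSL ℝ u ∘L (ContinuousLinearMap.fst ℝ _ _ ∘L D) -
    ContinuousLinearMap.snd ℝ _ _ ∘L D)

theorem nullSystem_eq_zero_iff : nullSystem p D q = 0 ↔ NullDir p q D := by
  simp only [nullSystem, Prod.mk_eq_zero, sub_eq_zero]
  constructor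
  · rintro ⟨hunit, hperp, hnormal⟩
    exact ⟨hunit, (real_inner_comm _ _).trans hperp, fun v => DFunLike.congr_fun hnormal v⟩
  · exact fun h => ⟨h.unit, (real_inner_comm _ _).trans h.perp,
      ContinuousLinearMap.ext fun v => h.normal v⟩

theorem contDiffAt_nullSystem {X : Type*} [NormedAddCommGroup X] [NormedSpace ℝ X]
    {k : WithTop ℕ∞} {p u : X → Euc n} {D : X → EuclideanSpace ℝ (Fin n) →L[ℝ] Euc n × ℝ} {z : X}
    (hp : ContDiffAt ℝ k p z) (hD : ContDiffAt ℝ k D z) (hu : ContDiffAt ℝ k u z) :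
    ContDiffAt ℝ k (fun y => nullSystem (p y) (D y) (u y)) z :=
  ((hu.inner ℝ hu).sub contDiffAt_const).prodMk ((hp.inner ℝ hu).prodMk
    ((((innerSL ℝ).contDiff.contDiffAt.comp z hu).clm_comp
      (contDiffAt_const.clm_comp hD)).sub (contDiffAt_const.clm_comp hD)))

theorem NullDir.exists_hasFDerivAt_nullSystem (h : NullDir p q D) (hp : ⟪p, p⟫ = 1)
    (hD : ∀ v, ⟪p, (D v).1⟫ = 0) (hinj : Function.Injective (reduced D q)) :
    ∃ L : Euc n →L[ℝ] ℝ × ℝ × (EuclideanSpace ℝ (Fin n) →L[ℝ] ℝ),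
      HasFDerivAt (nullSystem p D) L q ∧ Function.Injective L := by
  let R := ((ContinuousLinearMap.compL ℝ (EuclideanSpace ℝ (Fin n)) (Euc n) ℝ).flip
    (ContinuousLinearMap.fst ℝ _ _ ∘L D)).comp (innerSL ℝ)
  refine ⟨((2 : ℝ) • innerSL ℝ q).prod ((innerSL ℝ p).prod R),
    HasFDerivAt.prodMk ?_ ((innerSL ℝ p).hasFDerivAt.prodMk (R.hasFDerivAt.sub_const _)),
    (injective_iff_map_eq_zero _).2 fun u hu => ?_⟩
  · convert! ((hasFDerivAt_id q).inner ℝ (hasFDerivAt_id q)).sub_const 1 using 1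
    ext v
    simp [two_mul, real_inner_comm]
  · have hqu : (2 : ℝ) * ⟪q, u⟫ = 0 := congrArg Prod.fst hu
    have hpu : ⟪p, u⟫ = 0 := congrArg (fun w => w.2.1) hu
    have hDu : ∀ v, ⟪u, (D v).1⟫ = 0 := fun v =>
      DFunLike.congr_fun (congrArg (fun w => w.2.2) hu) v
    exact h.eq_zero_of_perp hp hD hinj hpu (by linarith) fun v =>
      (real_inner_comm _ _).trans (hDu v)

theorem finrank_nullSystem : Module.finrank ℝ (Euc n) =
    Module.finrank ℝ (ℝ × ℝ × (EuclideanSpace ℝ (Fin n) →L[ℝ] ℝ)) := by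
  rw [Module.finrank_prod, Module.finrank_prod, Module.finrank_self, finrank_euclideanSpace_fin,
    ← (LinearMap.toContinuousLinearMap
      (𝕜 := ℝ) (E := EuclideanSpace ℝ (Fin n)) (F' := ℝ)).finrank_eq, Module.finrank_linearMap,
    finrank_euclideanSpace_fin, Module.finrank_self]
  omega

theorem NullDir.exists_implicit {k : ℕ} (hk : k ≠ 0) {f : EuclideanSpace ℝ (Fin n) → Euc n × ℝ}
    {z : EuclideanSpace ℝ (Fin n)} (hf : ContDiffAt ℝ (k + 1 : ℕ) f z)
    (hp : ⟪(f z).1, (f z).1⟫ = 1) (hD : ∀ v, ⟪(f z).1, (fderiv ℝ f z v).1⟫ = 0)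
    (hq : NullDir (f z).1 q (fderiv ℝ f z)) (hinj : Function.Injective (reduced (fderiv ℝ f z) q)) :
    ∃ ψ : EuclideanSpace ℝ (Fin n) → Euc n, ContDiffAt ℝ k ψ z ∧ ψ z = q ∧
      (∀ᶠ y in 𝓝 z, NullDir (f y).1 (ψ y) (fderiv ℝ f y)) ∧
      ∀ᶠ w in 𝓝 (z, q), NullDir (f w.1).1 w.2 (fderiv ℝ f w.1) → w.2 = ψ w.1 := by
  have hf' : ContDiffAt ℝ k (fderiv ℝ f) z := hf.fderiv_right (by norm_cast)
  have hf_k : ContDiffAt ℝ k f z := hf.of_le (by exact_mod_cast Nat.le_succ k)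
  have hG : ContDiffAt ℝ k (fun w : EuclideanSpace ℝ (Fin n) × Euc n =>
      nullSystem (f w.1).1 (fderiv ℝ f w.1) w.2) (z, q) :=
    contDiffAt_nullSystem (ContDiffAt.comp (z, q) (g := f) hf_k contDiffAt_fst).fst
      (ContDiffAt.comp (z, q) (g := fderiv ℝ f) hf' contDiffAt_fst) contDiffAt_snd
  obtain ⟨L, hL, hLinj⟩ := hq.exists_hasFDerivAt_nullSystem hp hD hinj
  simpa only [nullSystem_eq_zero_iff] using MarginallyTrapped.exists_implicit finrank_nullSystem
    (by exact_mod_cast hk) hG (nullSystem_eq_zero_iff.2 hq) hL hLinj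

end NullSystem

section NullField

variable {n : ℕ} {M : Type*} [TopologicalSpace M] [ChartedSpace (EuclideanSpace ℝ (Fin n)) M]
  [IsManifold (𝓡 n) ∞ M] {F : M → Euc n × ℝ} {x y : M}

theorem nullDir_diff_iff (hy : y ∈ (extChartAt (𝓡 n) x).source)
    (hF : ContMDiffAt (𝓡 n) 𝓘(ℝ, Euc n × ℝ) 1 F y) {u : Euc n} :
    NullDir (F y).1 u (diff F y) ↔ NullDir (inChart x F (extChartAt (𝓡 n) x y)).1 u
      (fderiv ℝ (inChart x F) (extChartAt (𝓡 n) x y)) := by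
  rw [diff_eq_fderiv_comp_chartChange hy hF, NullDir.comp_iff (bijective_chartChange hy).2,
    inChart_apply hy]

theorem reduced_diff_eq_comp_chartChange (hy : y ∈ (extChartAt (𝓡 n) x).source)
    (hF : ContMDiffAt (𝓡 n) 𝓘(ℝ, Euc n × ℝ) 1 F y) (q : Euc n) :
    reduced (diff F y) q =
      reduced (fderiv ℝ (inChart x F) (extChartAt (𝓡 n) x y)) q ∘L chartChange x y := by
  rw [diff_eq_fderiv_comp_chartChange hy hF, reduced_comp]

theorem exists_nullField {k : ℕ} (hk : k ≠ 0)
    (hF : ContMDiffAt (𝓡 n) 𝓘(ℝ, Euc n × ℝ) (k + 1 : ℕ) F x)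
    (hunit : ∀ᶠ y in 𝓝 x, ‖(F y).1‖ = 1) {q : Euc n} (hq : NullDir (F x).1 q (diff F x))
    (hinj : Function.Injective (reduced (diff F x) q)) :
    ∃ N : M → Euc n, N x = q ∧ ContMDiffAt (𝓡 n) 𝓘(ℝ, Euc n) k N x ∧ IsNullField F N x ∧
      ∀ N' : M → Euc n, ContinuousAt N' x → N' x = q →
        (∀ᶠ y in 𝓝 x, NullDir (F y).1 (N' y) (diff F y)) → N' =ᶠ[𝓝 x] N := by
  have hone : (1 : WithTop ℕ∞) ≤ k := by exact_mod_cast Nat.one_le_iff_ne_zero.2 hk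
  have hF₁ : ContMDiffAt (𝓡 n) 𝓘(ℝ, Euc n × ℝ) 1 F x :=
    hF.of_le (hone.trans (by exact_mod_cast Nat.le_succ k))
  have hxs := mem_extChartAt_source (I := 𝓡 n) x
  have hnear := (eventually_contMDiffAt (k := 1) hF₁).and
    (extChartAt_source_mem_nhds (I := 𝓡 n) x)
  have hchart := continuousAt_extChartAt (I := 𝓡 n) x
  have hDx := diff_eq_fderiv (hF₁.mdifferentiableAt one_ne_zero)
  have hbase : inChart x F (extChartAt (𝓡 n) x x) = F x := inChart_apply_self x F
  obtain ⟨ψ, hψ, hψx, hnull, huniq⟩ := NullDir.exists_implicit hk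
    (contDiffAt_inChart (natCast_le_infty _) hxs hF)
    (by rw [hbase, real_inner_self_eq_norm_sq, hunit.self_of_nhds, one_pow])
    (by rw [← hDx, hbase]; exact inner_fst_diff_eq_zero hF₁ hunit)
    ((nullDir_diff_iff hxs hF₁).1 hq) (by rwa [← hDx])
  have hN : ContMDiffAt (𝓡 n) 𝓘(ℝ, Euc n) k (fun y => ψ (extChartAt (𝓡 n) x y)) x :=
    contMDiffAt_comp_extChartAt (natCast_le_infty k) hxs hψ
  refine ⟨fun y => ψ (extChartAt (𝓡 n) x y), hψx, hN, ⟨hF.of_le ?_, hunit, hN.of_le hone, ?_, ?_⟩,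
    fun N' hN' hN'x hN'null => ?_⟩
  · exact_mod_cast Nat.succ_le_succ (Nat.one_le_iff_ne_zero.2 hk)
  · filter_upwards [hnear, hchart.eventually hnull] with y hy hy_null
    exact (nullDir_diff_iff hy.2 hy.1).2 hy_null
  · have hreduced := (contDiffAt_reduced (contDiffAt_fderiv_inChart hxs hF) hψ).continuousAt
    filter_upwards [hnear, hchart.eventually (eventually_injective hreduced
      (by rwa [← hDx, hψx]))] with y hy hy_inj
    rw [reduced_diff_eq_comp_chartChange hy.2 hy.1]
    exact hy_inj.comp (bijective_chartChange hy.2).1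
  · have hpair : Filter.Tendsto (fun y => (extChartAt (𝓡 n) x y, N' y)) (𝓝 x)
        (𝓝 (extChartAt (𝓡 n) x x, q)) := hN'x ▸ hchart.prodMk hN'
    filter_upwards [hnear, hN'null, hpair.eventually huniq] with y hy hy_null hy_uniq
    exact hy_uniq ((nullDir_diff_iff hy.2 hy.1).1 hy_null)

end NullField

section Twist

variable {n : ℕ} {M : Type*} [TopologicalSpace M] [ChartedSpace (EuclideanSpace ℝ (Fin n)) M]
  [IsManifold (𝓡 n) ∞ M] {F : M → Euc n × ℝ} {N : M → Euc n} {x y : M}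

/-- The coordinate expression of `twist`, for maps `f`, `g` on the domain of a chart. -/
def twistAt (f : EuclideanSpace ℝ (Fin n) → Euc n × ℝ) (g : EuclideanSpace ℝ (Fin n) → Euc n)
    (z : EuclideanSpace ℝ (Fin n)) : EuclideanSpace ℝ (Fin n) →L[ℝ] Euc n :=
  fderiv ℝ g z + (ContinuousLinearMap.snd ℝ _ _ ∘L fderiv ℝ f z).smulRight (f z).1

theorem twist_eq_twistAt_comp_chartChange (hy : y ∈ (extChartAt (𝓡 n) x).source)
    (hF : ContMDiffAt (𝓡 n) 𝓘(ℝ, Euc n × ℝ) 1 F y) (hN : ContMDiffAt (𝓡 n) 𝓘(ℝ, Euc n) 1 N y) :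
    twist F N y =
      twistAt (inChart x F) (inChart x N) (extChartAt (𝓡 n) x y) ∘L chartChange x y := by
  rw [twist, twistAt, diff_eq_fderiv_comp_chartChange hy hF, diff_eq_fderiv_comp_chartChange hy hN,
    inChart_apply hy]
  rfl

namespace IsNullField

theorem contDiffAt_twistAt (h : IsNullField F N x) :
    ContDiffAt ℝ 0 (twistAt (inChart x F) (inChart x N)) (extChartAt (𝓡 n) x x) := by
  have hx := mem_extChartAt_source (I := 𝓡 n) x
  exact (contDiffAt_fderiv_inChart hx h.field_contMDiffAt).add
    ((contDiffAt_const.clm_comp (contDiffAt_fderiv_inChart hx h.contMDiffAt_one)).smulRight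
      ((contDiffAt_inChart (natCast_le_infty 2) hx h.contMDiffAt).of_le (by norm_num)).fst)

theorem eventually_twist_ne_zero (h : IsNullField F N x) (h0 : twist F N x ≠ 0) :
    ∀ᶠ y in 𝓝 x, twist F N y ≠ 0 := by
  have htwist : ∀ {y}, y ∈ (extChartAt (𝓡 n) x).source → IsNullField F N y →
      (twist F N y = 0 ↔
        twistAt (inChart x F) (inChart x N) (extChartAt (𝓡 n) x y) = 0) := fun hys hy => by
    rw [twist_eq_twistAt_comp_chartChange hys hy.contMDiffAt_one hy.field_contMDiffAt,
      ContinuousLinearMap.ext_iff, ContinuousLinearMap.ext_iff]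
    exact ((bijective_chartChange hys).2.forall
      (p := fun v => twistAt (inChart x F) (inChart x N) _ v = 0)).symm
  rw [Ne, htwist (mem_extChartAt_source x) h] at h0
  filter_upwards [h.eventually,
    eventually_of_inChart (h.contDiffAt_twistAt.continuousAt.eventually_ne h0)] with y hy ⟨hys, hy0⟩
  rwa [Ne, htwist hys hy]

theorem injective_reduced_fderiv (h : IsNullField F N y) (hy : y ∈ (extChartAt (𝓡 n) x).source) :
    Function.Injective (reduced (fderiv ℝ (inChart x F) (extChartAt (𝓡 n) x y)) (N y)) := by
  have hinj := h.injective.self_of_nhds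
  rw [reduced_diff_eq_comp_chartChange hy h.contMDiffAt_one] at hinj
  exact Function.Injective.of_comp_right hinj (bijective_chartChange hy).2

theorem relTrace_reduced_twist (h : IsNullField F N y) (hy : y ∈ (extChartAt (𝓡 n) x).source) :
    relTrace (reduced (diff F y) (N y)) (twist F N y) =
      relTrace (reduced (fderiv ℝ (inChart x F) (extChartAt (𝓡 n) x y)) (N y))
        (twistAt (inChart x F) (inChart x N) (extChartAt (𝓡 n) x y)) := by
  have hrange := h.exists_twist_eq
  rw [twist_eq_twistAt_comp_chartChange hy h.contMDiffAt_one h.field_contMDiffAt,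
    reduced_diff_eq_comp_chartChange hy h.contMDiffAt_one] at hrange ⊢
  refine relTrace_comp_comp (h.injective_reduced_fderiv hy) (fun v => ?_) (bijective_chartChange hy)
  obtain ⟨w, rfl⟩ := (bijective_chartChange hy).2 v
  exact (hrange w).imp' _ fun _ => id

theorem eventually_relTrace_ne_zero (h : IsNullField F N x)
    (h0 : relTrace (reduced (diff F x) (N x)) (twist F N x) ≠ 0) :
    ∀ᶠ y in 𝓝 x, relTrace (reduced (diff F y) (N y)) (twist F N y) ≠ 0 := by
  have hx := mem_extChartAt_source (I := 𝓡 n) x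
  have hN : ContDiffAt ℝ 0 (inChart x N) (extChartAt (𝓡 n) x x) :=
    (contDiffAt_inChart (natCast_le_infty 1) hx h.field_contMDiffAt).of_le zero_le_one
  have hinj := h.injective_reduced_fderiv hx
  rw [h.relTrace_reduced_twist hx] at h0
  rw [← inChart_apply hx N] at h0 hinj
  have hcont := (contDiffAt_relTrace (contDiffAt_reduced
    (contDiffAt_fderiv_inChart hx h.contMDiffAt_one) hN) h.contDiffAt_twistAt hinj).continuousAt
  filter_upwards [h.eventually, eventually_of_inChart (hcont.eventually_ne h0)]
    with y hy ⟨hys, hy0⟩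
  rwa [hy.relTrace_reduced_twist hys, ← inChart_apply hys N]

end IsNullField

end Twist

/-! ### Null second fundamental forms -/

section NullSecondForm

/-- Both `a` and `g` have symmetric second derivatives: `dg = p da` gives `dp ∧ da = 0`. -/
theorem fderiv_smul_fderiv_comm {X Y : Type*} [NormedAddCommGroup X] [NormedSpace ℝ X]
    [NormedAddCommGroup Y] [NormedSpace ℝ Y] {a : X → ℝ} {p g : X → Y} {z : X}
    (ha : ContDiffAt ℝ 2 a z) (hp : ContDiffAt ℝ 1 p z)
    (hg : ∀ᶠ y in 𝓝 z, HasFDerivAt g ((fderiv ℝ a y).smulRight (p y)) y) (v w : X) :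
    fderiv ℝ a z w • fderiv ℝ p z v = fderiv ℝ a z v • fderiv ℝ p z w := by
  have ha' : ContDiffAt ℝ 1 (fderiv ℝ a) z := ha.fderiv_right (by norm_num)
  have hg' := ((ha'.smulRight hp).differentiableAt one_ne_zero).hasFDerivAt
  have hsecond : ∀ v w, fderiv ℝ (fun y => (fderiv ℝ a y).smulRight (p y)) z v w =
      fderiv ℝ a z w • fderiv ℝ p z v + fderiv ℝ (fderiv ℝ a) z v w • p z := by
    intro v w
    simpa using DFunLike.congr_fun ((hg'.clm_apply (hasFDerivAt_const w z)).unique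
      (((ha'.differentiableAt one_ne_zero).hasFDerivAt.clm_apply (hasFDerivAt_const w z)).smul
        (hp.differentiableAt one_ne_zero).hasFDerivAt)) v
  have hsymm := second_derivative_symmetric_of_eventually hg hg' v w
  rwa [hsecond, hsecond, (ha.isSymmSndFDerivAt (by simp)).eq w v, add_left_inj] at hsymm

theorem eq_zero_or_eq_zero_of_forall {X Y Z : Type*} [AddCommGroup X] [Module ℝ X]
    [AddCommGroup Y] [Module ℝ Y] [AddCommGroup Z] [Module ℝ Z] {f : X →ₗ[ℝ] Y} {g : X →ₗ[ℝ] Z}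
    (h : ∀ v, f v = 0 ∨ g v = 0) : f = 0 ∨ g = 0 := by
  by_contra! hne
  obtain ⟨a, ha⟩ := DFunLike.ne_iff.1 hne.1
  obtain ⟨b, hb⟩ := DFunLike.ne_iff.1 hne.2
  have hga := (h a).resolve_left ha
  have hfb := (h b).resolve_right hb
  rcases h (a + b) with hab | hab
  · rw [map_add, hfb, add_zero] at hab
    exact ha hab
  · rw [map_add, hga, zero_add] at hab
    exact hb hab

variable {n : ℕ} {M : Type*} [TopologicalSpace M] [ChartedSpace (EuclideanSpace ℝ (Fin n)) M]
  [IsManifold (𝓡 n) ∞ M] {F : M → Euc n × ℝ} {N N' : M → Euc n} {x : M}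

namespace IsNullField

theorem eventually_hasFDerivAt_neg (h : IsNullField F N x) (h0 : ∀ᶠ y in 𝓝 x, twist F N y = 0) :
    ∀ᶠ z in 𝓝 (extChartAt (𝓡 n) x x), HasFDerivAt (fun z => -inChart x N z)
      ((fderiv ℝ (fun z => (inChart x F z).2) z).smulRight (inChart x F z).1) z := by
  filter_upwards [eventually_inChart (h0.and h.eventually),
    extChartAt_target_mem_nhds (I := 𝓡 n) x] with z ⟨hz0, hz⟩ hzt
  have hzs := (extChartAt (𝓡 n) x).map_target hzt
  have hf := contDiffAt_inChart (natCast_le_infty 2) hzs hz.contMDiffAt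
  have hg := contDiffAt_inChart (natCast_le_infty 1) hzs hz.field_contMDiffAt
  rw [twist_eq_twistAt_comp_chartChange hzs hz.contMDiffAt_one hz.field_contMDiffAt] at hz0
  rw [PartialEquiv.right_inv _ hzt] at hf hg hz0
  have htwist : twistAt (inChart x F) (inChart x N) z = 0 := ContinuousLinearMap.ext fun v => by
    obtain ⟨w, rfl⟩ := (bijective_chartChange hzs).2 v
    exact DFunLike.congr_fun hz0 w
  have hneg : (ContinuousLinearMap.snd ℝ _ _ ∘L fderiv ℝ (inChart x F) z).smulRight
      (inChart x F z).1 = -fderiv ℝ (inChart x N) z := eq_neg_of_add_eq_zero_right htwist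
  rw [(hf.differentiableAt two_ne_zero).hasFDerivAt.snd.fderiv, hneg]
  exact (hg.differentiableAt one_ne_zero).hasFDerivAt.neg

/-- Some `w ≠ 0` has `(dF w).2 = 0`; comparing second derivatives then shows that all other
vectors do. -/
theorem snd_diff_eq_zero (hn : 2 ≤ n) (h : IsNullField F N x)
    (h0 : ∀ᶠ y in 𝓝 x, twist F N y = 0) (v : EuclideanSpace ℝ (Fin n)) :
    (diff F x v).2 = 0 := by
  have hf := contDiffAt_inChart (natCast_le_infty 2) (mem_extChartAt_source x) h.contMDiffAt
  have hfderiv := hasFDerivAt_inChart h.contMDiffAt_one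
  have hcomm : ∀ v w : EuclideanSpace ℝ (Fin n),
      (diff F x w).2 • (diff F x v).1 = (diff F x v).2 • (diff F x w).1 := by
    have hcomm := fderiv_smul_fderiv_comm hf.snd (hf.of_le one_le_two).fst
      (h.eventually_hasFDerivAt_neg h0)
    rw [hfderiv.fst.fderiv, hfderiv.snd.fderiv] at hcomm
    exact hcomm
  obtain ⟨w, hw, hw0⟩ := Submodule.exists_mem_ne_zero_of_ne_bot
    (LinearMap.ker_ne_bot_of_finrank_lt
      (f := (ContinuousLinearMap.snd ℝ (Euc n) ℝ ∘L diff (n := n) F x).toLinearMap)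
      (by rw [Module.finrank_self, finrank_euclideanSpace_fin]; omega))
  have hw_snd : (diff F x w).2 = 0 := hw
  by_contra hv
  have hw_fst := hcomm v w
  rw [hw_snd, zero_smul, eq_comm, smul_eq_zero, or_iff_right hv] at hw_fst
  refine hw0 (h.injective.self_of_nhds ?_)
  rw [reduced_apply, hw_fst, hw_snd, zero_smul, sub_zero, map_zero]

theorem twist_apply_eq_zero (h : IsNullField F N x) {v : EuclideanSpace ℝ (Fin n)}
    (hv : ∀ w, ⟪twist F N x v, reduced (diff F x) (N x) w⟫ = 0) : twist F N x v = 0 := by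
  obtain ⟨u, hu⟩ := h.exists_twist_eq v
  rw [← inner_self_eq_zero (𝕜 := ℝ)]
  nth_rewrite 2 [hu]
  exact hv u

theorem twist_eq_zero_or (h : IsNullField F N x) (h' : IsNullField F N' x) (hne : N x ≠ N' x)
    (hnull : ∀ v w, lorForm n (secondFormL F x v w) (secondFormL F x v w) = 0) :
    twist F N x = 0 ∨ twist F N' x = 0 := by
  have hpair : ∀ v w, ⟪twist F N x v, reduced (diff F x) (N x) w⟫ = 0 ∨
      ⟪twist F N' x v, reduced (diff F x) (N' x) w⟫ = 0 := fun v w => by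
    have hζ := mem_normalSpace_lorForm_iff.1 (secondForm_mem_normalSpace F x v w)
    rw [← neg_eq_zero, ← h.lorForm_secondForm_field, ← neg_eq_zero (a := ⟪_, _⟫),
      ← h'.lorForm_secondForm_field, ← h.nullDir.self_of_nhds.lorForm_self_eq_zero_iff
        h'.nullDir.self_of_nhds hne h.inner_base h.inner_base_diff h.injective.self_of_nhds hζ.1
        hζ.2]
    exact hnull v w
  have happly : ∀ v, (twist F N x).toLinearMap v = 0 ∨ (twist F N' x).toLinearMap v = 0 :=
    fun v => (eq_zero_or_eq_zero_of_forall
      (f := innerₛₗ ℝ (twist F N x v) ∘ₗ (reduced (diff F x) (N x)).toLinearMap)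
      (g := innerₛₗ ℝ (twist F N' x v) ∘ₗ (reduced (diff F x) (N' x)).toLinearMap) (hpair v)).imp
      (fun hv => h.twist_apply_eq_zero (LinearMap.congr_fun hv))
      fun hv => h'.twist_apply_eq_zero (LinearMap.congr_fun hv)
  exact (eq_zero_or_eq_zero_of_forall happly).imp (fun hT => ContinuousLinearMap.coe_injective hT)
    fun hT => ContinuousLinearMap.coe_injective hT

theorem eventually_twist_eq_zero (h : IsNullField F N x) (h' : IsNullField F N' x)
    (hne : N x ≠ N' x) (htwist : twist F N' x ≠ 0)
    (hnull : ∀ᶠ y in 𝓝 x, ∀ v w, lorForm n (secondFormL F y v w) (secondFormL F y v w) = 0) :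
    ∀ᶠ y in 𝓝 x, twist F N y = 0 := by
  filter_upwards [h.eventually, h'.eventually, h'.eventually_twist_ne_zero htwist, hnull,
    (h.field_contMDiffAt.continuousAt.sub h'.field_contMDiffAt.continuousAt).eventually_ne
      (sub_ne_zero.2 hne)] with y hy hy' hy_twist hy_null hy_ne
  exact (hy.twist_eq_zero_or hy' (sub_ne_zero.1 hy_ne) hy_null).resolve_right hy_twist

theorem snd_secondForm_eq_zero (h : IsNullField F N x)
    (hhor : ∀ᶠ y in 𝓝 x, ∀ v : EuclideanSpace ℝ (Fin n), (diff F y v).2 = 0)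
    (v w : EuclideanSpace ℝ (Fin n)) : (secondFormL F x v w).2 = 0 := by
  have hvert : ∀ u : Euc n × ℝ, lorForm n (0, 1) u = -u.2 := fun u => by
    rw [lorForm_apply, inner_zero_left, one_mul, zero_sub]
  have hmem : ((0 : Euc n), (1 : ℝ)) ∈ normalSpace n (lorForm n) (productTangent n) F x :=
    mem_normalSpace_lorForm_iff.2 ⟨inner_zero_right _, fun v => by
      rw [hvert, hhor.self_of_nhds, neg_zero]⟩
  have hdiff2 := form_diff2_eq_neg_of_normal (B := lorForm n) (ξ := fun _ => ((0 : Euc n), (1 : ℝ)))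
    h.contMDiffAt contMDiffAt_const
    (hhor.mono fun y hy u => by rw [hvert, hy, neg_zero]) v w
  have hconst : diff (n := n) (fun _ : M => ((0 : Euc n), (1 : ℝ))) x = 0 := mfderiv_const
  rw [hconst, zero_apply, map_zero, LinearMap.zero_apply, neg_zero, lorForm_isSymm.eq] at hdiff2
  rw [← neg_eq_zero, ← hvert, ← lorForm_isSymm.eq, h.lorForm_secondForm v w hmem, hdiff2]

end IsNullField

theorem isTotallyGeodesicOn_of_null (hn : 2 ≤ n) {U : Set M} (hU : IsOpen U)
    (hF : IsNondegenerateOn 2 F U) (hnull : HasNullSecondFormOn F U) :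
    IsTotallyGeodesicOn F U := by
  intro x hx v w
  by_contra hζ0
  have hxU := hU.mem_nhds hx
  have hF₂ : ContMDiffAt (𝓡 n) 𝓘(ℝ, Euc n × ℝ) 2 F x := hF.contMDiffOn.contMDiffAt hxU
  have hunit : ∀ᶠ y in 𝓝 x, ‖(F y).1‖ = 1 := Filter.mem_of_superset hxU hF.mem
  have hζ := mem_normalSpace_lorForm_iff.1 (secondForm_mem_normalSpace F x v w)
  obtain ⟨hζ_snd, hq⟩ := nullDir_of_null hζ0 (hnull x hx v w) hζ.1 hζ.2
  have hinj : ∀ {q}, NullDir (F x).1 q (diff F x) → Function.Injective (reduced (diff F x) q) :=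
    fun hq => hq.injective_reduced (hF.nondegenerate x hx)
  obtain ⟨q', hq', hne⟩ := hq.exists_ne (inner_fst_diff_eq_zero (hF₂.of_le one_le_two) hunit)
    (hinj hq)
  obtain ⟨N, hNx, -, hN, -⟩ := exists_nullField one_ne_zero hF₂ hunit hq (hinj hq)
  obtain ⟨N', rfl, -, hN', -⟩ := exists_nullField one_ne_zero hF₂ hunit hq' (hinj hq')
  have hζ_eq : secondFormL F x v w = (secondFormL F x v w).2 • (N x, 1) := by
    rw [hNx]
    exact Prod.ext (by simp [smul_smul, hζ_snd]) (by simp)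
  have htwist : twist F N' x ≠ 0 := fun h0 => by
    have hpair := hN'.lorForm_secondForm_field v w
    rw [h0, zero_apply, inner_zero_left, neg_zero, hζ_eq, map_smul, LinearMap.smul_apply,
      smul_eq_mul, hNx] at hpair
    exact mul_ne_zero hζ_snd (hq.lorForm_ne_zero hq' hne) hpair
  have hzero := hN.eventually_twist_eq_zero hN' (hNx ▸ hne) htwist
    (Filter.mem_of_superset hxU hnull)
  refine hζ_snd (hN.snd_secondForm_eq_zero ?_ v w)
  filter_upwards [hN.eventually, hzero.eventually_nhds] with y hy hy_zero
  exact hy.snd_diff_eq_zero hn hy_zero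

end NullSecondForm

/-! ### Hypersurfaces of the sphere -/

namespace IsShapePair

section Comp

variable {E V : Type*} [NormedAddCommGroup E] [InnerProductSpace ℝ E] [NormedAddCommGroup V]
  [InnerProductSpace ℝ V] {a b : E →L[ℝ] V} {T : E →L[ℝ] E}

theorem of_comp (hT : Function.Bijective T) (h : IsShapePair (a ∘L T) (b ∘L T)) :
    IsShapePair a b := by
  refine ⟨(Function.Injective.of_comp_iff' a hT).1 h.injective, fun v w => ?_, fun v => ?_⟩
  · obtain ⟨v, rfl⟩ := hT.2 v
    obtain ⟨w, rfl⟩ := hT.2 w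
    exact h.symm v w
  · obtain ⟨v, rfl⟩ := hT.2 v
    obtain ⟨u, hu⟩ := h.range v
    exact ⟨T u, hu⟩

theorem injective_and_relTrace_eq_zero_comp_iff [FiniteDimensional ℝ E] [CompleteSpace E]
    [CompleteSpace V] (hT : Function.Bijective T) (h : IsShapePair (a ∘L T) (b ∘L T)) {s : ℝ} :
    (Function.Injective (s • (a ∘L T) + b ∘L T) ∧
        relTrace (s • (a ∘L T) + b ∘L T) (s • (b ∘L T) - a ∘L T) = 0) ↔
      Function.Injective (s • a + b) ∧ relTrace (s • a + b) (s • b - a) = 0 := by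
  rw [← ContinuousLinearMap.smul_comp, ← ContinuousLinearMap.smul_comp,
    ← ContinuousLinearMap.add_comp, ← ContinuousLinearMap.sub_comp, ContinuousLinearMap.coe_comp,
    Function.Injective.of_comp_iff' _ hT]
  refine and_congr_right fun hinj => ?_
  rw [relTrace_comp_comp hinj ((h.of_comp hT).exists_smul_sub_eq (notMem_shapeSet_iff.2 hinj)) hT]

end Comp

variable {E V Z : Type*} [NormedAddCommGroup E] [InnerProductSpace ℝ E] [FiniteDimensional ℝ E]
  [CompleteSpace E] [NormedAddCommGroup V] [InnerProductSpace ℝ V] [CompleteSpace V]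
  [NormedAddCommGroup Z] [NormedSpace ℝ Z] [CompleteSpace Z]

theorem exists_implicit [Nontrivial E] {k : WithTop ℕ∞} (hk : k ≠ 0) {a b : Z → E →L[ℝ] V} {z : Z}
    (ha : ContDiffAt ℝ k a z) (hb : ContDiffAt ℝ k b z) (h : IsShapePair (a z) (b z)) {s : ℝ}
    (hinj : Function.Injective (s • a z + b z))
    (hzero : relTrace (s • a z + b z) (s • b z - a z) = 0) :
    ∃ ψ : Z → ℝ, ContDiffAt ℝ k ψ z ∧ ψ z = s ∧
      (∀ᶠ y in 𝓝 z, Function.Injective (ψ y • a y + b y) ∧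
        relTrace (ψ y • a y + b y) (ψ y • b y - a y) = 0) ∧
      ∀ᶠ w in 𝓝 (z, s), relTrace (w.2 • a w.1 + b w.1) (w.2 • b w.1 - a w.1) = 0 →
        w.2 = ψ w.1 := by
  have ha' : ContDiffAt ℝ k (fun w : Z × ℝ => a w.1) (z, s) :=
    ContDiffAt.comp (z, s) (g := a) ha contDiffAt_fst
  have hb' : ContDiffAt ℝ k (fun w : Z × ℝ => b w.1) (z, s) :=
    ContDiffAt.comp (z, s) (g := b) hb contDiffAt_fst
  obtain ⟨c, hc, hderiv⟩ := h.exists_hasDerivAt_relTrace (notMem_shapeSet_iff.2 hinj)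
  obtain ⟨ψ, hψ, hψz, hψ0, huniq⟩ := MarginallyTrapped.exists_implicit rfl hk
    (contDiffAt_relTrace ((contDiffAt_snd.smul ha').add hb')
      ((contDiffAt_snd.smul hb').sub ha') hinj) hzero hderiv.hasFDerivAt
    fun u v huv => by simpa [hc] using huv
  refine ⟨ψ, hψ, hψz, Filter.Eventually.and ?_ hψ0, huniq⟩
  exact eventually_injective ((hψ.smul ha).add hb).continuousAt (by rwa [hψz])

end IsShapePair

section Hypersurface

variable {n : ℕ} {M : Type*} [TopologicalSpace M] [ChartedSpace (EuclideanSpace ℝ (Fin n)) M]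
  {φ ν : M → Euc n} {x y : M} {U : Set M}

theorem eucForm_isSymm : (eucForm n).IsSymm :=
  ⟨fun p q => real_inner_comm q p⟩

theorem mem_normalSpace_eucForm_iff {η : Euc n} :
    η ∈ normalSpace n (eucForm n) (sphereTangent n) φ x ↔
      ⟪φ x, η⟫ = 0 ∧ ∀ v : EuclideanSpace ℝ (Fin n), ⟪η, diff φ x v⟫ = 0 := by
  rw [mem_normalSpace_iff eucForm_isSymm, sphereTangent,
    Submodule.mem_orthogonal_singleton_iff_inner_right]
  rfl

namespace IsHypersurfaceOn

theorem contMDiffAt (h : IsHypersurfaceOn φ ν U) (hU : IsOpen U) (hx : x ∈ U) :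
    ContMDiffAt (𝓡 n) 𝓘(ℝ, Euc n) 4 φ x :=
  h.contMDiffOn.contMDiffAt (hU.mem_nhds hx)

theorem gauss_contMDiffAt (h : IsHypersurfaceOn φ ν U) (hU : IsOpen U) (hx : x ∈ U) :
    ContMDiffAt (𝓡 n) 𝓘(ℝ, Euc n) 3 ν x :=
  h.gauss_contMDiffOn.contMDiffAt (hU.mem_nhds hx)

theorem contMDiffAt_two (h : IsHypersurfaceOn φ ν U) (hU : IsOpen U) (hx : x ∈ U) :
    ContMDiffAt (𝓡 n) 𝓘(ℝ, Euc n) 2 φ x :=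
  (h.contMDiffAt hU hx).of_le (by norm_num)

theorem contMDiffAt_one (h : IsHypersurfaceOn φ ν U) (hU : IsOpen U) (hx : x ∈ U) :
    ContMDiffAt (𝓡 n) 𝓘(ℝ, Euc n) 1 φ x :=
  (h.contMDiffAt hU hx).of_le (by norm_num)

theorem gauss_contMDiffAt_two (h : IsHypersurfaceOn φ ν U) (hU : IsOpen U) (hx : x ∈ U) :
    ContMDiffAt (𝓡 n) 𝓘(ℝ, Euc n) 2 ν x :=
  (h.gauss_contMDiffAt hU hx).of_le (by norm_num)

theorem gauss_contMDiffAt_one (h : IsHypersurfaceOn φ ν U) (hU : IsOpen U) (hx : x ∈ U) :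
    ContMDiffAt (𝓡 n) 𝓘(ℝ, Euc n) 1 ν x :=
  (h.gauss_contMDiffAt hU hx).of_le (by norm_num)

theorem inner_self (h : IsHypersurfaceOn φ ν U) (hx : x ∈ U) : ⟪φ x, φ x⟫ = 1 := by
  rw [real_inner_self_eq_norm_sq, h.mem x hx, one_pow]

theorem inner_gauss_self (h : IsHypersurfaceOn φ ν U) (hx : x ∈ U) : ⟪ν x, ν x⟫ = 1 := by
  rw [real_inner_self_eq_norm_sq, h.gauss_unit x hx, one_pow]

theorem inner_gauss (h : IsHypersurfaceOn φ ν U) (hx : x ∈ U) : ⟪φ x, ν x⟫ = 0 :=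
  (mem_normalSpace_eucForm_iff.1 (h.gauss_normal x hx)).1

theorem inner_gauss_diff (h : IsHypersurfaceOn φ ν U) (hx : x ∈ U)
    (v : EuclideanSpace ℝ (Fin n)) : ⟪ν x, diff φ x v⟫ = 0 :=
  (mem_normalSpace_eucForm_iff.1 (h.gauss_normal x hx)).2 v

variable [IsManifold (𝓡 n) ∞ M]

theorem inner_diff (h : IsHypersurfaceOn φ ν U) (hU : IsOpen U) (hx : x ∈ U)
    (v : EuclideanSpace ℝ (Fin n)) : ⟪φ x, diff φ x v⟫ = 0 :=
  inner_diff_self_eq_zero (h.contMDiffAt_one hU hx) (Filter.mem_of_superset (hU.mem_nhds hx) h.mem)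
    v

theorem inner_gauss_diff_gauss (h : IsHypersurfaceOn φ ν U) (hU : IsOpen U) (hx : x ∈ U)
    (v : EuclideanSpace ℝ (Fin n)) : ⟪ν x, diff ν x v⟫ = 0 :=
  inner_diff_self_eq_zero (h.gauss_contMDiffAt_one hU hx)
    (Filter.mem_of_superset (hU.mem_nhds hx) h.gauss_unit) v

theorem inner_diff_gauss (h : IsHypersurfaceOn φ ν U) (hU : IsOpen U) (hx : x ∈ U)
    (v : EuclideanSpace ℝ (Fin n)) : ⟪φ x, diff ν x v⟫ = 0 := by
  have hsum := inner_diff_add_inner_diff (h.contMDiffAt_one hU hx) (h.gauss_contMDiffAt_one hU hx)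
    (Filter.mem_of_superset (hU.mem_nhds hx) fun _ => h.inner_gauss) v
  rwa [real_inner_comm (ν x), h.inner_gauss_diff hx, add_zero] at hsum

theorem exists_eq_diff (h : IsHypersurfaceOn φ ν U) (hU : IsOpen U) (hx : x ∈ U) {u : Euc n}
    (hφ : ⟪φ x, u⟫ = 0) (hν : ⟪ν x, u⟫ = 0) : ∃ v, u = diff (n := n) φ x v :=
  exists_eq_apply_of_perp (h.immersion x hx) (h.inner_self hx) (h.inner_gauss_self hx)
    ((real_inner_comm _ _).trans (h.inner_gauss hx)) (h.inner_diff hU hx) (h.inner_gauss_diff hx)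
    hφ hν

theorem inner_diff2 (h : IsHypersurfaceOn φ ν U) (hU : IsOpen U) (hx : x ∈ U)
    (v w : EuclideanSpace ℝ (Fin n)) :
    ⟪ν x, diff2 φ x v w⟫ = -⟪diff ν x v, diff φ x w⟫ :=
  form_diff2_eq_neg_of_normal (B := eucForm n) (h.contMDiffAt_two hU hx)
    (h.gauss_contMDiffAt_one hU hx)
    (Filter.mem_of_superset (hU.mem_nhds hx) fun _ => h.inner_gauss_diff) v w

theorem isShapePair (h : IsHypersurfaceOn φ ν U) (hU : IsOpen U) (hx : x ∈ U) :
    IsShapePair (diff (n := n) φ x) (diff (n := n) ν x) where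
  injective := h.immersion x hx
  symm v w := by
    rw [real_inner_comm, ← neg_inj, ← h.inner_diff2 hU hx, ← h.inner_diff2 hU hx,
      diff2_comm (h.contMDiffAt_two hU hx)]
  range v := h.exists_eq_diff hU hx (h.inner_diff_gauss hU hx v) (h.inner_gauss_diff_gauss hU hx v)

theorem eq_smul_gauss (h : IsHypersurfaceOn φ ν U) (hU : IsOpen U) (hx : x ∈ U) {η : Euc n}
    (hη : η ∈ normalSpace n (eucForm n) (sphereTangent n) φ x) : η = ⟪η, ν x⟫ • ν x := by
  obtain ⟨hη_base, hη_diff⟩ := mem_normalSpace_eucForm_iff.1 hη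
  obtain ⟨v, hv⟩ := h.exists_eq_diff hU hx (u := η - ⟪η, ν x⟫ • ν x)
    (by rw [inner_sub_right, real_inner_smul_right, hη_base, h.inner_gauss hx, mul_zero, sub_zero])
    (by rw [inner_sub_right, real_inner_smul_right, h.inner_gauss_self hx, mul_one,
      real_inner_comm, sub_self])
  rw [← sub_eq_zero, ← inner_self_eq_zero (𝕜 := ℝ)]
  nth_rewrite 2 [hv]
  rw [inner_sub_left, hη_diff, real_inner_smul_left, h.inner_gauss_diff hx, mul_zero, sub_zero]

theorem inner_secondForm (h : IsHypersurfaceOn φ ν U) (hU : IsOpen U) (hx : x ∈ U)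
    (v w : EuclideanSpace ℝ (Fin n)) :
    ⟪secondForm (eucForm n) (sphereTangent n) φ x v w, ν x⟫ = -⟪diff ν x v, diff φ x w⟫ := by
  rw [← h.inner_diff2 hU hx, real_inner_comm (diff2 φ x v w)]
  refine orthProj_spec (B := eucForm n) ⟨⟪diff2 φ x v w, ν x⟫ • ν x,
    Submodule.smul_mem _ _ (h.gauss_normal x hx), fun η hη => ?_⟩ (h.gauss_normal x hx)
  rw [h.eq_smul_gauss hU hx hη]
  simp only [eucForm_apply, real_inner_smul_left, real_inner_smul_right, h.inner_gauss_self hx]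
  ring

theorem inner_meanCurvature (h : IsHypersurfaceOn φ ν U) (hU : IsOpen U) (hx : x ∈ U) :
    ⟪meanCurvatureS φ x, ν x⟫ = -relTrace (diff (n := n) φ x) (diff (n := n) ν x) :=
  form_meanCurvature_eq_neg_relTrace (B := eucForm n) (h.immersion x hx) (fun _ _ => rfl)
    (h.inner_secondForm hU hx)

theorem meanCurvature_eq_zero_iff (h : IsHypersurfaceOn φ ν U) (hU : IsOpen U) (hx : x ∈ U) :
    meanCurvatureS φ x = 0 ↔ ∑ κ ∈ (h.isShapePair hU hx).finite.toFinset,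
      (shapeMult (diff (n := n) φ x) (diff (n := n) ν x) κ : ℝ) * κ = 0 := by
  have hinner := h.inner_meanCurvature hU hx
  rw [(h.isShapePair hU hx).relTrace_eq, neg_neg] at hinner
  rw [← hinner]
  refine ⟨fun hH => by rw [hH, inner_zero_left], fun hH => ?_⟩
  exact (h.eq_smul_gauss hU hx (meanCurvature_mem_normalSpace x)).trans (by rw [hH, zero_smul])

theorem trapPoly_eq (h : IsHypersurfaceOn φ ν U) (hU : IsOpen U) (hx : x ∈ U) :
    trapPoly φ ν x = weightedPoly (h.isShapePair hU hx).finite.toFinset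
      (fun κ => shapeMult (diff (n := n) φ x) (diff (n := n) ν x) κ) := by
  have hfin : (principalCurvatures φ ν x).Finite := (h.isShapePair hU hx).finite
  rw [trapPoly, finsum_mem_eq_finite_toFinset_sum _ hfin, weightedPoly]
  refine Finset.sum_congr rfl fun κ _ => ?_
  rw [finprod_mem_eq_finite_toFinset_prod _ (hfin.subset Set.sdiff_subset)]
  refine congrArg _ (Finset.prod_congr ?_ fun _ _ => rfl)
  ext μ
  simp only [Set.Finite.mem_toFinset, Finset.mem_erase, Set.mem_sdiff, Set.mem_singleton_iff]
  exact and_comm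

theorem isRoot_iff (h : IsHypersurfaceOn φ ν U) (hU : IsOpen U) (hx : x ∈ U) {s : ℝ} :
    (trapPoly φ ν x).IsRoot s ↔
      Function.Injective (s • diff (n := n) φ x + diff (n := n) ν x) ∧
        relTrace (s • diff (n := n) φ x + diff (n := n) ν x)
          (s • diff (n := n) ν x - diff (n := n) φ x) = 0 := by
  rw [h.trapPoly_eq hU hx, (h.isShapePair hU hx).isRoot_iff]

theorem encard_roots (hn : n ≠ 0) (h : IsHypersurfaceOn φ ν U) (hU : IsOpen U) (hx : x ∈ U) :
    (meanCurvatureS φ x = 0 → {s | (trapPoly φ ν x).IsRoot s}.encard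
      = (((principalCurvatures φ ν x).ncard - 1 : ℕ) : ℕ∞)) ∧
    (meanCurvatureS φ x ≠ 0 → {s | (trapPoly φ ν x).IsRoot s}.encard
      = ((principalCurvatures φ ν x).ncard : ℕ∞)) := by
  have : NeZero n := ⟨hn⟩
  have hs := h.isShapePair hU hx
  have hK : hs.finite.toFinset.Nonempty := hs.finite.toFinset_nonempty.2 hs.nonempty
  have hm : ∀ κ ∈ hs.finite.toFinset,
      (0 : ℝ) < shapeMult (diff (n := n) φ x) (diff (n := n) ν x) κ := fun κ hκ =>
    Nat.cast_pos.2 (shapeMult_pos (hs.finite.mem_toFinset.1 hκ))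
  have hcard : (principalCurvatures φ ν x).ncard = hs.finite.toFinset.card :=
    Set.ncard_eq_toFinset_card _ hs.finite
  rw [Ne, h.meanCurvature_eq_zero_iff hU hx, h.trapPoly_eq hU hx, hcard]
  exact ⟨encard_roots_weightedPoly_of_sum_eq_zero hK hm,
    encard_roots_weightedPoly_of_sum_ne_zero hK hm⟩

theorem isRoot_iff_inChart (h : IsHypersurfaceOn φ ν U) (hU : IsOpen U) (hy : y ∈ U)
    (hys : y ∈ (extChartAt (𝓡 n) x).source) {s : ℝ} :
    (trapPoly φ ν y).IsRoot s ↔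
      Function.Injective (s • fderiv ℝ (inChart x φ) (extChartAt (𝓡 n) x y) +
          fderiv ℝ (inChart x ν) (extChartAt (𝓡 n) x y)) ∧
        relTrace (s • fderiv ℝ (inChart x φ) (extChartAt (𝓡 n) x y) +
            fderiv ℝ (inChart x ν) (extChartAt (𝓡 n) x y))
          (s • fderiv ℝ (inChart x ν) (extChartAt (𝓡 n) x y) -
            fderiv ℝ (inChart x φ) (extChartAt (𝓡 n) x y)) = 0 := by
  have hφ := diff_eq_fderiv_comp_chartChange hys (h.contMDiffAt_one hU hy)
  have hν := diff_eq_fderiv_comp_chartChange hys (h.gauss_contMDiffAt_one hU hy)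
  have hs := h.isShapePair hU hy
  rw [hφ, hν] at hs
  rw [h.isRoot_iff hU hy, hφ, hν,
    hs.injective_and_relTrace_eq_zero_comp_iff (bijective_chartChange hys)]

theorem exists_rootFunction (hn : n ≠ 0) (h : IsHypersurfaceOn φ ν U) (hU : IsOpen U)
    (hx : x ∈ U) {s : ℝ} (hs : (trapPoly φ ν x).IsRoot s) :
    ∃ ψ : M → ℝ, ψ x = s ∧ ContMDiffAt (𝓡 n) 𝓘(ℝ, ℝ) 2 ψ x ∧
      (∀ᶠ y in 𝓝 x, (trapPoly φ ν y).IsRoot (ψ y)) ∧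
      ∀ r : M → ℝ, ContinuousAt r x → r x = s →
        (∀ᶠ y in 𝓝 x, (trapPoly φ ν y).IsRoot (r y)) → r =ᶠ[𝓝 x] ψ := by
  have : NeZero n := ⟨hn⟩
  have hxs := mem_extChartAt_source (I := 𝓡 n) x
  have hchart := continuousAt_extChartAt (I := 𝓡 n) x
  have hpair := h.isShapePair hU hx
  rw [diff_eq_fderiv ((h.contMDiffAt_one hU hx).mdifferentiableAt one_ne_zero),
    diff_eq_fderiv ((h.gauss_contMDiffAt_one hU hx).mdifferentiableAt one_ne_zero)] at hpair
  obtain ⟨hinj, hzero⟩ := (h.isRoot_iff_inChart hU hx hxs).1 hs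
  obtain ⟨ψ, hψ, hψx, hψ_root, huniq⟩ := IsShapePair.exists_implicit two_ne_zero
    (contDiffAt_fderiv_inChart (k := 2) hxs ((h.contMDiffAt hU hx).of_le (by norm_num)))
    (contDiffAt_fderiv_inChart (k := 2) hxs (h.gauss_contMDiffAt hU hx)) hpair hinj hzero
  have hnear := Filter.Eventually.and (hU.mem_nhds hx) (extChartAt_source_mem_nhds (I := 𝓡 n) x)
  refine ⟨fun y => ψ (extChartAt (𝓡 n) x y), hψx,
    contMDiffAt_comp_extChartAt (natCast_le_infty 2) hxs hψ, ?_, fun r hr hrx hr_root => ?_⟩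
  · filter_upwards [hnear, hchart.eventually hψ_root] with y hy hy_root
    exact (h.isRoot_iff_inChart hU hy.1 hy.2).2 hy_root
  · have hrlim : Filter.Tendsto (fun y => (extChartAt (𝓡 n) x y, r y)) (𝓝 x)
        (𝓝 (extChartAt (𝓡 n) x x, s)) := hrx ▸ hchart.prodMk hr
    filter_upwards [hnear, hr_root, hrlim.eventually huniq] with y hy hy_root hy_uniq
    exact hy_uniq ((h.isRoot_iff_inChart hU hy.1 hy.2).1 hy_root).2

end IsHypersurfaceOn

end Hypersurface

/-! ### Rotations in the plane of the position vector and the normal -/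

theorem sin_arccot (s : ℝ) : Real.sin (arccot s) = (√(1 + s ^ 2))⁻¹ := by
  rw [arccot, Real.sin_pi_div_two_sub, Real.cos_arctan, one_div]

theorem cos_arccot (s : ℝ) : Real.cos (arccot s) = Real.sin (arccot s) * s := by
  rw [sin_arccot, arccot, Real.cos_pi_div_two_sub, Real.sin_arctan, div_eq_inv_mul]

theorem arccot_mem_Ioo (s : ℝ) : arccot s ∈ Set.Ioo 0 Real.pi := by
  have hlt := Real.arctan_lt_pi_div_two s
  have hgt := Real.neg_pi_div_two_lt_arctan s
  constructor <;> rw [arccot] <;> linarith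

theorem sin_arccot_ne_zero (s : ℝ) : Real.sin (arccot s) ≠ 0 :=
  (Real.sin_pos_of_mem_Ioo (arccot_mem_Ioo s)).ne'

theorem arccot_cot {t : ℝ} (ht : t ∈ Set.Ioo 0 Real.pi) : arccot (Real.cot t) = t := by
  have htan : Real.cot t = Real.tan (Real.pi / 2 - t) := by
    rw [Real.cot_eq_cos_div_sin, Real.tan_eq_sin_div_cos, Real.sin_pi_div_two_sub,
      Real.cos_pi_div_two_sub]
  rw [arccot, htan, Real.arctan_tan (by linarith [ht.2]) (by linarith [ht.1]), sub_sub_cancel]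

theorem contDiff_arccot {k : WithTop ℕ∞} : ContDiff ℝ k arccot :=
  contDiff_const.sub Real.contDiff_arctan

section Rotate

variable {X V : Type*} [NormedAddCommGroup V]

/-- The field `cos θ f + sin θ g`, the rotation of `f` towards `g` by the angle `θ` when `f` and
`g` are orthonormal. -/
def rotate [NormedSpace ℝ V] (θ : X → ℝ) (f g : X → V) (y : X) : V :=
  Real.cos (θ y) • f y + Real.sin (θ y) • g y

variable {θ : X → ℝ} {f g : X → V} {x : X}

theorem rotate_neg_neg [NormedSpace ℝ V] : rotate θ (-f) (-g) x = -rotate θ f g x := by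
  simp only [rotate, Pi.neg_apply, smul_neg, neg_add]

theorem rotate_rotate_neg [NormedSpace ℝ V] :
    rotate θ (rotate θ f (-g)) (rotate θ g f) x = f x := by
  have hsq : Real.cos (θ x) * Real.cos (θ x) + Real.sin (θ x) * Real.sin (θ x) = 1 := by
    rw [← sq, ← sq, Real.cos_sq_add_sin_sq]
  calc rotate θ (rotate θ f (-g)) (rotate θ g f) x
      = (Real.cos (θ x) * Real.cos (θ x) + Real.sin (θ x) * Real.sin (θ x)) • f x := by
        simp only [rotate, Pi.neg_apply]
        module
    _ = f x := by rw [hsq, one_smul]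

variable [InnerProductSpace ℝ V]

theorem inner_rotate_eq_zero {w : V} (hf : ⟪f x, w⟫ = 0) (hg : ⟪g x, w⟫ = 0) :
    ⟪rotate θ f g x, w⟫ = 0 := by
  rw [rotate, inner_add_left, real_inner_smul_left, real_inner_smul_left, hf, hg, mul_zero,
    mul_zero, add_zero]

theorem inner_rotate_neg_rotate (hf : ‖f x‖ = 1) (hg : ‖g x‖ = 1) (hfg : ⟪f x, g x⟫ = 0) :
    ⟪rotate θ g (-f) x, rotate θ f g x⟫ = 0 := by
  have hgf : ⟪g x, f x⟫ = 0 := (real_inner_comm _ _).trans hfg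
  simp only [rotate, Pi.neg_apply, inner_add_left, inner_add_right, real_inner_smul_left,
    real_inner_smul_right, inner_neg_left, real_inner_self_eq_norm_sq, hf, hg, hfg, hgf]
  ring

theorem norm_rotate (hf : ‖f x‖ = 1) (hg : ‖g x‖ = 1) (hfg : ⟪f x, g x⟫ = 0) :
    ‖rotate θ f g x‖ = 1 := by
  have horth : ⟪Real.cos (θ x) • f x, Real.sin (θ x) • g x⟫ = 0 := by
    rw [real_inner_smul_left, real_inner_smul_right, hfg, mul_zero, mul_zero]
  rw [← sq_eq_sq₀ (norm_nonneg _) zero_le_one, rotate, sq,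
    norm_add_sq_eq_norm_sq_add_norm_sq_real horth, norm_smul, norm_smul, hf, hg, mul_one, mul_one,
    Real.norm_eq_abs, Real.norm_eq_abs, abs_mul_abs_self, abs_mul_abs_self, ← sq, ← sq,
    Real.cos_sq_add_sin_sq, one_pow]

end Rotate

section DiffRotate

variable {n : ℕ} {M : Type*} [TopologicalSpace M] [ChartedSpace (EuclideanSpace ℝ (Fin n)) M]
  {V : Type*} [NormedAddCommGroup V] [NormedSpace ℝ V] {θ : M → ℝ} {f g : M → V} {x : M}

theorem contMDiffAt_rotate {k : WithTop ℕ∞} (hθ : ContMDiffAt (𝓡 n) 𝓘(ℝ, ℝ) k θ x)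
    (hf : ContMDiffAt (𝓡 n) 𝓘(ℝ, V) k f x) (hg : ContMDiffAt (𝓡 n) 𝓘(ℝ, V) k g x) :
    ContMDiffAt (𝓡 n) 𝓘(ℝ, V) k (rotate θ f g) x :=
  (((contMDiffAt_iff_contDiffAt.2 Real.contDiff_cos.contDiffAt).comp x hθ).smul hf).add
    (((contMDiffAt_iff_contDiffAt.2 Real.contDiff_sin.contDiffAt).comp x hθ).smul hg)

variable [IsManifold (𝓡 n) ∞ M]

theorem diff_neg (hf : ContMDiffAt (𝓡 n) 𝓘(ℝ, V) 1 f x) :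
    diff (n := n) (-f) x = -diff f x :=
  diff_eq_of_hasFDerivAt hf.neg (hasFDerivAt_inChart hf).neg

theorem diff_rotate (hθ : ContMDiffAt (𝓡 n) 𝓘(ℝ, ℝ) 1 θ x)
    (hf : ContMDiffAt (𝓡 n) 𝓘(ℝ, V) 1 f x) (hg : ContMDiffAt (𝓡 n) 𝓘(ℝ, V) 1 g x)
    (v : EuclideanSpace ℝ (Fin n)) :
    diff (rotate θ f g) x v = Real.cos (θ x) • diff f x v + Real.sin (θ x) • diff g x v +
      diff θ x v • rotate θ g (-f) x := by
  have hdθ := hasFDerivAt_inChart hθ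
  have hderiv := (hdθ.cos.smul (hasFDerivAt_inChart hf)).add
    (hdθ.sin.smul (hasFDerivAt_inChart hg))
  rw [diff_eq_of_hasFDerivAt (contMDiffAt_rotate hθ hf hg) hderiv,
    inChart_apply_self, inChart_apply_self, inChart_apply_self]
  simp only [_root_.add_apply, _root_.smul_apply, ContinuousLinearMap.smulRight_apply, smul_eq_mul,
    rotate, Pi.neg_apply]
  module

end DiffRotate

/-! ### The null lift of a hypersurface -/

/-- The null lift of a hypersurface written in terms of the angle `θ = cot⁻¹ s`. -/
def rotationLift {n : ℕ} {M : Type*} (θ : M → ℝ) (φ ν : M → Euc n) (y : M) : Euc n × ℝ :=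
  (rotate θ φ ν y, θ y)

theorem nullLift_eq_rotationLift {n : ℕ} {M : Type*} (φ ν : M → Euc n) (s : M → ℝ) :
    nullLift φ ν s = rotationLift (fun y => arccot (s y)) φ ν := by
  funext y
  rw [nullLift, rotationLift, rotate, cos_arccot, sin_arccot, smul_add, smul_smul]

section RotationLift

variable {n : ℕ} {M : Type*} [TopologicalSpace M] [ChartedSpace (EuclideanSpace ℝ (Fin n)) M]
  {φ ν : M → Euc n} {θ : M → ℝ} {x : M} {U : Set M}

theorem contMDiffAt_rotationLift {k : WithTop ℕ∞} (hθ : ContMDiffAt (𝓡 n) 𝓘(ℝ, ℝ) k θ x)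
    (hφ : ContMDiffAt (𝓡 n) 𝓘(ℝ, Euc n) k φ x) (hν : ContMDiffAt (𝓡 n) 𝓘(ℝ, Euc n) k ν x) :
    ContMDiffAt (𝓡 n) 𝓘(ℝ, Euc n × ℝ) k (rotationLift θ φ ν) x :=
  (contMDiffAt_rotate hθ hφ hν).prodMk_space hθ

variable [IsManifold (𝓡 n) ∞ M]

theorem diff_rotationLift_apply (hθ : ContMDiffAt (𝓡 n) 𝓘(ℝ, ℝ) 1 θ x)
    (hφ : ContMDiffAt (𝓡 n) 𝓘(ℝ, Euc n) 1 φ x) (hν : ContMDiffAt (𝓡 n) 𝓘(ℝ, Euc n) 1 ν x)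
    (v : EuclideanSpace ℝ (Fin n)) :
    diff (rotationLift θ φ ν) x v =
      (Real.cos (θ x) • diff φ x v + Real.sin (θ x) • diff ν x v +
        diff θ x v • rotate θ ν (-φ) x, diff θ x v) := by
  rw [← diff_rotate hθ hφ hν]
  exact DFunLike.congr_fun (diff_prodMk (contMDiffAt_rotate hθ hφ hν) hθ) v

theorem reduced_rotationLift (hθ : ContMDiffAt (𝓡 n) 𝓘(ℝ, ℝ) 1 θ x)
    (hφ : ContMDiffAt (𝓡 n) 𝓘(ℝ, Euc n) 1 φ x) (hν : ContMDiffAt (𝓡 n) 𝓘(ℝ, Euc n) 1 ν x) :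
    reduced (diff (n := n) (rotationLift θ φ ν) x) (rotate θ ν (-φ) x) =
      Real.cos (θ x) • diff φ x + Real.sin (θ x) • diff ν x := by
  ext v : 1
  rw [reduced_apply, diff_rotationLift_apply hθ hφ hν, add_sub_cancel_right]
  rfl

theorem twist_rotationLift (hθ : ContMDiffAt (𝓡 n) 𝓘(ℝ, ℝ) 1 θ x)
    (hφ : ContMDiffAt (𝓡 n) 𝓘(ℝ, Euc n) 1 φ x) (hν : ContMDiffAt (𝓡 n) 𝓘(ℝ, Euc n) 1 ν x) :
    twist (n := n) (rotationLift θ φ ν) (rotate θ ν (-φ)) x =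
      Real.cos (θ x) • diff ν x - Real.sin (θ x) • diff φ x := by
  ext v : 1
  rw [twist_apply, diff_rotationLift_apply hθ hφ hν, diff_rotate (g := -φ) hθ hν hφ.neg,
    diff_neg hφ, rotate_neg_neg, rotationLift, smul_neg, neg_add_cancel_right, _root_.neg_apply,
    smul_neg, ← sub_eq_add_neg]
  rfl

namespace IsHypersurfaceOn

theorem nullDir_rotationLift (h : IsHypersurfaceOn φ ν U) (hU : IsOpen U) (hx : x ∈ U)
    (hθ : ContMDiffAt (𝓡 n) 𝓘(ℝ, ℝ) 1 θ x) :
    NullDir (rotationLift θ φ ν x).1 (rotate θ ν (-φ) x) (diff (rotationLift θ φ ν) x) := by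
  have hnorm : ‖rotate θ ν (-φ) x‖ = 1 := by
    refine norm_rotate (h.gauss_unit x hx) ((norm_neg _).trans (h.mem x hx)) ?_
    rw [Pi.neg_apply, inner_neg_right, real_inner_comm, h.inner_gauss hx, neg_zero]
  have hperp {w : Euc n} (hφw : ⟪φ x, w⟫ = 0) (hνw : ⟪ν x, w⟫ = 0) :
      ⟪rotate θ ν (-φ) x, w⟫ = 0 :=
    inner_rotate_eq_zero hνw (by rw [Pi.neg_apply, inner_neg_left, hφw, neg_zero])
  have hself : ⟪rotate θ ν (-φ) x, rotate θ ν (-φ) x⟫ = 1 := by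
    rw [real_inner_self_eq_norm_sq, hnorm, one_pow]
  refine ⟨hself, inner_rotate_neg_rotate (h.mem x hx) (h.gauss_unit x hx) (h.inner_gauss hx),
    fun v => ?_⟩
  rw [diff_rotationLift_apply hθ (h.contMDiffAt_one hU hx) (h.gauss_contMDiffAt_one hU hx),
    inner_add_right, inner_add_right, real_inner_smul_right, real_inner_smul_right,
    real_inner_smul_right, hself, hperp (h.inner_diff hU hx v) (h.inner_gauss_diff hx v),
    hperp (h.inner_diff_gauss hU hx v) (h.inner_gauss_diff_gauss hU hx v), mul_zero, mul_zero,
    mul_one, add_zero, zero_add]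

theorem isNullField_rotationLift (h : IsHypersurfaceOn φ ν U) (hU : IsOpen U) (hx : x ∈ U)
    (hθ : ContMDiffAt (𝓡 n) 𝓘(ℝ, ℝ) 2 θ x)
    (hinj : ∀ᶠ y in 𝓝 x, Function.Injective
      (Real.cos (θ y) • diff (n := n) φ y + Real.sin (θ y) • diff (n := n) ν y)) :
    IsNullField (rotationLift θ φ ν) (rotate θ ν (-φ)) x where
  contMDiffAt := contMDiffAt_rotationLift hθ (h.contMDiffAt_two hU hx)
    (h.gauss_contMDiffAt_two hU hx)
  base_unit := (hU.eventually_mem hx).mono fun y hy =>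
    norm_rotate (h.mem y hy) (h.gauss_unit y hy) (h.inner_gauss hy)
  field_contMDiffAt := contMDiffAt_rotate (hθ.of_le one_le_two) (h.gauss_contMDiffAt_one hU hx)
    (h.contMDiffAt_one hU hx).neg
  nullDir := by
    filter_upwards [hU.mem_nhds hx, eventually_contMDiffAt (k := 1) (hθ.of_le one_le_two)]
      with y hy hθy using h.nullDir_rotationLift hU hy hθy
  injective := by
    filter_upwards [hU.mem_nhds hx, eventually_contMDiffAt (k := 1) (hθ.of_le one_le_two), hinj]
      with y hy hθy hinjy
    rwa [reduced_rotationLift hθy (h.contMDiffAt_one hU hy) (h.gauss_contMDiffAt_one hU hy)]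

end IsHypersurfaceOn

end RotationLift

section NullLift

variable {n : ℕ} {M : Type*} [TopologicalSpace M] [ChartedSpace (EuclideanSpace ℝ (Fin n)) M]
  {x : M} {U : Set M}

namespace IsNullField

variable {F : M → Euc n × ℝ} {N : M → Euc n}

theorem firstForm_pos (h : IsNullField F N x) {v : EuclideanSpace ℝ (Fin n)} (hv : v ≠ 0) :
    0 < firstForm (lorForm n) F x v v := by
  rw [firstForm, ← h.nullDir.self_of_nhds.inner_reduced, real_inner_self_pos]
  exact (map_ne_zero_iff _ h.injective.self_of_nhds).2 hv

variable [IsManifold (𝓡 n) ∞ M]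

theorem lorForm_meanCurvature_self_eq_zero (h : IsNullField F N x)
    (h0 : lorForm n (meanCurvatureL F x) (N x, 1) = 0) :
    lorForm n (meanCurvatureL F x) (meanCurvatureL F x) = 0 := by
  have hN := h.nullDir.self_of_nhds
  have hinj := h.injective.self_of_nhds
  obtain ⟨N', hN', hne⟩ := hN.exists_ne h.inner_base_diff hinj
  have hmem := mem_normalSpace_lorForm_iff.1 (meanCurvature_mem_normalSpace (n := n)
    (B := lorForm n) (W := productTangent n) (f := F) x)
  exact (hN.lorForm_self_eq_zero_iff hN' hne h.inner_base h.inner_base_diff hinj hmem.1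
    hmem.2).2 (Or.inl h0)

end IsNullField

namespace IsHypersurfaceOn

variable [IsManifold (𝓡 n) ∞ M] {φ ν : M → Euc n} {s : M → ℝ}

theorem contMDiffAt_rootFunction (hn : n ≠ 0) (h : IsHypersurfaceOn φ ν U) (hU : IsOpen U)
    (hs : IsRootFunctionOn φ ν s U) (hx : x ∈ U) : ContMDiffAt (𝓡 n) 𝓘(ℝ, ℝ) 2 s x := by
  obtain ⟨ψ, -, hψ, -, huniq⟩ := h.exists_rootFunction hn hU hx (hs.2 x hx)
  exact hψ.congr_of_eventuallyEq (huniq s (hs.1.continuousAt (hU.mem_nhds hx)) rfl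
    ((hU.eventually_mem hx).mono hs.2))

theorem isNullField_nullLift (hn : n ≠ 0) (h : IsHypersurfaceOn φ ν U) (hU : IsOpen U)
    (hs : IsRootFunctionOn φ ν s U) (hx : x ∈ U) :
    IsNullField (nullLift φ ν s) (rotate (fun y => arccot (s y)) ν (-φ)) x := by
  rw [nullLift_eq_rotationLift]
  refine h.isNullField_rotationLift hU hx ((contMDiffAt_iff_contDiffAt.2
    contDiff_arccot.contDiffAt).comp x (h.contMDiffAt_rootFunction hn hU hs hx)) ?_
  filter_upwards [hU.mem_nhds hx] with y hy
  rw [cos_arccot, ← smul_smul, ← smul_add]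
  exact (smul_right_injective _ (sin_arccot_ne_zero _)).comp ((h.isRoot_iff hU hy).1 (hs.2 y hy)).1

theorem lorForm_meanCurvature_nullLift (hn : n ≠ 0) (h : IsHypersurfaceOn φ ν U) (hU : IsOpen U)
    (hs : IsRootFunctionOn φ ν s U) (hx : x ∈ U) :
    lorForm n (meanCurvatureL (nullLift φ ν s) x)
      (rotate (fun y => arccot (s y)) ν (-φ) x, 1) = 0 := by
  obtain ⟨hinj, htrace⟩ := (h.isRoot_iff hU hx).1 (hs.2 x hx)
  have hφ := h.contMDiffAt_one hU hx
  have hν := h.gauss_contMDiffAt_one hU hx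
  have hθ : ContMDiffAt (𝓡 n) 𝓘(ℝ, ℝ) 1 (fun y => arccot (s y)) x :=
    ((contMDiffAt_iff_contDiffAt.2 contDiff_arccot.contDiffAt).comp x
      (h.contMDiffAt_rootFunction hn hU hs hx)).of_le one_le_two
  rw [(h.isNullField_nullLift hn hU hs hx).lorForm_meanCurvature, nullLift_eq_rotationLift,
    reduced_rotationLift hθ hφ hν, twist_rotationLift hθ hφ hν, cos_arccot, ← smul_smul,
    ← smul_smul, ← smul_add, ← smul_sub, relTrace_smul_smul hinj
      ((h.isShapePair hU hx).exists_smul_sub_eq (notMem_shapeSet_iff.2 hinj))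
      (sin_arccot_ne_zero _), htrace, neg_zero]

theorem isMarginallyTrappedOn_nullLift (hn : n ≠ 0) (h : IsHypersurfaceOn φ ν U)
    (hU : IsOpen U) (hs : IsRootFunctionOn φ ν s U) :
    IsMarginallyTrappedOn 2 (nullLift φ ν s) U := by
  have hnull := fun y (hy : y ∈ U) => h.isNullField_nullLift hn hU hs hy
  exact ⟨⟨fun y hy => (hnull y hy).contMDiffAt.contMDiffWithinAt,
    fun y hy => (hnull y hy).base_unit.self_of_nhds, fun y hy _ => (hnull y hy).firstForm_pos⟩,
    fun y hy => (hnull y hy).lorForm_meanCurvature_self_eq_zero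
      (h.lorForm_meanCurvature_nullLift hn hU hs hy)⟩

end IsHypersurfaceOn

end NullLift

/-! ### Ordering the roots -/

theorem exists_strictMono_range_eq {α : Type*} [LinearOrder α] {S : Set α} {q : ℕ}
    (hS : S.encard = q) : ∃ e : Fin q → α, StrictMono e ∧ Set.range e = S := by
  have hfin := Set.finite_of_encard_eq_coe hS
  rw [hfin.encard_eq_coe_toFinset_card, Nat.cast_inj] at hS
  refine ⟨hfin.toFinset.orderEmbOfFin hS, OrderEmbedding.strictMono _, ?_⟩
  rw [Finset.range_orderEmbOfFin, hfin.coe_toFinset]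

theorem strictMono_eq_of_range_subset {ι α : Type*} [LinearOrder ι] [Finite ι] [PartialOrder α]
    {e e' : ι → α} (he : StrictMono e) (he' : StrictMono e') (h : Set.range e ⊆ Set.range e') :
    e = e' := by
  refine (he.range_inj he').1 ((Set.finite_range e).eq_of_subset_of_encard_le h ?_)
  rw [← Set.image_univ, ← Set.image_univ, he.injective.encard_image, he'.injective.encard_image]

section Roots

variable {n : ℕ} {M : Type*} [TopologicalSpace M] [ChartedSpace (EuclideanSpace ℝ (Fin n)) M]
  [IsManifold (𝓡 n) ∞ M] {φ ν : M → Euc n} {U : Set M}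

namespace IsHypersurfaceOn

theorem isRootFunctionOn_of_strictMono (hn : n ≠ 0) (h : IsHypersurfaceOn φ ν U) (hU : IsOpen U)
    {ι : Type*} [LinearOrder ι] [Finite ι] {s : ι → M → ℝ}
    (hmono : ∀ x ∈ U, StrictMono fun i => s i x)
    (hrange : ∀ x ∈ U, Set.range (fun i => s i x) = {t | (trapPoly φ ν x).IsRoot t}) (i : ι) :
    IsRootFunctionOn φ ν (s i) U := by
  have hroot : ∀ x ∈ U, ∀ j, (trapPoly φ ν x).IsRoot (s j x) := fun x hx j =>
    (hrange x hx).subset ⟨j, rfl⟩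
  refine ⟨fun x hx => ContinuousAt.continuousWithinAt ?_, fun x hx => hroot x hx i⟩
  choose ψ hψx hψ hψroot _ using fun j => h.exists_rootFunction hn hU hx (hroot x hx j)
  have hψmono : ∀ᶠ y in 𝓝 x, StrictMono fun j => ψ j y := by
    refine Filter.eventually_all.2 fun j => Filter.eventually_all.2 fun k =>
      Filter.eventually_imp_distrib_left.2 fun hjk => ?_
    refine (hψ j).continuousAt.eventually_lt (hψ k).continuousAt ?_
    simpa only [hψx] using hmono x hx hjk
  refine (hψ i).continuousAt.congr ?_
  filter_upwards [hψmono, Filter.eventually_all.2 hψroot, hU.mem_nhds hx] with y hmonoy hrooty hy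
  refine congrFun (strictMono_eq_of_range_subset hmonoy (hmono y hy) ?_) i
  rw [hrange y hy]
  exact Set.range_subset_iff.2 hrooty

theorem exists_rootFunctions (hn : n ≠ 0) (h : IsHypersurfaceOn φ ν U) (hU : IsOpen U) {q : ℕ}
    (hq : ∀ x ∈ U, {t | (trapPoly φ ν x).IsRoot t}.encard = q) :
    ∃ s : Fin q → M → ℝ,
      (∀ x ∈ U, Function.Injective (fun i => s i x) ∧
        Set.range (fun i => s i x) = {t | (trapPoly φ ν x).IsRoot t}) ∧
      ∀ i, IsRootFunctionOn φ ν (s i) U ∧ IsMarginallyTrappedOn 2 (nullLift φ ν (s i)) U := by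
  have henum : ∀ x, ∃ e : Fin q → ℝ, x ∈ U →
      StrictMono e ∧ Set.range e = {t | (trapPoly φ ν x).IsRoot t} := fun x => by
    by_cases hx : x ∈ U
    · exact (exists_strictMono_range_eq (hq x hx)).imp fun _ he _ => he
    · exact ⟨fun _ => 0, fun hxU => absurd hxU hx⟩
  choose e he using henum
  have hroot : ∀ i, IsRootFunctionOn φ ν (fun x => e x i) U :=
    h.isRootFunctionOn_of_strictMono hn hU (fun x hx => (he x hx).1) fun x hx => (he x hx).2
  exact ⟨fun i x => e x i, fun x hx => ⟨(he x hx).1.injective, (he x hx).2⟩,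
    fun i => ⟨hroot i, h.isMarginallyTrappedOn_nullLift hn hU (hroot i)⟩⟩

end IsHypersurfaceOn

end Roots

/-! ### Marginally trapped immersions are null lifts -/

theorem exists_injective_smul_sub {E V : Type*} [NormedAddCommGroup E] [InnerProductSpace ℝ E]
    [FiniteDimensional ℝ E] [NormedAddCommGroup V] [InnerProductSpace ℝ V] [CompleteSpace V]
    {P : E →L[ℝ] V} (hP : Function.Injective P) (Q : E →L[ℝ] V) :
    ∃ s : ℝ, Function.Injective (s • P - Q) := by
  have hcont : ContinuousAt (fun t : ℝ => P - t • Q) 0 := by fun_prop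
  have hnear : ∀ᶠ t : ℝ in 𝓝 0, Function.Injective (P - t • Q) :=
    eventually_injective hcont (by rwa [zero_smul, sub_zero])
  obtain ⟨t, ht, ht0⟩ :=
    ((hnear.filter_mono nhdsWithin_le_nhds).and (self_mem_nhdsWithin (s := {0}ᶜ))).exists
  refine ⟨t⁻¹, ?_⟩
  have hfactor : t⁻¹ • P - Q = t⁻¹ • (P - t • Q) := by rw [smul_sub, inv_smul_smul₀ ht0]
  rw [hfactor]
  exact (smul_right_injective V (inv_ne_zero ht0)).comp ht

theorem eventually_injective_diff {n : ℕ} {M : Type*} [TopologicalSpace M]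
    [ChartedSpace (EuclideanSpace ℝ (Fin n)) M] [IsManifold (𝓡 n) ∞ M] {V : Type*}
    [NormedAddCommGroup V] [InnerProductSpace ℝ V] [CompleteSpace V] {f : M → V} {x : M}
    (hf : ContMDiffAt (𝓡 n) 𝓘(ℝ, V) 1 f x) (hinj : Function.Injective (diff (n := n) f x)) :
    ∀ᶠ y in 𝓝 x, Function.Injective (diff (n := n) f y) := by
  have hxs := mem_extChartAt_source (I := 𝓡 n) x
  rw [← (hasFDerivAt_inChart hf).fderiv] at hinj
  filter_upwards [eventually_contMDiffAt (k := 1) hf, extChartAt_source_mem_nhds (I := 𝓡 n) x,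
    eventually_of_inChart (eventually_injective
      (contDiffAt_fderiv_inChart (k := 0) hxs hf).continuousAt hinj)] with y hfy hys hy
  rw [diff_eq_fderiv_comp_chartChange hys hfy]
  exact hy.2.comp (bijective_chartChange hys).injective

section Slice

variable {n : ℕ} {M : Type*} {F : M → Euc n × ℝ} {N : M → Euc n} {c : ℝ} {x : M}

/-- The point at which the null geodesic issued from `F y` in the direction `(N y, 1)` crosses the
slice `𝕊ⁿ⁺¹ × {-c}`. It recovers a hypersurface from its null lifts. -/
def slicePoint (F : M → Euc n × ℝ) (N : M → Euc n) (c : ℝ) : M → Euc n :=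
  rotate (fun y => (F y).2 + c) (fun y => (F y).1) (-N)

/-- The horizontal part of the velocity of the null geodesic issued from `F y` in the direction
`(N y, 1)`, at its crossing with the slice `𝕊ⁿ⁺¹ × {-c}`. It is the Gauss map of `slicePoint`. -/
def sliceNormal (F : M → Euc n × ℝ) (N : M → Euc n) (c : ℝ) : M → Euc n :=
  rotate (fun y => (F y).2 + c) N (fun y => (F y).1)

theorem nullLift_slice (hc : (F x).2 + c ∈ Set.Ioo 0 Real.pi) :
    nullLift (slicePoint F N c) (sliceNormal F N c) (fun y => Real.cot ((F y).2 + c)) x =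
      ((F x).1, (F x).2 + c) := by
  rw [nullLift_eq_rotationLift]
  have harccot := arccot_cot hc
  refine Prod.ext ?_ harccot
  rw [rotationLift, rotate, harccot]
  exact rotate_rotate_neg (θ := fun y => (F y).2 + c)

variable [TopologicalSpace M] [ChartedSpace (EuclideanSpace ℝ (Fin n)) M]

theorem contMDiffAt_snd_add_const {k : WithTop ℕ∞}
    (hF : ContMDiffAt (𝓡 n) 𝓘(ℝ, Euc n × ℝ) k F x) (c : ℝ) :
    ContMDiffAt (𝓡 n) 𝓘(ℝ, ℝ) k (fun y => (F y).2 + c) x :=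
  (contMDiffAt_snd_apply hF).add contMDiffAt_const

theorem contMDiffAt_slicePoint {k : WithTop ℕ∞} (hF : ContMDiffAt (𝓡 n) 𝓘(ℝ, Euc n × ℝ) k F x)
    (hN : ContMDiffAt (𝓡 n) 𝓘(ℝ, Euc n) k N x) (c : ℝ) :
    ContMDiffAt (𝓡 n) 𝓘(ℝ, Euc n) k (slicePoint F N c) x :=
  contMDiffAt_rotate (contMDiffAt_snd_add_const hF c) (contMDiffAt_fst_apply hF) hN.neg

theorem contMDiffAt_sliceNormal {k : WithTop ℕ∞} (hF : ContMDiffAt (𝓡 n) 𝓘(ℝ, Euc n × ℝ) k F x)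
    (hN : ContMDiffAt (𝓡 n) 𝓘(ℝ, Euc n) k N x) (c : ℝ) :
    ContMDiffAt (𝓡 n) 𝓘(ℝ, Euc n) k (sliceNormal F N c) x :=
  contMDiffAt_rotate (contMDiffAt_snd_add_const hF c) hN (contMDiffAt_fst_apply hF)

namespace IsNullField

theorem norm_slicePoint (h : IsNullField F N x) : ‖slicePoint F N c x‖ = 1 := by
  refine norm_rotate h.base_unit.self_of_nhds ((norm_neg _).trans
    h.nullDir.self_of_nhds.norm_eq_one) ?_
  rw [Pi.neg_apply, inner_neg_right, real_inner_comm, h.nullDir.self_of_nhds.perp, neg_zero]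

theorem norm_sliceNormal (h : IsNullField F N x) : ‖sliceNormal F N c x‖ = 1 :=
  norm_rotate h.nullDir.self_of_nhds.norm_eq_one h.base_unit.self_of_nhds
    h.nullDir.self_of_nhds.perp

theorem inner_slicePoint_sliceNormal (h : IsNullField F N x) :
    ⟪slicePoint F N c x, sliceNormal F N c x⟫ = 0 :=
  inner_rotate_neg_rotate h.nullDir.self_of_nhds.norm_eq_one h.base_unit.self_of_nhds
    h.nullDir.self_of_nhds.perp

variable [IsManifold (𝓡 n) ∞ M]

theorem diff_snd_add_const (h : IsNullField F N x) (c : ℝ) (v : EuclideanSpace ℝ (Fin n)) :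
    diff (fun y => (F y).2 + c) x v = (diff F x v).2 := by
  rw [diff_eq_of_hasFDerivAt (contMDiffAt_snd_add_const h.contMDiffAt_one c)
    ((hasFDerivAt_inChart h.contMDiffAt_one).snd.add_const c)]
  rfl

theorem diff_slicePoint (h : IsNullField F N x) (c : ℝ) :
    diff (n := n) (slicePoint F N c) x =
      Real.cos ((F x).2 + c) • reduced (diff F x) (N x) -
        Real.sin ((F x).2 + c) • twist F N x := by
  ext v : 1
  rw [slicePoint, diff_rotate (g := -N) (contMDiffAt_snd_add_const h.contMDiffAt_one c)
    (contMDiffAt_fst_apply h.contMDiffAt_one) h.field_contMDiffAt.neg,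
    diff_neg h.field_contMDiffAt, diff_fst_apply h.contMDiffAt_one, h.diff_snd_add_const]
  simp only [_root_.sub_apply, _root_.smul_apply, _root_.neg_apply, twist_apply, reduced_apply,
    rotate, Pi.neg_apply]
  module

theorem diff_sliceNormal (h : IsNullField F N x) (c : ℝ) :
    diff (n := n) (sliceNormal F N c) x =
      Real.sin ((F x).2 + c) • reduced (diff F x) (N x) +
        Real.cos ((F x).2 + c) • twist F N x := by
  ext v : 1
  rw [sliceNormal, diff_rotate (contMDiffAt_snd_add_const h.contMDiffAt_one c)
    h.field_contMDiffAt (contMDiffAt_fst_apply h.contMDiffAt_one),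
    diff_fst_apply h.contMDiffAt_one, h.diff_snd_add_const]
  simp only [_root_.add_apply, _root_.smul_apply, twist_apply, reduced_apply, rotate,
    Pi.neg_apply]
  module

theorem cot_smul_diff_slicePoint_add (h : IsNullField F N x)
    (hsin : Real.sin ((F x).2 + c) ≠ 0) :
    Real.cot ((F x).2 + c) • diff (n := n) (slicePoint F N c) x + diff (sliceNormal F N c) x =
      (Real.sin ((F x).2 + c))⁻¹ • reduced (diff F x) (N x) := by
  rw [h.diff_slicePoint, h.diff_sliceNormal, Real.cot_eq_cos_div_sin]
  match_scalars <;> field_simp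
  · exact Real.cos_sq_add_sin_sq _
  · ring

theorem cot_smul_diff_sliceNormal_sub (h : IsNullField F N x)
    (hsin : Real.sin ((F x).2 + c) ≠ 0) :
    Real.cot ((F x).2 + c) • diff (n := n) (sliceNormal F N c) x - diff (slicePoint F N c) x =
      (Real.sin ((F x).2 + c))⁻¹ • twist F N x := by
  rw [h.diff_slicePoint, h.diff_sliceNormal, Real.cot_eq_cos_div_sin]
  match_scalars <;> field_simp
  · ring
  · rw [sub_neg_eq_add]
    exact Real.cos_sq_add_sin_sq _

theorem inner_sliceNormal_diff_slicePoint (h : IsNullField F N x)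
    (v : EuclideanSpace ℝ (Fin n)) :
    ⟪sliceNormal F N c x, diff (slicePoint F N c) x v⟫ = 0 := by
  have hdir := h.nullDir.self_of_nhds
  rw [h.diff_slicePoint]
  refine inner_rotate_eq_zero ?_ ?_
  · rw [_root_.sub_apply, _root_.smul_apply, _root_.smul_apply, inner_sub_right,
      real_inner_smul_right, real_inner_smul_right, hdir.inner_reduced_left, h.inner_field_twist,
      mul_zero, mul_zero, sub_zero]
  · rw [_root_.sub_apply, _root_.smul_apply, _root_.smul_apply, inner_sub_right,
      real_inner_smul_right, real_inner_smul_right, hdir.inner_base_reduced h.inner_base_diff,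
      h.inner_base_twist, mul_zero, mul_zero, sub_zero]

end IsNullField

variable {O : Set M} [IsManifold (𝓡 n) ∞ M]

theorem isHypersurfaceOn_slice (h : ∀ y ∈ O, IsNullField F N y)
    (hφ : ContMDiffOn (𝓡 n) 𝓘(ℝ, Euc n) 4 (slicePoint F N c) O)
    (hν : ContMDiffOn (𝓡 n) 𝓘(ℝ, Euc n) 3 (sliceNormal F N c) O)
    (hinj : ∀ y ∈ O, Function.Injective (diff (n := n) (slicePoint F N c) y)) :
    IsHypersurfaceOn (slicePoint F N c) (sliceNormal F N c) O where
  contMDiffOn := hφ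
  mem y hy := (h y hy).norm_slicePoint
  immersion := hinj
  gauss_contMDiffOn := hν
  gauss_unit y hy := (h y hy).norm_sliceNormal
  gauss_normal y hy := mem_normalSpace_eucForm_iff.2
    ⟨(h y hy).inner_slicePoint_sliceNormal, (h y hy).inner_sliceNormal_diff_slicePoint⟩

theorem isRootFunctionOn_slice (h : ∀ y ∈ O, IsNullField F N y) (hO : IsOpen O)
    (hslice : IsHypersurfaceOn (slicePoint F N c) (sliceNormal F N c) O)
    (hsin : ∀ y ∈ O, Real.sin ((F y).2 + c) ≠ 0)
    (htrace : ∀ y ∈ O, lorForm n (meanCurvatureL F y) (N y, 1) = 0) :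
    IsRootFunctionOn (slicePoint F N c) (sliceNormal F N c)
      (fun y => Real.cot ((F y).2 + c)) O := by
  refine ⟨fun y hy => ContinuousAt.continuousWithinAt ?_, fun y hy => ?_⟩
  · have hθ := (contMDiffAt_snd_add_const (h y hy).contMDiffAt c).continuousAt
    simp only [Real.cot_eq_cos_div_sin]
    exact (Real.continuous_cos.continuousAt.comp hθ).div
      (Real.continuous_sin.continuousAt.comp hθ) (hsin y hy)
  · have hinj := (h y hy).injective.self_of_nhds
    have hsin' := inv_ne_zero (hsin y hy)
    rw [hslice.isRoot_iff hO hy, (h y hy).cot_smul_diff_slicePoint_add (hsin y hy),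
      (h y hy).cot_smul_diff_sliceNormal_sub (hsin y hy),
      relTrace_smul_smul hinj (h y hy).exists_twist_eq hsin']
    refine ⟨(smul_right_injective _ hsin').comp hinj, ?_⟩
    rw [← neg_eq_zero, ← (h y hy).lorForm_meanCurvature, htrace y hy]

theorem IsNullField.exists_injective_diff_slicePoint (h : IsNullField F N x) :
    ∃ c, (F x).2 + c ∈ Set.Ioo 0 Real.pi ∧
      Function.Injective (diff (n := n) (slicePoint F N c) x) := by
  obtain ⟨s, hs⟩ := exists_injective_smul_sub h.injective.self_of_nhds (twist F N x)
  have hc : (F x).2 + (arccot s - (F x).2) = arccot s := add_sub_cancel _ _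
  refine ⟨arccot s - (F x).2, by rw [hc]; exact arccot_mem_Ioo s, ?_⟩
  have hdiff : diff (n := n) (slicePoint F N (arccot s - (F x).2)) x =
      Real.sin (arccot s) • (s • reduced (diff F x) (N x) - twist F N x) := by
    rw [h.diff_slicePoint, hc, cos_arccot]
    module
  rw [hdiff]
  exact (smul_right_injective _ (sin_arccot_ne_zero s)).comp hs

theorem IsNullField.isLocallyNullLift (h : IsNullField F N x)
    (hF : ContMDiffAt (𝓡 n) 𝓘(ℝ, Euc n × ℝ) 4 F x) (hN : ContMDiffAt (𝓡 n) 𝓘(ℝ, Euc n) 4 N x)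
    (htrace : ∀ᶠ y in 𝓝 x, lorForm n (meanCurvatureL F y) (N y, 1) = 0) :
    IsLocallyNullLift F x := by
  obtain ⟨c, hc, hinj⟩ := h.exists_injective_diff_slicePoint
  have hφ := contMDiffAt_slicePoint hF hN c
  have hθ : ∀ᶠ y in 𝓝 x, (F y).2 + c ∈ Set.Ioo 0 Real.pi :=
    (contMDiffAt_snd_add_const hF c).continuousAt.eventually (isOpen_Ioo.mem_nhds hc)
  obtain ⟨O, hOprop, hO, hxO⟩ := eventually_nhds_iff.1 <|
    ((h.eventually.and (eventually_contMDiffAt (k := 4) hφ)).and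
      ((eventually_contMDiffAt (k := 4) (contMDiffAt_sliceNormal hF hN c)).and
        (eventually_injective_diff (hφ.of_le (by norm_num)) hinj))).and (hθ.and htrace)
  have hnull : ∀ y ∈ O, IsNullField F N y := fun y hy => (hOprop y hy).1.1.1
  have hslice : IsHypersurfaceOn (slicePoint F N c) (sliceNormal F N c) O :=
    isHypersurfaceOn_slice hnull
      (fun y hy => (hOprop y hy).1.1.2.contMDiffWithinAt)
      (fun y hy => ((hOprop y hy).1.2.1.of_le (by norm_num)).contMDiffWithinAt)
      fun y hy => (hOprop y hy).1.2.2
  exact ⟨O, hO, hxO, slicePoint F N c, sliceNormal F N c, fun y => Real.cot ((F y).2 + c), c,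
    hslice,
    isRootFunctionOn_slice hnull hO hslice
      (fun y hy => (Real.sin_pos_of_mem_Ioo (hOprop y hy).2.1).ne') fun y hy => (hOprop y hy).2.2,
    fun y hy => (nullLift_slice (hOprop y hy).2.1).symm⟩

end Slice

section Converse

variable {n : ℕ} {M : Type*} [TopologicalSpace M] [ChartedSpace (EuclideanSpace ℝ (Fin n)) M]
  {F : M → Euc n × ℝ} {x : M} {U : Set M}

theorem IsLocallyNullLift.eventually (h : IsLocallyNullLift F x) :
    ∀ᶠ y in 𝓝 x, IsLocallyNullLift F y := by
  obtain ⟨O, hO, hxO, hlift⟩ := h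
  exact (hO.eventually_mem hxO).mono fun y hy => ⟨O, hO, hy, hlift⟩

namespace IsSpacelikeOn

theorem contMDiffAt {k : WithTop ℕ∞} (h : IsSpacelikeOn k F U) (hU : IsOpen U) (hx : x ∈ U) :
    ContMDiffAt (𝓡 n) 𝓘(ℝ, Euc n × ℝ) k F x :=
  h.contMDiffOn.contMDiffAt (hU.mem_nhds hx)

theorem nondegenerate {k : WithTop ℕ∞} (h : IsSpacelikeOn k F U) (hx : x ∈ U)
    (v : EuclideanSpace ℝ (Fin n))
    (hv : ∀ w : EuclideanSpace ℝ (Fin n), lorForm n (diff F x v) (diff F x w) = 0) : v = 0 := by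
  by_contra hv0
  exact (h.spacelike x hx v hv0).ne' (hv v)

variable [IsManifold (𝓡 n) ∞ M]

theorem exists_nullField {k : ℕ} (hk : k ≠ 0) (h : IsSpacelikeOn (k + 1 : ℕ) F U) (hU : IsOpen U)
    (hx : x ∈ U) {q : Euc n} (hq : NullDir (F x).1 q (diff F x)) :
    ∃ N : M → Euc n, N x = q ∧ ContMDiffAt (𝓡 n) 𝓘(ℝ, Euc n) k N x ∧ IsNullField F N x ∧
      ∀ N' : M → Euc n, ContinuousAt N' x → N' x = q →
        (∀ᶠ y in 𝓝 x, NullDir (F y).1 (N' y) (diff F y)) → N' =ᶠ[𝓝 x] N :=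
  MarginallyTrapped.exists_nullField hk (h.contMDiffAt hU hx) ((hU.eventually_mem hx).mono h.mem)
    hq (hq.injective_reduced (h.nondegenerate hx))

end IsSpacelikeOn

theorem IsNullNormalOn.nullDir {ξ : M → Euc n × ℝ} (hξ : IsNullNormalOn F ξ U) (hx : x ∈ U) :
    (ξ x).2 ≠ 0 ∧ NullDir (F x).1 ((ξ x).2⁻¹ • (ξ x).1) (diff F x) := by
  obtain ⟨hne, hnull, hnormal⟩ := hξ.2 x hx
  rw [mem_normalSpace_lorForm_iff] at hnormal
  exact nullDir_of_null hne hnull hnormal.1 hnormal.2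

theorem inv_snd_smul_eq {V : Type*} [AddCommGroup V] [Module ℝ V] {ζ : V × ℝ} (hζ : ζ.2 ≠ 0) :
    (ζ.2⁻¹ • ζ.1, (1 : ℝ)) = ζ.2⁻¹ • ζ :=
  Prod.ext rfl (inv_mul_cancel₀ hζ).symm

variable [IsManifold (𝓡 n) ∞ M]

theorem isLocallyNullLift_of_nullNormal (hU : IsOpen U) (h : IsMarginallyTrappedOn 5 F U)
    (hx : x ∈ U) {O : Set M} {ξ : M → Euc n × ℝ} (hO : IsOpen O) (hxO : x ∈ O)
    (hξ : IsNullNormalOn F ξ O) (hH : ∀ y ∈ O, lorForm n (meanCurvatureL F y) (ξ y) = 0) :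
    IsLocallyNullLift F x := by
  have hξx : ContinuousAt ξ x := hξ.1.continuousAt (hO.mem_nhds hxO)
  obtain ⟨N, -, hN, hnull, huniq⟩ :=
    h.1.exists_nullField four_ne_zero hU hx (hξ.nullDir hxO).2
  have hξN : (fun y => (ξ y).2⁻¹ • (ξ y).1) =ᶠ[𝓝 x] N :=
    huniq _ ((hξx.snd.inv₀ (hξ.nullDir hxO).1).smul hξx.fst) rfl
      ((hO.eventually_mem hxO).mono fun y hy => (hξ.nullDir hy).2)
  refine hnull.isLocallyNullLift ((h.1.contMDiffAt hU hx).of_le (by norm_num)) hN ?_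
  filter_upwards [hξN, hO.mem_nhds hxO] with y hy hyO
  rw [← hy, inv_snd_smul_eq (hξ.nullDir hyO).1, map_smul, hH y hyO, smul_zero]

theorem isLocallyNullLift_of_meanCurvature_ne_zero (hU : IsOpen U)
    (h : IsMarginallyTrappedOn 5 F U) (hx : x ∈ U) (hne : meanCurvatureL F x ≠ 0) :
    IsLocallyNullLift F x := by
  have hmem := fun y => mem_normalSpace_lorForm_iff.1 (meanCurvature_mem_normalSpace (n := n)
    (B := lorForm n) (W := productTangent n) (f := F) y)
  obtain ⟨hH2, hdir⟩ := nullDir_of_null hne (h.2 x hx) (hmem x).1 (hmem x).2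
  obtain ⟨N, hNx, hN, hnull, -⟩ := h.1.exists_nullField four_ne_zero hU hx hdir
  rw [← hNx] at hdir
  obtain ⟨q, hq, hNq⟩ := hdir.exists_ne hnull.inner_base_diff hnull.injective.self_of_nhds
  obtain ⟨N', hN'x, -, hnull', -⟩ := h.1.exists_nullField four_ne_zero hU hx hq
  have htrace : relTrace (reduced (diff F x) (N' x)) (twist F N' x) ≠ 0 := by
    have hmul : lorForm n (N x, 1) (q, 1) =
        (meanCurvatureL F x).2⁻¹ * lorForm n (meanCurvatureL F x) (q, 1) := by
      rw [hNx, inv_snd_smul_eq hH2, map_smul, LinearMap.smul_apply, smul_eq_mul]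
    rw [← neg_ne_zero, ← hnull'.lorForm_meanCurvature, hN'x]
    exact right_ne_zero_of_mul (hmul ▸ hdir.lorForm_ne_zero hq hNq)
  refine hnull.isLocallyNullLift ((h.1.contMDiffAt hU hx).of_le (by norm_num)) hN ?_
  filter_upwards [hnull.eventually, hnull'.eventually, hU.mem_nhds hx,
    hnull'.eventually_relTrace_ne_zero htrace,
    (hnull.field_contMDiffAt.continuousAt.sub hnull'.field_contMDiffAt.continuousAt).eventually_ne
      (sub_ne_zero.2 (hN'x ▸ hNq))] with y hy hy' hyU htracey hney
  refine ((hy.nullDir.self_of_nhds.lorForm_self_eq_zero_iff hy'.nullDir.self_of_nhds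
    (sub_ne_zero.1 hney)
    hy.inner_base hy.inner_base_diff hy.injective.self_of_nhds (hmem y).1 (hmem y).2).1
    (h.2 y hyU)).resolve_right ?_
  rwa [hy'.lorForm_meanCurvature, neg_eq_zero]

theorem isLocallyNullLift_of_eventually_meanCurvature_eq_zero (hU : IsOpen U)
    (h : IsMarginallyTrappedOn 5 F U) (hx : x ∈ U)
    (h0 : ∀ᶠ y in 𝓝 x, meanCurvatureL F y = 0) : IsLocallyNullLift F x := by
  have hF := h.1.contMDiffAt hU hx
  obtain ⟨q, hq⟩ := exists_nullDir (inner_fst_diff_eq_zero (hF.of_le (by norm_num))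
    ((hU.eventually_mem hx).mono h.1.mem)) (h.1.spacelike x hx)
  obtain ⟨N, -, hN, hnull, -⟩ := h.1.exists_nullField four_ne_zero hU hx hq
  refine hnull.isLocallyNullLift (hF.of_le (by norm_num)) hN (h0.mono fun y hy => ?_)
  rw [hy, map_zero, LinearMap.zero_apply]

theorem exists_open_dense_isLocallyNullLift (hU : IsOpen U) (h : IsMarginallyTrappedOn 5 F U) :
    ∃ O : Set M, IsOpen O ∧ O ⊆ U ∧ U ⊆ closure O ∧
      (∀ x ∈ U, meanCurvatureL F x ≠ 0 → x ∈ O) ∧ ∀ x ∈ O, IsLocallyNullLift F x := by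
  have hne : ∀ x ∈ U, meanCurvatureL F x ≠ 0 → x ∈ {x | x ∈ U ∧ IsLocallyNullLift F x} :=
    fun x hx hH => ⟨hx, isLocallyNullLift_of_meanCurvature_ne_zero hU h hx hH⟩
  refine ⟨{x | x ∈ U ∧ IsLocallyNullLift F x}, isOpen_iff_mem_nhds.2 fun x hx =>
    (hU.eventually_mem hx.1).and hx.2.eventually, fun x hx => hx.1, fun x hx => ?_, hne,
    fun x hx => hx.2⟩
  by_cases h0 : ∀ᶠ y in 𝓝 x, meanCurvatureL F y = 0
  · exact subset_closure
      ⟨hx, isLocallyNullLift_of_eventually_meanCurvature_eq_zero hU h hx h0⟩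
  · rw [mem_closure_iff_frequently]
    exact ((Filter.not_eventually.1 h0).and_eventually (hU.mem_nhds hx)).mono fun y hy =>
      hne y hy.2 hy.1

end Converse

/-! ### Surfaces -/

theorem isRoot_weightedPoly_pair {κ₁ κ₂ a t : ℝ} {m : ℝ → ℝ} (hne : κ₁ ≠ κ₂) (hm₁ : m κ₁ = 1)
    (hm₂ : m κ₂ = 1) (hsum : κ₁ + κ₂ ≠ 0) (ha : a * (κ₁ + κ₂) = κ₁ * κ₂ - 1) :
    (weightedPoly {κ₁, κ₂} m).IsRoot t ↔ t = a - √(a ^ 2 + 1) ∨ t = a + √(a ^ 2 + 1) := by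
  have hsq : √(a ^ 2 + 1) ^ 2 = a ^ 2 + 1 := Real.sq_sqrt (by positivity)
  have hfactor : (weightedPoly {κ₁, κ₂} m).eval t =
      (κ₁ + κ₂) * ((t - (a - √(a ^ 2 + 1))) * (t - (a + √(a ^ 2 + 1)))) := by
    rw [eval_weightedPoly, Finset.sum_pair hne, hm₁, hm₂,
      Finset.erase_insert (Finset.notMem_singleton.2 hne), Finset.pair_comm,
      Finset.erase_insert (Finset.notMem_singleton.2 hne.symm), Finset.prod_singleton,
      Finset.prod_singleton]
    linear_combination 2 * t * ha + (κ₁ + κ₂) * hsq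
  rw [IsRoot.def, hfactor, mul_eq_zero, or_iff_right hsum, mul_eq_zero, sub_eq_zero, sub_eq_zero]

section Surface

variable {n : ℕ} {M : Type*}

/-- The roots `a ± √(a² + 1)` of the polynomial of a surface, the sign being `ε = ±1`. -/
def surfaceRoot (ε : ℝ) (a : M → ℝ) (x : M) : ℝ := a x + ε * √(a x ^ 2 + 1)

theorem surfaceLift_eq_nullLift {ε : ℝ} (hε : ε ^ 2 = 1) (φ ν : M → Euc n) (a : M → ℝ) :
    surfaceLift ε φ ν a = nullLift φ ν (surfaceRoot ε a) := by
  funext x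
  have hnorm : 1 + surfaceRoot ε a x ^ 2 = 2 * (a x ^ 2 + 1 + ε * (a x * √(a x ^ 2 + 1))) := by
    have hsq : √(a x ^ 2 + 1) ^ 2 = a x ^ 2 + 1 := Real.sq_sqrt (by positivity)
    rw [surfaceRoot]
    linear_combination ε ^ 2 * hsq + (a x ^ 2 + 1) * hε
  rw [nullLift, hnorm, Real.sqrt_mul zero_le_two]
  rfl

namespace IsHypersurfaceOn

variable [TopologicalSpace M] [ChartedSpace (EuclideanSpace ℝ (Fin n)) M] [IsManifold (𝓡 n) ∞ M]
  {φ ν : M → Euc n} {U : Set M} {κ₁ κ₂ : M → ℝ}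

theorem isRoot_surface_iff (hn : n = 2) (h : IsHypersurfaceOn φ ν U) (hU : IsOpen U) {x : M}
    (hx : x ∈ U) (hH : meanCurvatureS φ x ≠ 0)
    (hκ : principalCurvatures φ ν x = {κ₁ x, κ₂ x}) (hne : κ₁ x ≠ κ₂ x) {t : ℝ} :
    (trapPoly φ ν x).IsRoot t ↔ t = surfaceRoot (-1) (surfaceParam κ₁ κ₂) x ∨
      t = surfaceRoot 1 (surfaceParam κ₁ κ₂) x := by
  have hpair := h.isShapePair hU hx
  have hset : shapeSet (diff (n := n) φ x) (diff ν x) = {κ₁ x, κ₂ x} := hκ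
  have hK : hpair.finite.toFinset = {κ₁ x, κ₂ x} := by
    ext μ
    rw [Set.Finite.mem_toFinset, hset, Finset.mem_insert, Finset.mem_singleton]
    rfl
  have hm : ∀ μ ∈ ({κ₁ x, κ₂ x} : Set ℝ),
      (shapeMult (diff (n := n) φ x) (diff ν x) μ : ℝ) = 1 := fun μ hμ => by
    rw [hpair.shapeMult_eq_one (by rw [hset, Set.ncard_pair hne, finrank_euclideanSpace_fin, hn])
      (hset ▸ hμ), Nat.cast_one]
  have hm₁ := hm (κ₁ x) (Set.mem_insert _ _)
  have hm₂ := hm (κ₂ x) (Set.mem_insert_of_mem _ rfl)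
  have hsum : κ₁ x + κ₂ x ≠ 0 := by
    rwa [Ne, h.meanCurvature_eq_zero_iff hU hx, hK, Finset.sum_pair hne, hm₁, hm₂, one_mul,
      one_mul] at hH
  rw [h.trapPoly_eq hU hx, hK, isRoot_weightedPoly_pair hne hm₁ hm₂ hsum
    (div_mul_cancel₀ _ hsum), surfaceRoot, surfaceRoot, neg_one_mul, one_mul, ← sub_eq_add_neg]
  rfl

theorem isRootFunctionOn_surfaceRoot (hn : n = 2) (h : IsHypersurfaceOn φ ν U) (hU : IsOpen U)
    (hH : ∀ x ∈ U, meanCurvatureS φ x ≠ 0)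
    (hκ : ∀ x ∈ U, principalCurvatures φ ν x = {κ₁ x, κ₂ x} ∧ κ₁ x ≠ κ₂ x) (i : Fin 2) :
    IsRootFunctionOn φ ν (surfaceRoot (![-1, 1] i) (surfaceParam κ₁ κ₂)) U := by
  refine h.isRootFunctionOn_of_strictMono (by omega) hU
    (s := fun i => surfaceRoot (![-1, 1] i) (surfaceParam κ₁ κ₂)) (fun x _ => ?_) (fun x hx => ?_) i
  · have hpos : 0 < √(surfaceParam κ₁ κ₂ x ^ 2 + 1) := by positivity
    have hsign : StrictMono ![(-1 : ℝ), 1] := by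
      rw [Fin.strictMono_iff_lt_succ]
      simp
    exact fun i j hij => add_lt_add_right (mul_lt_mul_of_pos_right (hsign hij) hpos) _
  · ext t
    rw [Set.mem_ofPred_eq, h.isRoot_surface_iff hn hU hx (hH x hx) (hκ x hx).1 (hκ x hx).2]
    simp only [Set.mem_range, Fin.exists_fin_two, Matrix.cons_val_zero, Matrix.cons_val_one,
      eq_comm (a := t)]

theorem isMarginallyTrappedOn_surfaceLift (hn : n = 2) (h : IsHypersurfaceOn φ ν U)
    (hU : IsOpen U) (hH : ∀ x ∈ U, meanCurvatureS φ x ≠ 0)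
    (hκ : ∀ x ∈ U, principalCurvatures φ ν x = {κ₁ x, κ₂ x} ∧ κ₁ x ≠ κ₂ x) :
    IsMarginallyTrappedOn 2 (surfaceLift 1 φ ν (surfaceParam κ₁ κ₂)) U ∧
      IsMarginallyTrappedOn 2 (surfaceLift (-1) φ ν (surfaceParam κ₁ κ₂)) U := by
  have hn0 : n ≠ 0 := by omega
  rw [surfaceLift_eq_nullLift (one_pow 2), surfaceLift_eq_nullLift neg_one_sq]
  exact ⟨h.isMarginallyTrappedOn_nullLift hn0 hU (h.isRootFunctionOn_surfaceRoot hn hU hH hκ 1),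
    h.isMarginallyTrappedOn_nullLift hn0 hU (h.isRootFunctionOn_surfaceRoot hn hU hH hκ 0)⟩

end IsHypersurfaceOn

end Surface

end MarginallyTrapped

end

open MarginallyTrapped in
theorem theorem3 (n : ℕ) (hn : 1 ≤ n) {M : Type*} [TopologicalSpace M]
    [ChartedSpace (EuclideanSpace ℝ (Fin n)) M] [IsManifold (𝓡 n) ∞ M]
    (U : Set M) (hU : IsOpen U) :
    -- null second fundamental form
    (2 ≤ n → ∀ F : M → Euc n × ℝ, IsNondegenerateOn 2 F U →
      HasNullSecondFormOn F U → IsTotallyGeodesicOn F U) ∧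
    -- hypersurfaces of the sphere
    (∀ φ ν : M → Euc n, IsHypersurfaceOn φ ν U →
      -- number of roots
      (∀ x ∈ U,
        (meanCurvatureS φ x = 0 →
          {s | (trapPoly φ ν x).IsRoot s}.encard
            = (((principalCurvatures φ ν x).ncard - 1 : ℕ) : ℕ∞)) ∧
        (meanCurvatureS φ x ≠ 0 →
          {s | (trapPoly φ ν x).IsRoot s}.encard
            = ((principalCurvatures φ ν x).ncard : ℕ∞))) ∧
      -- every continuous root gives a marginally trapped immersion
      (∀ s : M → ℝ, IsRootFunctionOn φ ν s U →
        IsMarginallyTrappedOn 2 (nullLift φ ν s) U) ∧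
      -- when there are `p` distinct principal curvatures everywhere, the roots are `p - 1`
      -- (minimal case) or `p` continuous functions, with their marginally trapped immersions
      (∀ p : ℕ, (∀ x ∈ U, (principalCurvatures φ ν x).encard = (p : ℕ∞)) →
        ((∀ x ∈ U, meanCurvatureS φ x = 0) →
          ∃ s : Fin (p - 1) → M → ℝ,
            (∀ x ∈ U, Function.Injective (fun i => s i x) ∧
              Set.range (fun i => s i x) = {t | (trapPoly φ ν x).IsRoot t}) ∧
            ∀ i, IsRootFunctionOn φ ν (s i) U ∧
              IsMarginallyTrappedOn 2 (nullLift φ ν (s i)) U) ∧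
        ((∀ x ∈ U, meanCurvatureS φ x ≠ 0) →
          ∃ s : Fin p → M → ℝ,
            (∀ x ∈ U, Function.Injective (fun i => s i x) ∧
              Set.range (fun i => s i x) = {t | (trapPoly φ ν x).IsRoot t}) ∧
            ∀ i, IsRootFunctionOn φ ν (s i) U ∧
              IsMarginallyTrappedOn 2 (nullLift φ ν (s i)) U))) ∧
    -- converse
    (∀ F : M → Euc n × ℝ, IsMarginallyTrappedOn 5 F U →
      (∀ x ∈ U, ∀ (N : Set M) (ξ : M → Euc n × ℝ), IsOpen N → x ∈ N → N ⊆ U →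
        IsNullNormalOn F ξ N → (∀ y ∈ N, lorForm n (meanCurvatureL F y) (ξ y) = 0) →
        IsLocallyNullLift F x) ∧
      ∃ O : Set M, IsOpen O ∧ O ⊆ U ∧ U ⊆ closure O ∧
        (∀ x ∈ U, meanCurvatureL F x ≠ 0 → x ∈ O) ∧ ∀ x ∈ O, IsLocallyNullLift F x) ∧
    -- surfaces
    (n = 2 → ∀ φ ν : M → Euc n, IsHypersurfaceOn φ ν U →
      (∀ x ∈ U, meanCurvatureS φ x ≠ 0) →
      ∀ κ₁ κ₂ : M → ℝ,
        (∀ x ∈ U, principalCurvatures φ ν x = {κ₁ x, κ₂ x} ∧ κ₁ x ≠ κ₂ x) →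
        IsMarginallyTrappedOn 2 (surfaceLift 1 φ ν (surfaceParam κ₁ κ₂)) U ∧
        IsMarginallyTrappedOn 2 (surfaceLift (-1) φ ν (surfaceParam κ₁ κ₂)) U) := by
  have hn0 : n ≠ 0 := Nat.one_le_iff_ne_zero.1 hn
  refine ⟨fun hn2 F hF hnull => isTotallyGeodesicOn_of_null hn2 hU hF hnull,
    fun φ ν h => ⟨fun x hx => h.encard_roots hn0 hU hx,
      fun s hs => h.isMarginallyTrappedOn_nullLift hn0 hU hs, fun p hp => ?_⟩,
    fun F hF => ⟨fun x hx N ξ hN hxN _ hξ hH =>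
      isLocallyNullLift_of_nullNormal hU hF hx hN hxN hξ hH,
      exists_open_dense_isLocallyNullLift hU hF⟩,
    fun hn2 φ ν h hH κ₁ κ₂ hκ => h.isMarginallyTrappedOn_surfaceLift hn2 hU hH hκ⟩
  have hncard : ∀ x ∈ U, (principalCurvatures φ ν x).ncard = p := fun x hx => by
    rw [Set.ncard, hp x hx, ENat.toNat_natCast]
  refine ⟨fun hH => h.exists_rootFunctions hn0 hU fun x hx => ?_,
    fun hH => h.exists_rootFunctions hn0 hU fun x hx => ?_⟩
  · rw [(h.encard_roots hn0 hU hx).1 (hH x hx), hncard x hx]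
  · rw [(h.encard_roots hn0 hU hx).2 (hH x hx), hncard x hx]
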